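/- Let $\mathbb K$ be a field of characteristic zero and let $\mathfrak h$ be the three-dimensional Heisenberg Lie algebra over $\mathbb K$, with basis $x_1,x_{-1},h_0$ whose only non-zero bracket is $[x_1,x_{-1}]=h_0$ (up to antisymmetry), and dual basis $x^{-1},x^{1},h^{0}$ of $\mathfrak h^*$ (so $x^{-1}(x_1)=x^{1}(x_{-1})=h^0(h_0)=1$). The group $G=\mathrm{SL}(2,\mathbb K)$ acts on $\mathfrak h$ by Lie algebra automorphisms, canonically on $\langle x_1,x_{-1}\rangle\cong\mathbb K^2$ (with $x_1=(1,0)$, $x_{-1}=(0,1)$) and trivially on $h_0$; hence it acts on $C=\bigoplus_{p,q}\Lambda^p\mathfrak h^*\otimes\Lambda^q\mathfrak h$. Give $C$ the product $(\varphi\otimes v)\vee(\psi\otimes w)=(-1)^{\deg v\,\deg\psi}(\varphi\wedge\psi)\otimes(v\wedge w)$ and the Chevalley–Eilenberg differential $\Lambda^p\mathfrak h^*\otimes\Lambda^q\mathfrak h\to\Lambda^{p+1}\mathfrak h^*\otimes\Lambda^q\mathfrak h$ of $\mathfrak h$ with coefficients in the module $\Lambda\mathfrak h$ (adjoint action). The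 product $\vee$ induces the cup product on $H_E^{\bullet,\bullet}(\mathfrak h)=\bigoplus_{p+q\text{ even}}H^p(\mathfrak h,\Lambda^q\mathfrak h)$, and $G$ acts on this space. **Labeling.** Let $V_0=\mathbb K$ (trivial), $V_1=\mathbb K^2$ (canonical), $V_2=\mathfrak{sl}(2,\mathbb K)$ (adjoint), with highest weight vectors $\bar v_0=1$, $\bar v_1=(1,0)$, $\bar v_2=\begin{pmatrix}0&1\\0&0\end{pmatrix}$. Let $m^{0,i,i}(a\otimes v)=av=m^{i,0,i}(v\otimes a)$ and $$m^{1,1,0}(x\otimes y)=x_1y_2-x_2y_1,\qquad m^{1,1,2}(x\otimes y)=\begin{pmatrix}x_1y_2+x_2y_1&-2x_1y_1\\2x_2y_2&-x_1y_2-x_2y_1\end{pmatrix},$$ $$m^{2,1,1}(A\otimes x)=xA^t=m^{1,2,1}(x\otimes A),\qquad m^{2,2,0}(A\otimes B)=\operatorname{tr}(AB),\qquad m^{2,2,2}(A\otimes B)=AB-BA,$$ and $m^{i,j,k}=0$ for all other triples $i,j,k\in\{0,1,2\}$. **Highest weight vectors.** Consider ten components $H_k^{p,q}$ and the following cochains $z$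 (wedge signs omitted): $$\begin{array}{ll} H_0^{0,0}:\ 1\otimes 1 & H_1^{2,0}:\ x^1h^0\otimes 1\\ H_0^{1,1}:\ x^1\otimes x_{-1}+x^{-1}\otimes x_1+2h^0\otimes h_0 & H_2^{1,1}:\ x^1\otimes x_1\\ H_1^{3,1}:\ x^{-1}x^1h^0\otimes x_1 & H_1^{0,2}:\ 1\otimes x_1h_0\\ H_0^{2,2}:\ x^{-1}x^1\otimes x_1x_{-1} & H_2^{2,2}:\ x^1h^0\otimes x_1h_0\\ H_1^{1,3}:\ x^1\otimes x_1x_{-1}h_0 & H_0^{3,3}:\ x^{-1}x^1h^0\otimes x_1x_{-1}h_0 \end{array}$$ **Theorem.** (a) $V_0,V_1,V_2$ are irreducible and pairwise non-isomorphic, and for all $i,j,k\in\{0,1,2\}$ the space $\operatorname{Hom}_G(V_i\otimes V_j,V_k)$ has basis $\{m^{i,j,k}\}$ if $m^{i,j,k}$ is one of the maps displayed above, and is zero otherwise. $G$ acts on $H_E^{\bullet,\bullet}(\mathfrak h)$ by automorphisms of the cup product. (b) The ten cochains $z$ are cocycles, and there is exactly one family of $G$-morphisms $\tau_r:V_k\to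 H_E^{\bullet,\bullet}(\mathfrak h)$, one for each component $r=H_k^{p,q}$, such that $\tau_r(\bar v_k)$ is the class of the cochain of $r$. Each $\tau_r$ is injective with image in $H^p(\mathfrak h,\Lambda^q\mathfrak h)$; writing $H_k^{p,q}$ for this image, $H_E^{\bullet,\bullet}(\mathfrak h)$ is the direct sum of the ten $H_k^{p,q}$. (c) With respect to these $\tau_r$, the $G$-table of the cup product, that is, the unique family of scalars $c_{r_1,r_2}^{s}$ (indexed by the triples of components $r_1,r_2,s$, of weights $k_1,k_2,k$, with $\operatorname{Hom}_G(V_{k_1}\otimes V_{k_2},V_k)\neq0$) such that $$\tau_{r_1}(x)\vee\tau_{r_2}(y)=\sum_s c_{r_1,r_2}^{s}\,\tau_s\big(m^{k_1,k_2,k}(x\otimes y)\big)\qquad(x\in V_{k_1},\ y\in V_{k_2}),$$ is the following, where $r_1\vee r_2=\sum_s c_{r_1,r_2}^s\,s$ is the entry in row $r_1$ and column $r_2$ and empty entries are $0$: $$\begin{array}{c||ccccc|ccccc} \vee & H_{0}^{0,0} & H_{0}^{1,1} & H_{2}^{1,1} & H_{1}^{2,0} & H_{1}^{0,2} & H_{0}^{2,2}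 & H_{2}^{2,2} & H_{1}^{3,1} & H_{1}^{1,3} & H_{0}^{3,3}\\ \hline H_{0}^{0,0} & H_{0}^{0,0} & H_{0}^{1,1} & H_{2}^{1,1} & H_{1}^{2,0} & H_{1}^{0,2} & H_{0}^{2,2} & H_{2}^{2,2} & H_{1}^{3,1} & H_{1}^{1,3} & H_{0}^{3,3}\\ H_{0}^{1,1} & H_{0}^{1,1} & -6H_{0}^{2,2} & -2H_{2}^{2,2} & H_{1}^{3,1} & -H_{1}^{1,3} & 2H_{0}^{3,3}&&&&\\ H_{2}^{1,1} & H_{2}^{1,1} & -2H_{2}^{2,2} & H_{0}^{2,2} & H_{1}^{3,1} & H_{1}^{1,3} & & -H_{0}^{3,3}&&&\\ H_{1}^{2,0} & H_{1}^{2,0} & H_{1}^{3,1} & H_{1}^{3,1} & & \frac{1}{2}H_{0}^{2,2}-\frac{1}{2}H_{2}^{2,2} & & & & -H_{0}^{3,3}&\\ H_{1}^{0,2} & H_{1}^{0,2} & -H_{1}^{1,3} &H_{1}^{1,3} & -\frac{1}{2}H_{0}^{2,2}-\frac{1}{2}H_{2}^{2,2} & & & & -H_{0}^{3,3}&&\\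 H_{0}^{2,2} & H_{0}^{2,2} & 2H_{0}^{3,3} & & & &&&&&\\ H_{2}^{2,2} & H_{2}^{2,2} & & -H_{0}^{3,3} & & &&&&&\\ H_{1}^{3,1} & H_{1}^{3,1} & & & & H_{0}^{3,3}&&&&&\\ H_{1}^{1,3} & H_{1}^{1,3} & & & H_{0}^{3,3} & &&&&&\\ H_{0}^{3,3} & H_{0}^{3,3} & & & & &&&&& \end{array}$$ -/

import Mathlib

open scoped TensorProduct Matrix

universe u v

namespace CupTable

/-! ### The super-commutative algebra `Λ𝔤* ⊗ Λ𝔤` -/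

section Cochains

variable (K : Type u) [Field K] (L : Type u) [AddCommGroup L] [Module K L]

/-- The space `C = ⨁ Λᵖ𝔤* ⊗ Λ^q 𝔤`.  Its product `∨` is the product of the graded tensor product of
the two exterior algebras, `(φ ⊗ v) ∨ (ψ ⊗ w) = (-1)^(deg v * deg ψ) (φ ∧ ψ) ⊗ (v ∧ w)`. -/
abbrev Cochain : Type u :=
  (fun p : ℕ => ⋀[K]^p (Module.Dual K L)) ᵍ⊗[K] (fun q : ℕ => ⋀[K]^q L)

/-! Shortcuts for instance search, all equal to the instances found by Mathlib. -/

noncomputable instance : Ring (Cochain K L) := inferInstance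

noncomputable instance : Algebra K (Cochain K L) := inferInstance

noncomputable instance : AddCommGroup (Cochain K L) := inferInstance

noncomputable instance : AddCommMonoid (Cochain K L) := inferInstance

noncomputable instance : Module K (Cochain K L) := inferInstance

noncomputable instance : Monoid (Cochain K L) := inferInstance

noncomputable instance : Mul (Cochain K L) := inferInstance

noncomputable instance : One (Cochain K L) := inferInstance

noncomputable instance : Semiring (Cochain K L) := inferInstance

noncomputable instance : NonUnitalNonAssocRing (Cochain K L) := inferInstance

noncomputable instance : NonUnitalNonAssocSemiring (Cochain K L) := inferInstance

noncomputable instance : NonAssocSemiring (Cochain K L) := inferInstance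

noncomputable instance : AddMonoid (Cochain K L) := inferInstance

noncomputable instance : AddGroup (Cochain K L) := inferInstance

noncomputable instance : SubtractionMonoid (Cochain K L) := inferInstance

noncomputable instance : AddZeroClass (Cochain K L) := inferInstance

noncomputable instance : Zero (Cochain K L) := inferInstance

noncomputable instance : Add (Cochain K L) := inferInstance

noncomputable instance : Neg (Cochain K L) := inferInstance

noncomputable instance : Sub (Cochain K L) := inferInstance

instance : IsScalarTower K (Cochain K L) (Cochain K L) := inferInstance

instance : SMulCommClass K (Cochain K L) (Cochain K L) := inferInstance

variable {K L}

/-- The pure tensor `φ ⊗ w` in `C`, as a bilinear map. -/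
noncomputable def tens : ExteriorAlgebra K (Module.Dual K L) →ₗ[K] ExteriorAlgebra K L →ₗ[K]
    Cochain K L :=
  (TensorProduct.mk K _ _).compr₂ (GradedTensorProduct.of K _ _).toLinearMap

theorem tens_apply (φ : ExteriorAlgebra K (Module.Dual K L)) (w : ExteriorAlgebra K L) :
    tens φ w = φ ᵍ⊗ₜ[K] w := rfl

variable (K L) in
/-- The bihomogeneous component `C^{p,q} = Λᵖ𝔤* ⊗ Λ^q 𝔤`. -/
noncomputable def bidegree (p q : ℕ) : Submodule K (Cochain K L) :=
  Submodule.span K {x | ∃ φ ∈ ⋀[K]^p (Module.Dual K L), ∃ w ∈ ⋀[K]^q L, x = tens φ w}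

variable (K L) in
/-- The even part of `C`: the sum of the `C^{p,q}` with `p + q` even. -/
noncomputable def evenPart : Submodule K (Cochain K L) :=
  ⨆ (p : ℕ) (q : ℕ) (_ : Even (p + q)), bidegree K L p q

/-- The linear map `φ ⊗ w ↦ S φ ⊗ T w` on `C`. -/
noncomputable def tensorMap
    (S : ExteriorAlgebra K (Module.Dual K L) →ₗ[K] ExteriorAlgebra K (Module.Dual K L))
    (T : ExteriorAlgebra K L →ₗ[K] ExteriorAlgebra K L) : Cochain K L →ₗ[K] Cochain K L :=
  (GradedTensorProduct.of K _ _).toLinearMap ∘ₗ TensorProduct.map S T ∘ₗ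
    (GradedTensorProduct.of K _ _).symm.toLinearMap

@[simp] theorem tensorMap_tens
    (S : ExteriorAlgebra K (Module.Dual K L) →ₗ[K] ExteriorAlgebra K (Module.Dual K L))
    (T : ExteriorAlgebra K L →ₗ[K] ExteriorAlgebra K L) (φ w) :
    tensorMap S T (tens φ w) = tens (S φ) (T w) := rfl

theorem one_eq_tens : (1 : Cochain K L) = tens 1 1 := rfl

theorem tens_induction {P : Cochain K L → Prop} (hz : P 0)
    (ha : ∀ x y, P x → P y → P (x + y)) (hp : ∀ φ w, P (tens φ w)) (x : Cochain K L) : P x :=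
  TensorProduct.induction_on (motive := fun t => P (GradedTensorProduct.of K _ _ t)) x hz hp
    (fun _ _ => ha _ _)

theorem left_mul_tens (φ ψ : ExteriorAlgebra K (Module.Dual K L)) (w : ExteriorAlgebra K L) :
    tens φ 1 * tens ψ w = tens (φ * ψ) w := by
  induction ψ using DirectSum.Decomposition.inductionOn
    (fun p : ℕ => ⋀[K]^p (Module.Dual K L)) with
  | zero => simp
  | homogeneous ψ =>
    exact GradedTensorProduct.tmul_one_mul_coe_tmul
      (fun p : ℕ => ⋀[K]^p (Module.Dual K L)) (fun q : ℕ => ⋀[K]^q L) φ ψ w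
  | add ψ ψ' h h' => simp only [map_add, LinearMap.add_apply, mul_add, h, h']

theorem involute_of_mem {M : Type u} [AddCommGroup M] [Module K M] (p : ℕ)
    (x : ExteriorAlgebra K M) (hx : x ∈ ⋀[K]^p M) :
    CliffordAlgebra.involute x = (-1 : ℤˣ) ^ p • x := by
  induction hx using Submodule.pow_induction_on_left' with
  | algebraMap r => simp
  | add x y i hx hy h h' => rw [map_add, h, h', smul_add]
  | mem_mul m hm i x hx h =>
    obtain ⟨m, rfl⟩ := hm
    rw [map_mul, h, CliffordAlgebra.involute_ι, pow_succ]
    simp [mul_smul_comm]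

theorem ι_mul_tens (v : L) (ψ : ExteriorAlgebra K (Module.Dual K L)) (w : ExteriorAlgebra K L) :
    tens 1 (ExteriorAlgebra.ι K v) * tens ψ w =
      tens (CliffordAlgebra.involute ψ) (ExteriorAlgebra.ι K v * w) := by
  induction ψ using DirectSum.Decomposition.inductionOn
    (fun p : ℕ => ⋀[K]^p (Module.Dual K L)) with
  | zero => simp
  | @homogeneous i ψ =>
    have hv : ExteriorAlgebra.ι K v ∈ ⋀[K]^1 L := by simp [ExteriorAlgebra.exteriorPower]
    have := GradedTensorProduct.tmul_coe_mul_coe_tmul (R := K)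
      (fun p : ℕ => ⋀[K]^p (Module.Dual K L)) (fun q : ℕ => ⋀[K]^q L) 1 ⟨_, hv⟩ ψ w
    rw [involute_of_mem i _ ψ.2]
    rcases Int.units_eq_one_or ((-1 : ℤˣ) ^ i) with h | h <;>
      simpa [tens_apply, h] using this
  | add ψ ψ' h h' => simp only [map_add, LinearMap.add_apply, mul_add, h, h']

theorem tens_eq_mul (φ : ExteriorAlgebra K (Module.Dual K L)) (w : ExteriorAlgebra K L) :
    tens φ w = tens φ 1 * tens 1 w := by rw [left_mul_tens, mul_one]

theorem right_mul_right (w w' : ExteriorAlgebra K L) :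
    tens (1 : ExteriorAlgebra K (Module.Dual K L)) w * tens 1 w' = tens 1 (w * w') := by
  induction w using ExteriorAlgebra.induction generalizing w' with
  | algebraMap r => simp [Algebra.algebraMap_eq_smul_one, ← one_eq_tens]
  | ι v => rw [ι_mul_tens]; simp
  | add a b ha hb => simp only [map_add, add_mul, ha, hb]
  | mul a b ha hb => rw [← ha, mul_assoc, hb, ha, mul_assoc]

/-- `C` is generated by `𝔤*` and `𝔤`. -/
theorem generator_induction {P : Cochain K L → Prop} (hone : P 1)
    (hadd : ∀ x y, P x → P y → P (x + y)) (hsmul : ∀ (c : K) x, P x → P (c • x))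
    (hmul : ∀ x y, P x → P y → P (x * y))
    (hl : ∀ φ : Module.Dual K L, P (tens (ExteriorAlgebra.ι K φ) 1))
    (hr : ∀ v : L, P (tens 1 (ExteriorAlgebra.ι K v))) (x : Cochain K L) : P x := by
  have h1 : ∀ φ : ExteriorAlgebra K (Module.Dual K L), P (tens φ 1) := fun φ => by
    induction φ using ExteriorAlgebra.induction with
    | algebraMap r =>
      simpa [Algebra.algebraMap_eq_smul_one, ← one_eq_tens] using hsmul r _ hone
    | ι φ => exact hl φ
    | add a b ha hb => simpa using hadd _ _ ha hb
    | mul a b ha hb => simpa [left_mul_tens] using hmul _ _ ha hb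
  have h2 : ∀ w : ExteriorAlgebra K L, P (tens 1 w) := fun w => by
    induction w using ExteriorAlgebra.induction with
    | algebraMap r =>
      simpa [Algebra.algebraMap_eq_smul_one, ← one_eq_tens] using hsmul r _ hone
    | ι φ => exact hr φ
    | add a b ha hb => simpa using hadd _ _ ha hb
    | mul a b ha hb => simpa [right_mul_right] using hmul _ _ ha hb
  refine tens_induction ?_ hadd (fun φ w => ?_) x
  · simpa using hsmul 0 _ hone
  · rw [tens_eq_mul]; exact hmul _ _ (h1 φ) (h2 w)

/-- The parity automorphism of `C`, equal to `(-1)^(p+q)` on `C^{p,q}`. -/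
noncomputable def parity : Cochain K L →ₗ[K] Cochain K L :=
  tensorMap CliffordAlgebra.involute.toLinearMap CliffordAlgebra.involute.toLinearMap

theorem parity_tens (φ : ExteriorAlgebra K (Module.Dual K L)) (w : ExteriorAlgebra K L) :
    parity (tens φ w) = tens (CliffordAlgebra.involute φ) (CliffordAlgebra.involute w) := rfl

theorem parity_of_even (x : Cochain K L) (hx : x ∈ evenPart K L) : parity x = x := by
  have : evenPart K L ≤ LinearMap.eqLocus parity LinearMap.id := by
    refine iSup_le fun p => iSup_le fun q => iSup_le fun hpq => Submodule.span_le.2 ?_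
    rintro _ ⟨φ, hφ, w, hw, rfl⟩
    change parity (tens φ w) = tens φ w
    rw [parity_tens, involute_of_mem p φ hφ, involute_of_mem q w hw]
    rcases Nat.even_or_odd p with hp | hp
    · have hq : Even q := by rw [Nat.even_add] at hpq; exact hpq.1 hp
      simp [hp.neg_one_pow, hq.neg_one_pow]
    · have hq : Odd q := by grind
      simp [hp.neg_one_pow, hq.neg_one_pow]
  exact this hx

theorem one_mem_evenPart : (1 : Cochain K L) ∈ evenPart K L := by
  refine Submodule.mem_iSup_of_mem 0 (Submodule.mem_iSup_of_mem 0
    (Submodule.mem_iSup_of_mem (by simp) (Submodule.subset_span ⟨1, ?_, 1, ?_, rfl⟩))) <;>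
  simp [ExteriorAlgebra.exteriorPower]

theorem mul_mem_evenPart {x y : Cochain K L} (hx : x ∈ evenPart K L) (hy : y ∈ evenPart K L) :
    x * y ∈ evenPart K L := by
  have key : evenPart K L * evenPart K L ≤ evenPart K L := by
    simp only [evenPart, Submodule.iSup_mul, Submodule.mul_iSup]
    refine iSup_le fun p' => iSup_le fun q' => iSup_le fun h' => iSup_le fun p => iSup_le fun q =>
      iSup_le fun h => ?_
    rw [bidegree, bidegree, Submodule.span_mul_span]
    refine Submodule.span_le.2 ?_
    rintro _ ⟨_, ⟨φ, hφ, w, hw, rfl⟩, _, ⟨ψ, hψ, z, hz, rfl⟩, rfl⟩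
    have := GradedTensorProduct.tmul_coe_mul_coe_tmul (R := K)
      (fun p : ℕ => ⋀[K]^p (Module.Dual K L)) (fun q : ℕ => ⋀[K]^q L) φ ⟨w, hw⟩ ⟨ψ, hψ⟩ z
    have hmem : tens (φ * ψ) (w * z) ∈ evenPart K L := by
      refine Submodule.mem_iSup_of_mem (p + p') (Submodule.mem_iSup_of_mem (q + q')
        (Submodule.mem_iSup_of_mem (by grind) (Submodule.subset_span ⟨_, ?_, _, ?_, rfl⟩)))
      · exact SetLike.mul_mem_graded hφ hψ
      · exact SetLike.mul_mem_graded hw hz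
    change tens φ w * tens ψ z ∈ evenPart K L
    rw [tens_apply, tens_apply, this]
    rcases Int.units_eq_one_or ((-1 : ℤˣ) ^ (q * p')) with h | h
    · rw [h, one_smul]; exact hmem
    · rw [h, Units.neg_smul, one_smul]; exact Submodule.neg_mem _ hmem
  exact key (Submodule.mul_mem_mul hx hy)

end Cochains

/-! ### The Chevalley–Eilenberg differential -/

section Differential

variable {K : Type u} [Field K] {L : Type u} [AddCommGroup L] [Module K L]

/-- The linear map of `C` induced by a linear map of `𝔤*` and a linear map of `𝔤`. -/
noncomputable def cochainMap (F : Module.Dual K L →ₗ[K] Module.Dual K L) (G : L →ₗ[K] L) :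
    Cochain K L →ₗ[K] Cochain K L :=
  tensorMap (ExteriorAlgebra.map F).toLinearMap (ExteriorAlgebra.map G).toLinearMap

theorem cochainMap_tens (F : Module.Dual K L →ₗ[K] Module.Dual K L) (G : L →ₗ[K] L)
    (φ : ExteriorAlgebra K (Module.Dual K L)) (w : ExteriorAlgebra K L) :
    cochainMap F G (tens φ w) = tens (ExteriorAlgebra.map F φ) (ExteriorAlgebra.map G w) := rfl

theorem cochainMap_tens_one (F : Module.Dual K L →ₗ[K] Module.Dual K L) (G : L →ₗ[K] L)
    (φ : ExteriorAlgebra K (Module.Dual K L)) :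
    cochainMap F G (tens φ 1) = tens (ExteriorAlgebra.map F φ) 1 := by
  rw [cochainMap_tens, map_one (ExteriorAlgebra.map G)]

theorem cochainMap_one_tens (F : Module.Dual K L →ₗ[K] Module.Dual K L) (G : L →ₗ[K] L)
    (w : ExteriorAlgebra K L) :
    cochainMap F G (tens 1 w) = tens 1 (ExteriorAlgebra.map G w) := by
  rw [cochainMap_tens, map_one (ExteriorAlgebra.map F)]

theorem cochainMap_one (F : Module.Dual K L →ₗ[K] Module.Dual K L) (G : L →ₗ[K] L) :
    cochainMap F G 1 = 1 := by
  rw [one_eq_tens, cochainMap_one_tens, map_one (ExteriorAlgebra.map G)]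

theorem involute_eq_map {M : Type u} [AddCommGroup M] [Module K M] :
    (CliffordAlgebra.involute : ExteriorAlgebra K M →ₐ[K] _) =
      ExteriorAlgebra.map (-LinearMap.id) := by
  ext; simp

theorem map_involute {M : Type u} [AddCommGroup M] [Module K M] (F : M →ₗ[K] M)
    (x : ExteriorAlgebra K M) :
    ExteriorAlgebra.map F (CliffordAlgebra.involute x)
      = CliffordAlgebra.involute (ExteriorAlgebra.map F x) := by
  rw [involute_eq_map, ← AlgHom.comp_apply, ← AlgHom.comp_apply, ExteriorAlgebra.map_comp_map,
    ExteriorAlgebra.map_comp_map]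
  congr 2
  ext; simp

theorem cochainMap_mul (F : Module.Dual K L →ₗ[K] Module.Dual K L) (G : L →ₗ[K] L)
    (x y : Cochain K L) : cochainMap F G (x * y) = cochainMap F G x * cochainMap F G y := by
  revert y
  refine generator_induction (P := fun x => ∀ y, cochainMap F G (x * y)
    = cochainMap F G x * cochainMap F G y) (fun y => ?_) (fun x x' h h' y => ?_)
    (fun c x h y => ?_) (fun x x' h h' y => ?_) (fun φ y => ?_) (fun v y => ?_) x
  · rw [one_mul, cochainMap_one, one_mul]
  · rw [add_mul, map_add, h, h', map_add, add_mul]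
  · rw [smul_mul_assoc, map_smul, h, map_smul, smul_mul_assoc]
  · rw [mul_assoc, h, h', h, mul_assoc]
  · induction y using tens_induction with
    | hz => simp
    | ha a b ha hb => rw [mul_add, map_add, ha, hb, map_add, mul_add]
    | hp ψ w => rw [left_mul_tens, cochainMap_tens, cochainMap_tens_one, cochainMap_tens,
        left_mul_tens, map_mul]
  · induction y using tens_induction with
    | hz => simp
    | ha a b ha hb => rw [mul_add, map_add, ha, hb, map_add, mul_add]
    | hp ψ w => rw [ι_mul_tens, cochainMap_tens, cochainMap_one_tens, cochainMap_tens,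
        ExteriorAlgebra.map_apply_ι, ι_mul_tens, map_mul, ExteriorAlgebra.map_apply_ι,
        map_involute]

theorem parity_eq : (parity : Cochain K L →ₗ[K] _) =
    cochainMap (-LinearMap.id) (-LinearMap.id) := by
  rw [parity, cochainMap, involute_eq_map, involute_eq_map]

theorem parity_mul (x y : Cochain K L) : parity (x * y) = parity x * parity y := by
  rw [parity_eq, cochainMap_mul]

theorem parity_cochainMap (F : Module.Dual K L →ₗ[K] Module.Dual K L) (G : L →ₗ[K] L)
    (x : Cochain K L) : parity (cochainMap F G x) = cochainMap F G (parity x) := by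
  induction x using tens_induction with
  | hz => simp
  | ha a b ha hb => rw [map_add, map_add, ha, hb, map_add, map_add]
  | hp φ w => rw [cochainMap_tens, parity_tens, parity_tens, cochainMap_tens, map_involute,
      map_involute]

theorem cochainMap_mem_bidegree (F : Module.Dual K L →ₗ[K] Module.Dual K L) (G : L →ₗ[K] L)
    (p q : ℕ) : bidegree K L p q ≤ (bidegree K L p q).comap (cochainMap F G) := by
  have key {M : Type u} [AddCommGroup M] [Module K M] (f : M →ₗ[K] M) (n : ℕ)
      (x : ExteriorAlgebra K M) (hx : x ∈ ⋀[K]^n M) : ExteriorAlgebra.map f x ∈ ⋀[K]^n M := by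
    have h : (⋀[K]^n M).map (ExteriorAlgebra.map f).toLinearMap ≤ ⋀[K]^n M := by
      rw [ExteriorAlgebra.exteriorPower, Submodule.map_pow]
      refine pow_le_pow_left' ?_ n
      rintro _ ⟨_, ⟨m, rfl⟩, rfl⟩
      exact ⟨f m, by simp⟩
    exact h ⟨x, hx, rfl⟩
  refine Submodule.span_le.2 ?_
  rintro _ ⟨φ, hφ, w, hw, rfl⟩
  exact Submodule.subset_span ⟨_, key F p φ hφ, _, key G q w hw, rfl⟩

theorem cochainMap_mem_evenPart (F : Module.Dual K L →ₗ[K] Module.Dual K L) (G : L →ₗ[K] L)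
    {x : Cochain K L} (hx : x ∈ evenPart K L) : cochainMap F G x ∈ evenPart K L := by
  have : evenPart K L ≤ (evenPart K L).comap (cochainMap F G) :=
    iSup_le fun p => iSup_le fun q => iSup_le fun h => (cochainMap_mem_bidegree F G p q).trans
      (Submodule.comap_mono (le_iSup_of_le p (le_iSup_of_le q (le_iSup_of_le h le_rfl))))
  exact this hx

/-- `D (x ∨ y) = D x ∨ y + (-1)^{deg x} x ∨ D y`. -/
def IsSuperDerivation (D : Cochain K L →ₗ[K] Cochain K L) : Prop :=
  ∀ x y, D (x * y) = D x * y + parity x * D y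

theorem IsSuperDerivation.sub {D D' : Cochain K L →ₗ[K] Cochain K L}
    (h : IsSuperDerivation D) (h' : IsSuperDerivation D') : IsSuperDerivation (D - D') := by
  intro x y
  simp only [LinearMap.sub_apply, h x y, h' x y, sub_mul, mul_sub]
  abel

theorem IsSuperDerivation.sum {ι : Type} (s : Finset ι)
    (D : ι → Cochain K L →ₗ[K] Cochain K L) (h : ∀ i ∈ s, IsSuperDerivation (D i)) :
    IsSuperDerivation (∑ i ∈ s, D i) := by
  intro x y
  simp only [LinearMap.sum_apply, Finset.sum_mul, Finset.mul_sum, ← Finset.sum_add_distrib]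
  exact Finset.sum_congr rfl fun i hi => h i hi x y

theorem IsSuperDerivation.of_generators {D : Cochain K L →ₗ[K] Cochain K L} (hone : D 1 = 0)
    (hl : ∀ (φ : Module.Dual K L) ψ w, D (tens (ExteriorAlgebra.ι K φ * ψ) w) =
      D (tens (ExteriorAlgebra.ι K φ) 1) * tens ψ w
        - tens (ExteriorAlgebra.ι K φ) 1 * D (tens ψ w))
    (hr : ∀ (v : L) ψ w, D (tens (CliffordAlgebra.involute ψ) (ExteriorAlgebra.ι K v * w)) =
      D (tens 1 (ExteriorAlgebra.ι K v)) * tens ψ w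
        - tens 1 (ExteriorAlgebra.ι K v) * D (tens ψ w)) :
    IsSuperDerivation D := by
  intro x
  refine generator_induction (P := fun x => ∀ y, D (x * y) = D x * y + parity x * D y)
    (fun y => ?_) (fun x x' h h' y => ?_)
    (fun c x h y => ?_) (fun x x' h h' y => ?_) (fun φ y => ?_) (fun v y => ?_) x
  · rw [one_mul, hone, parity_eq, cochainMap_one, zero_mul, one_mul, zero_add]
  · rw [add_mul, map_add, h, h', map_add, map_add, add_mul, add_mul]; abel
  · rw [smul_mul_assoc, map_smul, h, map_smul, map_smul, smul_mul_assoc, smul_mul_assoc, smul_add]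
  · rw [mul_assoc, h, h', h, parity_mul]; simp only [mul_add, add_mul, mul_assoc, add_assoc]
  · rw [parity_eq, cochainMap_tens_one, ExteriorAlgebra.map_apply_ι]
    induction y using tens_induction with
    | hz => simp
    | ha a b ha hb => rw [mul_add, map_add, ha, hb, map_add, mul_add, mul_add]; abel
    | hp ψ w => rw [left_mul_tens, hl]; simp [sub_eq_add_neg]
  · rw [parity_eq, cochainMap_one_tens, ExteriorAlgebra.map_apply_ι]
    induction y using tens_induction with
    | hz => simp
    | ha a b ha hb => rw [mul_add, map_add, ha, hb, map_add, mul_add, mul_add]; abel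
    | hp ψ w => rw [ι_mul_tens, hr]; simp [sub_eq_add_neg]

theorem contractLeft_involute {M : Type u} [AddCommGroup M] [Module K M] (β : Module.Dual K M)
    (x : ExteriorAlgebra K M) :
    CliffordAlgebra.contractLeft β (CliffordAlgebra.involute x) =
      -CliffordAlgebra.involute (CliffordAlgebra.contractLeft β x) := by
  induction x using CliffordAlgebra.left_induction with
  | algebraMap r => simp
  | add x y hx hy => simp only [map_add, hx, hy, neg_add]
  | ι_mul m x hx =>
    simp only [map_mul, CliffordAlgebra.involute_ι, neg_mul, map_neg,
      CliffordAlgebra.contractLeft_ι_mul, map_sub, map_smul, hx, mul_neg]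

theorem ι_mul_comm {M : Type u} [AddCommGroup M] [Module K M] (v : M)
    (x : ExteriorAlgebra K M) :
    ExteriorAlgebra.ι K v * CliffordAlgebra.involute x = x * ExteriorAlgebra.ι K v := by
  induction x using CliffordAlgebra.left_induction with
  | algebraMap r => simp [Algebra.commutes]
  | add x y hx hy => simp only [map_add, mul_add, add_mul, hx, hy]
  | ι_mul x m hx =>
    have h := eq_neg_of_add_eq_zero_left (ExteriorAlgebra.ι_add_mul_swap (R := K) m v)
    rw [map_mul, CliffordAlgebra.involute_ι, ← mul_assoc, mul_neg]
    rw [← h, mul_assoc, mul_assoc, hx]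

theorem superDerivation_one (α β : Module.Dual K L) (v : L) :
    IsSuperDerivation (tensorMap (LinearMap.mulLeft K (ExteriorAlgebra.ι K α))
      (LinearMap.mulLeft K (ExteriorAlgebra.ι K v) ∘ₗ CliffordAlgebra.contractLeft β) :
        Cochain K L →ₗ[K] _) := by
  refine IsSuperDerivation.of_generators ?_ (fun φ ψ w => ?_) (fun z ψ w => ?_)
  · rw [one_eq_tens]; simp
  · have h := eq_neg_of_add_eq_zero_left (ExteriorAlgebra.ι_add_mul_swap (R := K) α φ)
    simp only [tensorMap_tens, LinearMap.mulLeft_apply, LinearMap.comp_apply,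
      CliffordAlgebra.contractLeft_one, map_zero, zero_mul, zero_sub, left_mul_tens]
    rw [← mul_assoc, h]
    simp [mul_assoc]
  · have h := eq_neg_of_add_eq_zero_left (ExteriorAlgebra.ι_add_mul_swap (R := K) v z)
    simp only [tensorMap_tens, LinearMap.mulLeft_apply, LinearMap.comp_apply,
      CliffordAlgebra.contractLeft_ι, CliffordAlgebra.contractLeft_ι_mul, mul_one,
      Algebra.algebraMap_eq_smul_one, ι_mul_tens, map_mul, CliffordAlgebra.involute_ι]
    rw [mul_smul_comm, mul_one, map_smul, tens_eq_mul (ExteriorAlgebra.ι K α), smul_mul_assoc,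
      mul_assoc, ι_mul_tens, left_mul_tens, mul_sub, map_sub, mul_smul_comm, map_smul, ← mul_assoc, h]
    simp [mul_assoc]

theorem superDerivation_two (α β : Module.Dual K L) (v : L) :
    IsSuperDerivation (tensorMap (LinearMap.mulLeft K (ExteriorAlgebra.ι K α *
      ExteriorAlgebra.ι K β) ∘ₗ CliffordAlgebra.contractLeft (Module.Dual.eval K L v))
      LinearMap.id : Cochain K L →ₗ[K] _) := by
  refine IsSuperDerivation.of_generators ?_ (fun φ ψ w => ?_) (fun z ψ w => ?_)
  · rw [one_eq_tens]; simp
  · have h := eq_neg_of_add_eq_zero_left (ExteriorAlgebra.ι_add_mul_swap (R := K) α φ)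
    have h' := eq_neg_of_add_eq_zero_left (ExteriorAlgebra.ι_add_mul_swap (R := K) β φ)
    have h2 : ExteriorAlgebra.ι K α * ExteriorAlgebra.ι K β * ExteriorAlgebra.ι K φ =
        ExteriorAlgebra.ι K φ * (ExteriorAlgebra.ι K α * ExteriorAlgebra.ι K β) := by
      rw [mul_assoc, h', mul_neg, ← mul_assoc, h, neg_mul, neg_neg, mul_assoc]
    simp only [tensorMap_tens, LinearMap.mulLeft_apply, LinearMap.comp_apply, LinearMap.id_apply,
      CliffordAlgebra.contractLeft_ι, CliffordAlgebra.contractLeft_ι_mul, left_mul_tens,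
      Algebra.algebraMap_eq_smul_one]
    rw [mul_sub, ← mul_assoc, h2]
    simp [mul_assoc]
  · simp only [tensorMap_tens, LinearMap.mulLeft_apply, LinearMap.comp_apply, LinearMap.id_apply,
      CliffordAlgebra.contractLeft_one, map_zero, LinearMap.zero_apply, zero_mul,
      zero_sub, ι_mul_tens, contractLeft_involute, map_mul, CliffordAlgebra.involute_ι]
    simp

end Differential


section LieAlgebra

variable {K : Type u} [Field K] {L : Type u} [LieRing L] [LieAlgebra K L]

/-- The action of `x ∈ 𝔤` on `Λ𝔤` extending the adjoint action as a derivation: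
`x • w = ∑ₖ [x, eₖ] ∧ ι_{eᵏ} w` for a basis `eₖ` of `𝔤` with dual basis `eᵏ`. -/
noncomputable def extAd {n : ℕ} (b : Module.Basis (Fin n) K L) (x : L) :
    ExteriorAlgebra K L →ₗ[K] ExteriorAlgebra K L :=
  ∑ k, LinearMap.mulLeft K (ExteriorAlgebra.ι K ⁅x, b k⁆) ∘ₗ
    CliffordAlgebra.contractLeft (b.coord k)

/-- The Chevalley–Eilenberg differential `Λᵖ𝔤* ⊗ Λ𝔤 → Λᵖ⁺¹𝔤* ⊗ Λ𝔤` of the Lie algebra `𝔤` with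
coefficients in the `𝔤`-module `Λ𝔤`, in terms of a basis `eᵢ` of `𝔤` with dual basis `eⁱ`:
`d (φ ⊗ w) = ∑ᵢ (eⁱ ∧ φ) ⊗ (eᵢ • w) - ∑_{i<j} (eⁱ ∧ eʲ ∧ ι_{[eᵢ, eⱼ]} φ) ⊗ w`. -/
noncomputable def differential {n : ℕ} (b : Module.Basis (Fin n) K L) :
    Cochain K L →ₗ[K] Cochain K L :=
  (∑ i, tensorMap (LinearMap.mulLeft K (ExteriorAlgebra.ι K (b.coord i))) (extAd b (b i))) -
  ∑ i, ∑ j ∈ Finset.Ioi i, tensorMap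
    (LinearMap.mulLeft K (ExteriorAlgebra.ι K (b.coord i) * ExteriorAlgebra.ι K (b.coord j)) ∘ₗ
      CliffordAlgebra.contractLeft (Module.Dual.eval K L ⁅b i, b j⁆)) LinearMap.id

theorem tensorMap_sum {ι : Type} (s : Finset ι)
    (S : ExteriorAlgebra K (Module.Dual K L) →ₗ[K] ExteriorAlgebra K (Module.Dual K L))
    (T : ι → ExteriorAlgebra K L →ₗ[K] ExteriorAlgebra K L) :
    tensorMap S (∑ i ∈ s, T i) = ∑ i ∈ s, tensorMap S (T i) := by
  refine LinearMap.ext fun x => ?_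
  induction x using tens_induction with
  | hz => simp
  | ha a b ha hb => rw [map_add, ha, hb, map_add]
  | hp φ w => simp [LinearMap.sum_apply]

/-- The differential is a super-derivation of `∨`. -/
theorem differential_mul {n : ℕ} (b : Module.Basis (Fin n) K L) :
    IsSuperDerivation (differential b) := by
  refine IsSuperDerivation.sub ?_ ?_
  · refine IsSuperDerivation.sum _ _ fun i _ => ?_
    rw [extAd, tensorMap_sum]
    exact IsSuperDerivation.sum _ _ fun k _ => superDerivation_one _ _ _
  · exact IsSuperDerivation.sum _ _ fun i _ => IsSuperDerivation.sum _ _ fun j _ =>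
      superDerivation_two _ _ _

/-! ### The even cohomology and its cup product -/

variable {n : ℕ} (b : Module.Basis (Fin n) K L)

/-- The even cocycles: `ker d` in the even part of `C`. -/
noncomputable def evenCocycles : Submodule K (Cochain K L) :=
  LinearMap.ker (differential b) ⊓ evenPart K L

/-- The even coboundaries, as a subspace of the even cocycles. -/
noncomputable def evenCoboundaries : Submodule K (evenCocycles b) :=
  (LinearMap.range (differential b)).comap (evenCocycles b).subtype

/-- The even cohomology `H_E^{•,•}(𝔤) = ⨁_{p+q even} Hᵖ(𝔤, Λ^q 𝔤)`. -/
abbrev EvenCohomology : Type u := evenCocycles b ⧸ evenCoboundaries b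

/-- `h` is the cohomology class of the cochain `z`, which in particular is an even cocycle. -/
def IsClassOf (z : Cochain K L) (h : EvenCohomology b) : Prop :=
  ∃ hz : z ∈ evenCocycles b, (evenCoboundaries b).mkQ ⟨z, hz⟩ = h

/-- The component `Hᵖ(𝔤, Λ^q 𝔤)` of the even cohomology (for `p + q` even). -/
noncomputable def cohomology (p q : ℕ) : Submodule K (EvenCohomology b) :=
  ((bidegree K L p q).comap (evenCocycles b).subtype).map (evenCoboundaries b).mkQ

theorem mul_mem_evenCocycles {x y : Cochain K L} (hx : x ∈ evenCocycles b)
    (hy : y ∈ evenCocycles b) : x * y ∈ evenCocycles b := by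
  refine ⟨LinearMap.mem_ker.2 ?_, mul_mem_evenPart hx.2 hy.2⟩
  have h1 : differential b x = 0 := hx.1
  have h2 : differential b y = 0 := hy.1
  rw [differential_mul, h1, h2, zero_mul, mul_zero, add_zero]

/-- The product `∨` of even cocycles. -/
noncomputable def cocycleMul : evenCocycles b →ₗ[K] evenCocycles b →ₗ[K] evenCocycles b :=
  LinearMap.mk₂ K (fun x y => ⟨(x : Cochain K L) * y, mul_mem_evenCocycles b x.2 y.2⟩)
    (fun _ _ _ => Subtype.ext (add_mul _ _ _)) (fun _ _ _ => Subtype.ext (smul_mul_assoc _ _ _))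
    (fun _ _ _ => Subtype.ext (mul_add _ _ _)) (fun _ _ _ => Subtype.ext (mul_smul_comm _ _ _))

theorem cocycleMul_right (x y : evenCocycles b) (hy : y ∈ evenCoboundaries b) :
    cocycleMul b x y ∈ evenCoboundaries b := by
  obtain ⟨c, hc⟩ := hy
  refine ⟨x * c, ?_⟩
  have h1 : differential b x = 0 := x.2.1
  rw [differential_mul, h1, zero_mul, zero_add, parity_of_even _ x.2.2, hc]
  rfl

theorem cocycleMul_left (x y : evenCocycles b) (hx : x ∈ evenCoboundaries b) :
    cocycleMul b x y ∈ evenCoboundaries b := by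
  obtain ⟨c, hc⟩ := hx
  refine ⟨c * y, ?_⟩
  have h1 : differential b y = 0 := y.2.1
  rw [differential_mul, h1, mul_zero, add_zero, hc]
  rfl

/-- The product `∨` of even cocycles with values in the cohomology. -/
noncomputable def cocycleCup : evenCocycles b →ₗ[K] evenCocycles b →ₗ[K] EvenCohomology b :=
  (cocycleMul b).compr₂ (evenCoboundaries b).mkQ

/-- The cup product of the even cohomology, `[x] ∨ [y] = [x ∨ y]`. -/
noncomputable def cup : EvenCohomology b →ₗ[K] EvenCohomology b →ₗ[K] EvenCohomology b :=
  (cocycleCup b).liftQ₂ (evenCoboundaries b) (evenCoboundaries b)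
    (fun x hx => LinearMap.mem_ker.2 <| LinearMap.ext fun y =>
      (Submodule.Quotient.mk_eq_zero _).2 (cocycleMul_left b x y hx))
    (fun y hy => LinearMap.mem_ker.2 <| LinearMap.ext fun x =>
      (Submodule.Quotient.mk_eq_zero _).2 (cocycleMul_right b x y hy))

theorem cup_mk (x y : evenCocycles b) :
    cup b ((evenCoboundaries b).mkQ x) ((evenCoboundaries b).mkQ y) =
      (evenCoboundaries b).mkQ (cocycleMul b x y) := rfl

end LieAlgebra

/-! ### The Heisenberg Lie algebra -/

section Heisenberg

/-- The three-dimensional Heisenberg Lie algebra `𝔥`; the vector `v` stands for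
`v 0 • x₁ + v 1 • x₋₁ + v 2 • h₀`. -/
def Heisenberg (K : Type u) : Type u := Fin 3 → K

namespace Heisenberg

instance (K : Type u) : FunLike (Heisenberg K) (Fin 3) K where
  coe v := v
  coe_injective _ _ h := h

/-- The element `a • x₁ + b • x₋₁ + c • h₀` of `𝔥`. -/
def mk {K : Type u} (a b c : K) : Heisenberg K := ![a, b, c]

@[simp] theorem mk_zero {K : Type u} (a b c : K) : mk a b c 0 = a := rfl
@[simp] theorem mk_one {K : Type u} (a b c : K) : mk a b c 1 = b := rfl
@[simp] theorem mk_two {K : Type u} (a b c : K) : mk a b c 2 = c := rfl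

theorem ext {K : Type u} {v w : Heisenberg K} (h0 : v 0 = w 0) (h1 : v 1 = w 1)
    (h2 : v 2 = w 2) : v = w := by
  refine funext fun i => ?_
  fin_cases i
  exacts [h0, h1, h2]

variable (K : Type u) [Field K]

instance : AddCommGroup (Heisenberg K) := inferInstanceAs (AddCommGroup (Fin 3 → K))

instance : Module K (Heisenberg K) := inferInstanceAs (Module K (Fin 3 → K))

/-- The only non-zero bracket of basis vectors is `[x₁, x₋₁] = h₀`. -/
instance : Bracket (Heisenberg K) (Heisenberg K) where
  bracket v w := mk 0 0 (v 0 * w 1 - v 1 * w 0)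

variable {K}

theorem bracket_def (v w : Heisenberg K) : ⁅v, w⁆ = mk 0 0 (v 0 * w 1 - v 1 * w 0) := rfl

@[simp] theorem zero_apply (i : Fin 3) : (0 : Heisenberg K) i = 0 := rfl

@[simp] theorem add_apply (v w : Heisenberg K) (i : Fin 3) : (v + w) i = v i + w i := rfl

@[simp] theorem smul_apply (c : K) (v : Heisenberg K) (i : Fin 3) : (c • v) i = c * v i := rfl

instance : LieRing (Heisenberg K) where
  add_lie u v w := by apply ext <;> simp [bracket_def]; ring
  lie_add u v w := by apply ext <;> simp [bracket_def]; ring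
  lie_self u := by apply ext <;> simp [bracket_def]; ring
  leibniz_lie u v w := by apply ext <;> simp [bracket_def]

instance : LieAlgebra K (Heisenberg K) where
  lie_smul c v w := by apply ext <;> simp [bracket_def]; ring

end Heisenberg

variable (K : Type u) [Field K]

/-- The basis `x₁, x₋₁, h₀` of `𝔥`. -/
noncomputable def heisBasis : Module.Basis (Fin 3) K (Heisenberg K) := Pi.basisFun K (Fin 3)

theorem heisBasis_coord (i : Fin 3) (v : Heisenberg K) : (heisBasis K).coord i v = v i := rfl

theorem heisBasis_apply (i j : Fin 3) : heisBasis K i j = if j = i then 1 else 0 := by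
  change (Pi.basisFun K (Fin 3)) i j = _
  simp [Pi.single_apply]

/-- The linear map of `𝔥` given by the matrix `A` on the span of `x₁ = (1, 0)`, `x₋₁ = (0, 1)` and by
the identity on `h₀`. -/
def heisAct (A : Matrix (Fin 2) (Fin 2) K) : Heisenberg K →ₗ[K] Heisenberg K where
  toFun v := Heisenberg.mk (A 0 0 * v 0 + A 0 1 * v 1) (A 1 0 * v 0 + A 1 1 * v 1) (v 2)
  map_add' v w := by apply Heisenberg.ext <;> simp <;> ring
  map_smul' c v := by apply Heisenberg.ext <;> simp <;> ring

variable {K} in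
theorem heisAct_apply (A : Matrix (Fin 2) (Fin 2) K) (v : Heisenberg K) : heisAct K A v =
    Heisenberg.mk (A 0 0 * v 0 + A 0 1 * v 1) (A 1 0 * v 0 + A 1 1 * v 1) (v 2) := rfl

/-- `SL(2, K)` acts on `𝔥`: canonically on the span of `x₁ = (1, 0)` and `x₋₁ = (0, 1)`, and
trivially on `h₀`. -/
def heisRep : Representation K (Matrix.SpecialLinearGroup (Fin 2) K) (Heisenberg K) where
  toFun g := heisAct K g
  map_one' := LinearMap.ext fun v => by apply Heisenberg.ext <;> simp [heisAct_apply]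
  map_mul' g g' := LinearMap.ext fun v => by
    apply Heisenberg.ext <;>
      simp [heisAct_apply, Matrix.mul_apply, Fin.sum_univ_two] <;> ring

variable {K} in
theorem heisRep_apply (g : Matrix.SpecialLinearGroup (Fin 2) K) (v : Heisenberg K) :
    heisRep K g v =
      Heisenberg.mk (g 0 0 * v 0 + g 0 1 * v 1) (g 1 0 * v 0 + g 1 1 * v 1) (v 2) := rfl

/-- `SL(2, K)` acts on `𝔥` by Lie algebra automorphisms. -/
theorem heisRep_lie (g : Matrix.SpecialLinearGroup (Fin 2) K) (v w : Heisenberg K) :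
    heisRep K g ⁅v, w⁆ = ⁅heisRep K g v, heisRep K g w⁆ := by
  have h := g.det_coe
  rw [Matrix.det_fin_two] at h
  apply Heisenberg.ext <;> simp [heisRep_apply, Heisenberg.bracket_def]
  linear_combination (v 1 * w 0 - v 0 * w 1) * h

end Heisenberg


section Action

variable (K : Type u) [Field K]

/-- The special linear group `SL(2, K)`. -/
abbrev SL2 : Type u := Matrix.SpecialLinearGroup (Fin 2) K

/-- The action of `SL(2, K)` on `C = Λ𝔥* ⊗ Λ𝔥` induced by its action on `𝔥`. -/
noncomputable def cochainRep : Representation K (SL2 K) (Cochain K (Heisenberg K)) where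
  toFun g := cochainMap ((heisRep K).dual g) (heisRep K g)
  map_one' := LinearMap.ext fun x => by
    rw [map_one, map_one]
    induction x using tens_induction with
    | hz => simp
    | ha a b ha hb => rw [map_add, ha, hb, map_add]
    | hp φ w =>
      rw [cochainMap_tens, Module.End.one_eq_id, Module.End.one_eq_id, ExteriorAlgebra.map_id,
        ExteriorAlgebra.map_id]
      rfl
  map_mul' g g' := LinearMap.ext fun x => by
    rw [map_mul, map_mul]
    induction x using tens_induction with
    | hz => simp
    | ha a b ha hb => rw [map_add, ha, hb, map_add]
    | hp φ w =>
      rw [Module.End.mul_apply, cochainMap_tens, cochainMap_tens, cochainMap_tens,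
        Module.End.mul_eq_comp, Module.End.mul_eq_comp, ← ExteriorAlgebra.map_comp_map,
        ← ExteriorAlgebra.map_comp_map]
      rfl

variable {K}

theorem cochainRep_apply (g : SL2 K) : cochainRep K g =
    cochainMap ((heisRep K).dual g) (heisRep K g) := rfl

theorem differential_one {L : Type u} [LieRing L] [LieAlgebra K L] {n : ℕ}
    (b : Module.Basis (Fin n) K L) : differential b 1 = 0 := by
  have h := differential_mul b 1 1
  rw [parity_eq, cochainMap_one, mul_one, mul_one, one_mul] at h
  simpa using h

/-- The differential on `𝔤`: `d v = ∑ᵢ eⁱ ⊗ [eᵢ, v]`. -/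
theorem differential_ι_right {L : Type u} [LieRing L] [LieAlgebra K L] {n : ℕ}
    (b : Module.Basis (Fin n) K L) (v : L) :
    differential b (tens 1 (ExteriorAlgebra.ι K v)) =
      ∑ i, tens (ExteriorAlgebra.ι K (b.coord i)) (ExteriorAlgebra.ι K ⁅b i, v⁆) := by
  have h (x : L) : extAd b x (ExteriorAlgebra.ι K v) = ExteriorAlgebra.ι K ⁅x, v⁆ := by
    conv_rhs => rw [← b.sum_repr v, lie_sum, map_sum]
    simp [extAd, LinearMap.sum_apply, Algebra.algebraMap_eq_smul_one]
  simp [differential, LinearMap.sum_apply, h]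

/-- The differential on `𝔤*`: `d φ = -∑_{i<j} φ([eᵢ, eⱼ]) eⁱ ∧ eʲ`. -/
theorem differential_ι_left {L : Type u} [LieRing L] [LieAlgebra K L] {n : ℕ}
    (b : Module.Basis (Fin n) K L) (φ : Module.Dual K L) :
    differential b (tens (ExteriorAlgebra.ι K φ) 1) =
      -∑ i, ∑ j ∈ Finset.Ioi i, φ ⁅b i, b j⁆ •
        tens (ExteriorAlgebra.ι K (b.coord i) * ExteriorAlgebra.ι K (b.coord j)) 1 := by
  have h (x : L) : extAd b x 1 = 0 := by
    simp [extAd, LinearMap.sum_apply]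
  simp [differential, LinearMap.sum_apply, h, Algebra.algebraMap_eq_smul_one]

theorem heis_bracket_basis (i : Fin 3) (v : Heisenberg K) : ⁅heisBasis K i, v⁆ =
    (if i = 0 then v 1 else if i = 1 then -v 0 else 0) • heisBasis K 2 := by
  fin_cases i <;> apply Heisenberg.ext <;> simp [Heisenberg.bracket_def, heisBasis_apply]

theorem differential_heis_right (v : Heisenberg K) :
    differential (heisBasis K) (tens 1 (ExteriorAlgebra.ι K v)) =
      tens (ExteriorAlgebra.ι K (v 1 • (heisBasis K).coord 0 - v 0 • (heisBasis K).coord 1))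
        (ExteriorAlgebra.ι K (heisBasis K 2)) := by
  rw [differential_ι_right]
  simp [Fin.sum_univ_three, heis_bracket_basis, sub_eq_add_neg]

theorem differential_heis_left (φ : Module.Dual K (Heisenberg K)) :
    differential (heisBasis K) (tens (ExteriorAlgebra.ι K φ) 1) =
      -(φ (heisBasis K 2) • tens (ExteriorAlgebra.ι K ((heisBasis K).coord 0) *
        ExteriorAlgebra.ι K ((heisBasis K).coord 1)) 1) := by
  have h0 : Finset.Ioi (0 : Fin 3) = {1, 2} := by decide
  have h1 : Finset.Ioi (1 : Fin 3) = {2} := by decide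
  have h2 : Finset.Ioi (2 : Fin 3) = ∅ := by decide
  rw [differential_ι_left]
  simp [Fin.sum_univ_three, heis_bracket_basis, h0, h1, h2, heisBasis_apply]

theorem heisRep_dual_apply (g : SL2 K) (φ : Module.Dual K (Heisenberg K)) (v : Heisenberg K) :
    (heisRep K).dual g φ v = φ (heisRep K g⁻¹ v) := rfl

theorem heisRep_basis_two (g : SL2 K) : heisRep K g (heisBasis K 2) = heisBasis K 2 := by
  apply Heisenberg.ext <;> simp [heisRep_apply, heisBasis_apply]

theorem heisRep_dual_coord (g : SL2 K) :
    (heisRep K).dual g ((heisBasis K).coord 0) =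
      g 1 1 • (heisBasis K).coord 0 - g 0 1 • (heisBasis K).coord 1 ∧
    (heisRep K).dual g ((heisBasis K).coord 1) =
      g 0 0 • (heisBasis K).coord 1 - g 1 0 • (heisBasis K).coord 0 := by
  constructor <;> refine LinearMap.ext fun v => ?_ <;>
  rw [heisRep_dual_apply, heisBasis_coord, heisRep_apply, LinearMap.sub_apply,
    LinearMap.smul_apply, LinearMap.smul_apply, heisBasis_coord, heisBasis_coord,
    Matrix.SpecialLinearGroup.coe_inv, Matrix.adjugate_fin_two] <;> simp <;> ring

theorem differential_cochainRep (g : SL2 K) (x : Cochain K (Heisenberg K)) :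
    differential (heisBasis K) (cochainRep K g x) = cochainRep K g (differential (heisBasis K) x) := by
  induction x using generator_induction with
  | hone => rw [cochainRep_apply, cochainMap_one, differential_one, map_zero]
  | hadd x y hx hy => rw [map_add, map_add, hx, hy, map_add, map_add]
  | hsmul c x hx => rw [map_smul, map_smul, hx, map_smul, map_smul]
  | hmul x y hx hy =>
    rw [cochainRep_apply] at hx hy ⊢
    rw [cochainMap_mul, differential_mul, hx, hy, differential_mul, map_add, cochainMap_mul,
      cochainMap_mul, parity_cochainMap]
  | hl φ =>
    have hdet := g.det_coe
    rw [Matrix.det_fin_two] at hdet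
    obtain ⟨h0, h1⟩ := heisRep_dual_coord g
    rw [cochainRep_apply, cochainMap_tens_one, ExteriorAlgebra.map_apply_ι, differential_heis_left,
      differential_heis_left, map_neg, map_smul, cochainMap_tens_one,
      map_mul (ExteriorAlgebra.map _),
      ExteriorAlgebra.map_apply_ι, ExteriorAlgebra.map_apply_ι, h0, h1, heisRep_dual_apply,
      heisRep_basis_two]
    have key : ExteriorAlgebra.ι K (g 1 1 • (heisBasis K).coord 0 -
          g 0 1 • (heisBasis K).coord 1) *
        ExteriorAlgebra.ι K (g 0 0 • (heisBasis K).coord 1 - g 1 0 • (heisBasis K).coord 0) =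
        (g 0 0 * g 1 1 - g 0 1 * g 1 0) • (ExteriorAlgebra.ι K ((heisBasis K).coord 0) *
          ExteriorAlgebra.ι K ((heisBasis K).coord 1)) := by
      have h := eq_neg_of_add_eq_zero_left (ExteriorAlgebra.ι_add_mul_swap (R := K)
        ((heisBasis K).coord 1) ((heisBasis K).coord 0))
      simp only [map_sub, map_smul, sub_mul, mul_sub, smul_mul_smul_comm,
        ExteriorAlgebra.ι_sq_zero, h, smul_zero]
      module
    rw [key, hdet, one_smul]
  | hr v =>
    have hdet := g.det_coe
    rw [Matrix.det_fin_two] at hdet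
    obtain ⟨h0, h1⟩ := heisRep_dual_coord g
    rw [cochainRep_apply, cochainMap_one_tens, ExteriorAlgebra.map_apply_ι,
      differential_heis_right, differential_heis_right, cochainMap_tens,
      ExteriorAlgebra.map_apply_ι, ExteriorAlgebra.map_apply_ι, heisRep_basis_two,
      map_sub ((heisRep K).dual g), map_smul ((heisRep K).dual g), map_smul ((heisRep K).dual g),
      h0, h1, heisRep_apply, Heisenberg.mk_zero, Heisenberg.mk_one]
    congr 3
    module

theorem differential_parity (x : Cochain K (Heisenberg K)) :
    differential (heisBasis K) (parity x) = -parity (differential (heisBasis K) x) := by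
  induction x using generator_induction with
  | hone => rw [parity_eq, cochainMap_one, differential_one, map_zero, neg_zero]
  | hadd x y hx hy => rw [map_add, map_add, hx, hy, map_add, map_add, neg_add]
  | hsmul c x hx => rw [map_smul, map_smul, hx, map_smul, map_smul, smul_neg]
  | hmul x y hx hy =>
    rw [parity_mul, differential_mul, differential_mul, hx, hy, map_add, parity_mul, parity_mul,
      neg_mul, mul_neg, neg_add]
  | hl φ =>
    rw [differential_heis_left, parity_eq, cochainMap_tens_one, ExteriorAlgebra.map_apply_ι, map_neg,
      map_smul, cochainMap_tens_one, map_mul (ExteriorAlgebra.map _), ExteriorAlgebra.map_apply_ι,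
      ExteriorAlgebra.map_apply_ι]
    simp [differential_heis_left]
  | hr v =>
    rw [differential_heis_right, parity_eq, cochainMap_one_tens, ExteriorAlgebra.map_apply_ι,
      cochainMap_tens, ExteriorAlgebra.map_apply_ι, ExteriorAlgebra.map_apply_ι]
    simp [differential_heis_right]
    abel

/-- `d² = 0`. -/
theorem differential_differential (x : Cochain K (Heisenberg K)) :
    differential (heisBasis K) (differential (heisBasis K) x) = 0 := by
  have hc (i : Fin 3) : differential (heisBasis K)
      (tens (ExteriorAlgebra.ι K ((heisBasis K).coord i)) 1) =
        if i = 2 then -tens (ExteriorAlgebra.ι K ((heisBasis K).coord 0) *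
          ExteriorAlgebra.ι K ((heisBasis K).coord 1)) 1 else 0 := by
    rw [differential_heis_left, heisBasis_coord, heisBasis_apply]
    fin_cases i <;> simp
  have h2 : differential (heisBasis K) (tens 1 (ExteriorAlgebra.ι K (heisBasis K 2))) = 0 := by
    rw [differential_heis_right, heisBasis_apply, heisBasis_apply]
    simp
  induction x using generator_induction with
  | hone => rw [differential_one, map_zero]
  | hadd x y hx hy => rw [map_add, map_add, hx, hy, add_zero]
  | hsmul c x hx => rw [map_smul, map_smul, hx, smul_zero]
  | hmul x y hx hy =>
    rw [differential_mul, map_add, differential_mul, differential_mul, hx, hy, differential_parity,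
      zero_mul, mul_zero]
    simp
  | hl φ =>
    rw [differential_heis_left, map_neg, map_smul, ← left_mul_tens, differential_mul, hc, hc]
    simp
  | hr v =>
    rw [differential_heis_right, tens_eq_mul, differential_mul, h2, map_sub, map_smul, map_smul,
      map_sub, LinearMap.sub_apply, map_smul, map_smul, LinearMap.smul_apply, LinearMap.smul_apply,
      map_sub, map_smul, map_smul, hc, hc]
    simp

theorem cochainRep_mem_evenCocycles (g : SL2 K) :
    evenCocycles (heisBasis K) ≤ (evenCocycles (heisBasis K)).comap (cochainRep K g) := by
  intro x hx
  have h1 : differential (heisBasis K) x = 0 := hx.1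
  exact ⟨LinearMap.mem_ker.2 (by rw [differential_cochainRep, h1, map_zero]),
    cochainMap_mem_evenPart _ _ hx.2⟩

variable (K)

/-- The action of `SL(2, K)` on the even cocycles. -/
noncomputable def cocycleRep : Representation K (SL2 K) (evenCocycles (heisBasis K)) where
  toFun g := (cochainRep K g).restrict (cochainRep_mem_evenCocycles g)
  map_one' := LinearMap.ext fun x => Subtype.ext (by simp)
  map_mul' g g' := LinearMap.ext fun x => Subtype.ext (by simp)

theorem cocycleRep_mem (g : SL2 K) : evenCoboundaries (heisBasis K) ≤
    (evenCoboundaries (heisBasis K)).comap (cocycleRep K g) := by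
  rintro x ⟨c, hc⟩
  refine ⟨cochainRep K g c, ?_⟩
  rw [differential_cochainRep, hc]
  rfl

/-- The even cohomology `H_E^{•,•}(𝔥)` of the Heisenberg Lie algebra. -/
abbrev HeisCohomology : Type u := EvenCohomology (heisBasis K)

/-- The action of `SL(2, K)` on `H_E^{•,•}(𝔥)`, `g • [z] = [g • z]`. -/
noncomputable def cohomologyRep : Representation K (SL2 K) (HeisCohomology K) where
  toFun g := (evenCoboundaries (heisBasis K)).mapQ _ (cocycleRep K g) (cocycleRep_mem K g)
  map_one' := by
    refine LinearMap.ext fun x => ?_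
    obtain ⟨x, rfl⟩ := (evenCoboundaries (heisBasis K)).mkQ_surjective x
    simp
  map_mul' g g' := by
    refine LinearMap.ext fun x => ?_
    obtain ⟨x, rfl⟩ := (evenCoboundaries (heisBasis K)).mkQ_surjective x
    simp

end Action


/-! ### Labelings and `G`-tables -/

section GTable

/-- The data of a (partial) labeling of `Rep(G)`: representations `V i` of `G` `(i ∈ I)` and, for all
`i, j, k`, a finite family of linear maps `m i j k q : V i ⊗ V j → V k`. -/
structure PartialLabeling (K : Type u) (G : Type v) [Field K] [Group G] (I : Type) where
  /-- The representation spaces. -/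
  V : I → Type u
  [addCommGroup : ∀ i, AddCommGroup (V i)]
  [module : ∀ i, Module K (V i)]
  /-- The representations. -/
  ρ : ∀ i, Representation K G (V i)
  /-- The number of maps `V i ⊗ V j → V k`. -/
  d : I → I → I → ℕ
  /-- The maps `V i ⊗ V j → V k`. -/
  m : ∀ i j k, Fin (d i j k) → V i ⊗[K] V j →ₗ[K] V k

attribute [instance] PartialLabeling.addCommGroup PartialLabeling.module

/-- The data form a partial labeling: the `V i` are finite dimensional, irreducible and pairwise
non-isomorphic, and `m i j k` is a basis of `Hom_G(V i ⊗ V j, V k)`. -/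
structure PartialLabeling.IsLabeling {K : Type u} {G : Type v} [Field K] [Group G]
    {I : Type} (Λ : PartialLabeling K G I) : Prop where
  finiteDimensional : ∀ i, FiniteDimensional K (Λ.V i)
  irreducible : ∀ i, (Λ.ρ i).IsIrreducible
  eq_of_equiv : ∀ i j, Nonempty ((Λ.ρ i).Equiv (Λ.ρ j)) → i = j
  isIntertwining : ∀ i j k q,
    Representation.IsIntertwiningMap ((Λ.ρ i).tprod (Λ.ρ j)) (Λ.ρ k) (Λ.m i j k q)
  linearIndependent : ∀ i j k, LinearIndependent K (Λ.m i j k)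
  mem_span : ∀ i j k (f : Λ.V i ⊗[K] Λ.V j →ₗ[K] Λ.V k),
    Representation.IsIntertwiningMap ((Λ.ρ i).tprod (Λ.ρ j)) (Λ.ρ k) f →
      f ∈ Submodule.span K (Set.range (Λ.m i j k))

variable {K : Type u} {G : Type v} [Field K] [Group G] {I : Type} (Λ : PartialLabeling K G I)
  {A : Type u} [AddCommGroup A] [Module K A] (ρ : Representation K G A) (μ : A →ₗ[K] A →ₗ[K] A)
  {R : Type} (ε : R → I) (τ : ∀ r, Λ.V (ε r) →ₗ[K] A)

/-- `G` acts on the algebra `(A, μ)` by algebra automorphisms. -/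
def ActsByAlgebraAutomorphisms : Prop := ∀ g x y, ρ g (μ x y) = μ (ρ g x) (ρ g y)

/-- The maps `τ r : V (ε r) → A` are injective `G`-morphisms and `A` is the direct sum of their
images. -/
structure IsGDecomposition [DecidableEq R] : Prop where
  isIntertwining : ∀ r, Representation.IsIntertwiningMap (Λ.ρ (ε r)) ρ (τ r)
  injective : ∀ r, Function.Injective (τ r)
  isInternal : DirectSum.IsInternal fun r => LinearMap.range (τ r)

/-- The scalars `c r₁ r₂ s q` are the `G`-table of the algebra `(A, μ)` with respect to the labeling
`Λ` and the maps `τ`: on the images of `τ r₁` and `τ r₂`, the multiplication `μ` is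
`∑ₛ ∑_q c r₁ r₂ s q • (τ s ∘ m_q ∘ (τ r₁ ⊗ τ r₂)⁻¹)`. -/
def IsGTable [Fintype R] (c : ∀ r₁ r₂ s, Fin (Λ.d (ε r₁) (ε r₂) (ε s)) → K) : Prop :=
  ∀ r₁ r₂ (x : Λ.V (ε r₁)) (y : Λ.V (ε r₂)),
    μ (τ r₁ x) (τ r₂ y) = ∑ s, ∑ q, c r₁ r₂ s q • τ s (Λ.m _ _ _ q (x ⊗ₜ y))

end GTable

/-! ### The partial labeling of `Rep(SL(2, K))` by the weights `0, 1, 2` -/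

section Labeling

variable (K : Type u) [Field K]

/-- The Lie algebra `sl(2, K)` of trace zero matrices. -/
abbrev SL2Lie : Type u := LieAlgebra.SpecialLinear.sl (Fin 2) K

/-- The spaces `K`, `K²` and `sl(2, K)`. -/
def sl2V : Fin 3 → Type u
  | 0 => K
  | 1 => Fin 2 → K
  | 2 => SL2Lie K

instance : ∀ i, AddCommGroup (sl2V K i)
  | 0 => inferInstanceAs (AddCommGroup K)
  | 1 => inferInstanceAs (AddCommGroup (Fin 2 → K))
  | 2 => inferInstanceAs (AddCommGroup (SL2Lie K))

instance : ∀ i, Module K (sl2V K i)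
  | 0 => inferInstanceAs (Module K K)
  | 1 => inferInstanceAs (Module K (Fin 2 → K))
  | 2 => inferInstanceAs (Module K (SL2Lie K))

/-- The canonical representation `g • v = g v` of `SL(2, K)` on `K²`. -/
def canonicalRep : Representation K (SL2 K) (Fin 2 → K) where
  toFun g := Matrix.toLin' g.1
  map_one' := Matrix.toLin'_one
  map_mul' g g' := Matrix.toLin'_mul g.1 g'.1

theorem mem_sl_iff (A : Matrix (Fin 2) (Fin 2) K) :
    A ∈ LieAlgebra.SpecialLinear.sl (Fin 2) K ↔ A.trace = 0 := Iff.rfl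

/-- The adjoint representation `g • A = g A g⁻¹` of `SL(2, K)` on `sl(2, K)`. -/
def adjointRep : Representation K (SL2 K) (SL2Lie K) where
  toFun g :=
    { toFun := fun A => ⟨g.1 * A.1 * (g⁻¹).1, by
        have h := A.2
        rw [mem_sl_iff] at h ⊢
        rw [Matrix.trace_mul_comm, ← mul_assoc, ← Matrix.SpecialLinearGroup.coe_mul,
          inv_mul_cancel, Matrix.SpecialLinearGroup.coe_one, one_mul, h]⟩
      map_add' := fun A B => Subtype.ext (by
        change g.1 * (A.1 + B.1) * (g⁻¹).1 = g.1 * A.1 * (g⁻¹).1 + g.1 * B.1 * (g⁻¹).1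
        rw [mul_add, add_mul])
      map_smul' := fun c A => Subtype.ext (by
        change g.1 * (c • A.1) * (g⁻¹).1 = c • (g.1 * A.1 * (g⁻¹).1)
        rw [mul_smul_comm, smul_mul_assoc]) }
  map_one' := LinearMap.ext fun A => Subtype.ext (by
    change (1 : SL2 K).1 * A.1 * ((1 : SL2 K)⁻¹).1 = A.1
    rw [inv_one, Matrix.SpecialLinearGroup.coe_one, one_mul, mul_one])
  map_mul' g g' := LinearMap.ext fun A => Subtype.ext (by
    change (g * g').1 * A.1 * ((g * g')⁻¹).1 = g.1 * (g'.1 * A.1 * (g'⁻¹).1) * (g⁻¹).1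
    rw [mul_inv_rev, Matrix.SpecialLinearGroup.coe_mul, Matrix.SpecialLinearGroup.coe_mul]
    simp only [mul_assoc])

/-- The trivial, canonical and adjoint representations of `SL(2, K)`. -/
def sl2Rep : ∀ i, Representation K (SL2 K) (sl2V K i)
  | 0 => Representation.trivial K (SL2 K) K
  | 1 => canonicalRep K
  | 2 => adjointRep K

/-- The highest weight vectors `1`, `(1, 0)` and `!![0, 1; 0, 0]`. -/
def sl2HighestWeight : ∀ i, sl2V K i
  | 0 => (1 : K)
  | 1 => (![1, 0] : Fin 2 → K)
  | 2 => (⟨!![0, 1; 0, 0], by simp [mem_sl_iff, Matrix.trace_fin_two]⟩ : SL2Lie K)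

variable {K}

/-- `m^{1,1,0} (x ⊗ y) = det (x, y)`. -/
def m110 : (Fin 2 → K) →ₗ[K] (Fin 2 → K) →ₗ[K] K :=
  LinearMap.mk₂ K (fun x y => !![x 0, x 1; y 0, y 1].det)
    (fun x x' y => by simp [Matrix.det_fin_two]; ring)
    (fun c x y => by simp [Matrix.det_fin_two]; ring)
    (fun x y y' => by simp [Matrix.det_fin_two]; ring)
    (fun c x y => by simp [Matrix.det_fin_two]; ring)

/-- `m^{1,1,2} (x ⊗ y) = !![x₁y₂ + x₂y₁, -2x₁y₁; 2x₂y₂, -x₁y₂ - x₂y₁]`. -/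
def m112 : (Fin 2 → K) →ₗ[K] (Fin 2 → K) →ₗ[K] SL2Lie K :=
  LinearMap.mk₂ K
    (fun x y => ⟨!![x 0 * y 1 + x 1 * y 0, -2 * x 0 * y 0;
        2 * x 1 * y 1, -x 0 * y 1 - x 1 * y 0], by
      rw [mem_sl_iff, Matrix.trace_fin_two]; simp⟩)
    (fun x x' y => Subtype.ext (by ext i j; fin_cases i <;> fin_cases j <;> simp <;> ring))
    (fun c x y => Subtype.ext (by ext i j; fin_cases i <;> fin_cases j <;> simp <;> ring))
    (fun x y y' => Subtype.ext (by ext i j; fin_cases i <;> fin_cases j <;> simp <;> ring))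
    (fun c x y => Subtype.ext (by ext i j; fin_cases i <;> fin_cases j <;> simp <;> ring))

/-- `m^{2,1,1} (A ⊗ x) = x Aᵗ`, for a row vector `x`. -/
def m211 : SL2Lie K →ₗ[K] (Fin 2 → K) →ₗ[K] (Fin 2 → K) :=
  LinearMap.mk₂ K (fun A x => x ᵥ* A.1ᵀ)
    (fun A B x => by simp [Matrix.vecMul_add, Matrix.transpose_add])
    (fun c A x => by simp [Matrix.vecMul_smul, Matrix.transpose_smul])
    (fun A x y => Matrix.add_vecMul _ _ _)
    (fun c A x => Matrix.smul_vecMul _ _ _)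

/-- `m^{2,2,0} (A ⊗ B) = tr (AB)`. -/
def m220 : SL2Lie K →ₗ[K] SL2Lie K →ₗ[K] K :=
  LinearMap.mk₂ K (fun A B => (A.1 * B.1).trace)
    (fun _ _ _ => by simp [add_mul]) (fun _ _ _ => by simp)
    (fun _ _ _ => by simp [mul_add]) (fun _ _ _ => by simp)

/-- `m^{2,2,2} (A ⊗ B) = [A, B] = AB - BA`. -/
def m222 : SL2Lie K →ₗ[K] SL2Lie K →ₗ[K] SL2Lie K :=
  LinearMap.mk₂ K (fun A B => ⁅A, B⁆) (fun A B C => add_lie _ _ _) (fun c A B => smul_lie _ _ _)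
    (fun A B C => lie_add _ _ _) (fun c A B => lie_smul _ _ _)

variable (K)

/-- The chosen bilinear maps `V i × V j → V k`; they are zero where `Hom_G(V i ⊗ V j, V k) = 0`. -/
def sl2Bilin : ∀ i j k, sl2V K i →ₗ[K] sl2V K j →ₗ[K] sl2V K k
  | 0, 0, 0 => LinearMap.lsmul K K
  | 0, 1, 1 => LinearMap.lsmul K (Fin 2 → K)
  | 0, 2, 2 => LinearMap.lsmul K (SL2Lie K)
  | 1, 0, 1 => (LinearMap.lsmul K (Fin 2 → K)).flip
  | 2, 0, 2 => (LinearMap.lsmul K (SL2Lie K)).flip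
  | 1, 1, 0 => m110
  | 1, 1, 2 => m112
  | 2, 1, 1 => m211
  | 1, 2, 1 => m211.flip
  | 2, 2, 0 => m220
  | 2, 2, 2 => m222
  | _, _, _ => 0

/-- The dimension of `Hom_G(V i ⊗ V j, V k)`. -/
def sl2Dim : Fin 3 → Fin 3 → Fin 3 → ℕ
  | 0, 0, 0 => 1
  | 0, 1, 1 => 1
  | 0, 2, 2 => 1
  | 1, 0, 1 => 1
  | 2, 0, 2 => 1
  | 1, 1, 0 => 1
  | 1, 1, 2 => 1
  | 2, 1, 1 => 1
  | 1, 2, 1 => 1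
  | 2, 2, 0 => 1
  | 2, 2, 2 => 1
  | _, _, _ => 0

/-- The partial labeling of `Rep(SL(2, K))` with the trivial, canonical and adjoint
representations. -/
noncomputable def sl2Labeling : PartialLabeling K (SL2 K) (Fin 3) where
  V := sl2V K
  ρ := sl2Rep K
  d := sl2Dim
  m i j k _ := TensorProduct.lift (sl2Bilin K i j k)

end Labeling

/-! ### The table -/

section Table

/-- The ten components `H_k^{p,q}` of `H_E^{•,•}(𝔥)`; the component `H_k^{p,q}` is written `Hkpq`. -/
inductive Comp
  | H000 | H011 | H211 | H120 | H102 | H022 | H222 | H131 | H113 | H033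
  deriving DecidableEq

namespace Comp

instance : Fintype Comp where
  elems := {H000, H011, H211, H120, H102, H022, H222, H131, H113, H033}
  complete x := by cases x <;> simp

/-- The highest weight `k` of `H_k^{p,q}`. -/
def weight : Comp → Fin 3
  | H000 => 0 | H011 => 0 | H211 => 2 | H120 => 1 | H102 => 1
  | H022 => 0 | H222 => 2 | H131 => 1 | H113 => 1 | H033 => 0

/-- The bidegree `(p, q)` of `H_k^{p,q}`. -/
def bidegree : Comp → ℕ × ℕ
  | H000 => (0, 0) | H011 => (1, 1) | H211 => (1, 1) | H120 => (2, 0) | H102 => (0, 2)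
  | H022 => (2, 2) | H222 => (2, 2) | H131 => (3, 1) | H113 => (1, 3) | H033 => (3, 3)

end Comp

variable (K : Type u) [Field K]

/-- `x₁ ∈ Λ𝔥`. -/
noncomputable def xp : ExteriorAlgebra K (Heisenberg K) := ExteriorAlgebra.ι K (heisBasis K 0)

/-- `x₋₁ ∈ Λ𝔥`. -/
noncomputable def xm : ExteriorAlgebra K (Heisenberg K) := ExteriorAlgebra.ι K (heisBasis K 1)

/-- `h₀ ∈ Λ𝔥`. -/
noncomputable def hz : ExteriorAlgebra K (Heisenberg K) := ExteriorAlgebra.ι K (heisBasis K 2)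

/-- The element `x⁻¹` of `Λ𝔥*`, where `x⁻¹, x¹, h⁰` is the dual basis of `x₁, x₋₁, h₀`; it has
weight `-1`. -/
noncomputable def dxm : ExteriorAlgebra K (Module.Dual K (Heisenberg K)) :=
  ExteriorAlgebra.ι K ((heisBasis K).coord 0)

/-- The element `x¹` of `Λ𝔥*`, where `x⁻¹, x¹, h⁰` is the dual basis of `x₁, x₋₁, h₀`; it has
weight `1`. -/
noncomputable def dxp : ExteriorAlgebra K (Module.Dual K (Heisenberg K)) :=
  ExteriorAlgebra.ι K ((heisBasis K).coord 1)

/-- The element `h⁰` of `Λ𝔥*`, where `x⁻¹, x¹, h⁰` is the dual basis of `x₁, x₋₁, h₀`. -/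
noncomputable def dhz : ExteriorAlgebra K (Module.Dual K (Heisenberg K)) :=
  ExteriorAlgebra.ι K ((heisBasis K).coord 2)

open CupTable.Comp

/-- The chosen highest weight vectors of the components `H_k^{p,q}`, as cochains. -/
noncomputable def hwv : Comp → Cochain K (Heisenberg K)
  | H000 => 1
  | H011 => tens (dxp K) (xm K) + tens (dxm K) (xp K) + (2 : K) • tens (dhz K) (hz K)
  | H211 => tens (dxp K) (xp K)
  | H120 => tens (dxp K * dhz K) 1
  | H102 => tens 1 (xp K * hz K)
  | H022 => tens (dxm K * dxp K) (xp K * xm K)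
  | H222 => tens (dxp K * dhz K) (xp K * hz K)
  | H131 => tens (dxm K * dxp K * dhz K) (xp K)
  | H113 => tens (dxp K) (xp K * xm K * hz K)
  | H033 => tens (dxm K * dxp K * dhz K) (xp K * xm K * hz K)

/-- The coefficients of the table: `cupCoeff K r₁ r₂ s` is the coefficient of `s` in `r₁ ∨ r₂`. -/
def cupCoeff : Comp → Comp → Comp → K
  | H000, r, s => if r = s then 1 else 0
  | r, H000, s => if r = s then 1 else 0
  | H011, H011, H022 => -6
  | H011, H211, H222 => -2
  | H011, H120, H131 => 1
  | H011, H102, H113 => -1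
  | H011, H022, H033 => 2
  | H211, H011, H222 => -2
  | H211, H211, H022 => 1
  | H211, H120, H131 => 1
  | H211, H102, H113 => 1
  | H211, H222, H033 => -1
  | H120, H011, H131 => 1
  | H120, H211, H131 => 1
  | H120, H102, H022 => 1 / 2
  | H120, H102, H222 => -(1 / 2)
  | H120, H113, H033 => -1
  | H102, H011, H113 => -1
  | H102, H211, H113 => 1
  | H102, H120, H022 => -(1 / 2)
  | H102, H120, H222 => -(1 / 2)
  | H102, H131, H033 => -1
  | H022, H011, H033 => 2
  | H222, H211, H033 => -1
  | H131, H102, H033 => 1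
  | H113, H120, H033 => 1
  | _, _, _ => 0

/-- The `SL(2, K)`-table of the cup product.  All spaces `Hom_G(V i ⊗ V j, V k)` have dimension at
most one, so that the last index plays no role. -/
def cupTable : ∀ r₁ r₂ s : Comp,
    Fin ((sl2Labeling K).d r₁.weight r₂.weight s.weight) → K :=
  fun r₁ r₂ s _ => cupCoeff K r₁ r₂ s

/-- The maps `τ r : V → H_E^{•,•}(𝔥)` are the `SL(2, K)`-morphisms that send the highest weight
vectors of the labeling to the classes of the chosen highest weight vectors. -/
def IsHighestWeightFamily
    (τ : ∀ r : Comp, (sl2Labeling K).V r.weight →ₗ[K] HeisCohomology K) : Prop :=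
  ∀ r, Representation.IsIntertwiningMap ((sl2Labeling K).ρ r.weight) (cohomologyRep K) (τ r) ∧
    IsClassOf (heisBasis K) (hwv K r) (τ r (sl2HighestWeight K r.weight))

end Table

end CupTable

/-! The cochain space has dimension 64, with a basis of monomials on which `d` and `∨` are explicit.
The symmetry under `SL(2)` reduces every statement about the ten components to one vector, or to one
product of two vectors.

Representations. Let `v₊` and `v₋` be the highest and lowest weight vectors of `V_0`, `V_1`, `V_2`.
Upper unipotent matrices fix `v₊`, and they move `v₋` through a spanning set
(`span_upperUnip_lowestWeight`). Hence an equivariant bilinear map `B` on `V_i × V_j`, with values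
in any representation, vanishes as soon as `B(v₊, v₋) = 0` (`bilin_eq_zero`). If the values lie in
`V_k`, the torus element `diag(2, 1/2)` forces `B(v₊, v₋)` into the eigenspace for `2^(i-j)`. This
space has dimension at most one and, apart from `i = j = 0`, `k = 2`, it is spanned by
`m^{i,j,k}(v₊, v₋)`. In the exceptional case `B(v₊, v₋)` is an invariant of `sl(2)`, hence zero.
This classifies all equivariant bilinear maps (`exists_eq_smul_bilin`); irreducibility and
non-isomorphism use the same elements.

Cohomology. Explicit equivariant cochain maps realise the ten families. In coordinates, closedness
of an even cochain amounts to seven linear equations, and the even coboundaries are spanned by seven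
explicit elements. So 32 even dimensions leave 32 - 7 - 7 = 18 for cohomology, which is the total
dimension of the ten components. The proof solves the linear systems: `eq_zero_of_sum_tauCochain_eq`
gives independence modulo coboundaries and `exists_eq_sum_tauCochain` gives generation.

The table. The difference between the cup product of two components and its proposed expansion is an
equivariant bilinear map into cohomology, so one product `τ(v₊) ∨ τ(v₋)` decides each entry
(`cup_tau`). These products are monomial computations (`hwv_mul_lwv`). The only coboundary relation
they need is `d(h⁰ ⊗ x₁x₋₁) = x⁻¹h⁰ ⊗ x₁h₀ + x¹h⁰ ⊗ x₋₁h₀ - x⁻¹x¹ ⊗ x₁x₋₁`, the source of the `-6`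
and of the halves. Uniqueness of the table holds because each nonzero `m^{i,j,k}` is nonzero at
`(v₊, v₋)`. -/

namespace CupTable

/-! ### Monomial coordinates on the exterior algebra of a three-dimensional space -/

section ExteriorCoordinates

variable {K : Type u} [Field K] {M : Type u} [AddCommGroup M] [Module K M]
  (b : Module.Basis (Fin 3) K M)

local notation "Λι" => ExteriorAlgebra.ι K

/-- The monomials in the generators of the exterior algebra of a space of dimension three. -/
noncomputable def extMonomial : Fin 8 → ExteriorAlgebra K M :=
  ![1, Λι (b 0), Λι (b 1), Λι (b 2), Λι (b 0) * Λι (b 1), Λι (b 0) * Λι (b 2),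
    Λι (b 1) * Λι (b 2), Λι (b 0) * Λι (b 1) * Λι (b 2)]

theorem ι_swap (v w : M) : Λι v * Λι w = -(Λι w * Λι v) :=
  eq_neg_of_add_eq_zero_left (ExteriorAlgebra.ι_add_mul_swap v w)

theorem ι_swap_left (v w : M) (x : ExteriorAlgebra K M) :
    Λι v * (Λι w * x) = -(Λι w * (Λι v * x)) := by
  rw [← mul_assoc, ι_swap, neg_mul, mul_assoc]

theorem ι_sq_left (v : M) (x : ExteriorAlgebra K M) : Λι v * (Λι v * x) = 0 := by
  rw [← mul_assoc, ExteriorAlgebra.ι_sq_zero, zero_mul]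

/-- Left multiplication by the first generator in terms of monomials. -/
theorem ι_zero_mul_extMonomial (i : Fin 8) : Λι (b 0) * extMonomial b i =
    ![extMonomial b 1, 0, extMonomial b 4, extMonomial b 5, 0, 0, extMonomial b 7, 0] i := by
  fin_cases i <;> simp [extMonomial, mul_assoc, ι_sq_left]

theorem ι_one_mul_extMonomial (i : Fin 8) : Λι (b 1) * extMonomial b i =
    ![extMonomial b 2, -extMonomial b 4, 0, extMonomial b 6, 0, -extMonomial b 7, 0, 0] i := by
  fin_cases i <;> simp [extMonomial, mul_assoc, ι_sq_left, ι_swap (b 1) (b 0),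
    ι_swap_left (b 1) (b 0)]

theorem ι_two_mul_extMonomial (i : Fin 8) : Λι (b 2) * extMonomial b i =
    ![extMonomial b 3, -extMonomial b 5, -extMonomial b 6, 0, extMonomial b 7, 0, 0, 0] i := by
  fin_cases i <;> simp [extMonomial, mul_assoc, ι_swap (b 2) (b 0),
    ι_swap (b 2) (b 1), ι_swap_left (b 2) (b 0), ι_swap_left (b 2) (b 1)]

theorem contractLeft_zero_extMonomial (i : Fin 8) :
    CliffordAlgebra.contractLeft (b.coord 0) (extMonomial b i) =
    ![0, extMonomial b 0, 0, 0, extMonomial b 2, extMonomial b 3, 0, extMonomial b 6] i := by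
  fin_cases i <;> simp [extMonomial, mul_assoc, CliffordAlgebra.contractLeft_ι_mul,
    CliffordAlgebra.contractLeft_ι, Algebra.algebraMap_eq_smul_one]

theorem contractLeft_one_extMonomial (i : Fin 8) :
    CliffordAlgebra.contractLeft (b.coord 1) (extMonomial b i) =
    ![0, 0, extMonomial b 0, 0, -extMonomial b 1, 0, extMonomial b 3, -extMonomial b 5] i := by
  fin_cases i <;> simp [extMonomial, mul_assoc, CliffordAlgebra.contractLeft_ι_mul,
    CliffordAlgebra.contractLeft_ι, Algebra.algebraMap_eq_smul_one]

theorem contractLeft_two_extMonomial (i : Fin 8) :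
    CliffordAlgebra.contractLeft (b.coord 2) (extMonomial b i) =
    ![0, 0, 0, extMonomial b 0, 0, -extMonomial b 1, -extMonomial b 2, extMonomial b 4] i := by
  fin_cases i <;> simp [extMonomial, mul_assoc, CliffordAlgebra.contractLeft_ι_mul,
    CliffordAlgebra.contractLeft_ι, Algebra.algebraMap_eq_smul_one]

theorem involute_extMonomial (i : Fin 8) :
    CliffordAlgebra.involute (extMonomial b i) =
      (![1, -1, -1, -1, 1, 1, 1, -1] i : K) • extMonomial b i := by
  fin_cases i <;> simp [extMonomial, CliffordAlgebra.involute_ι]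

/-- The span contains 1 and, by the three multiplication tables, is stable under left multiplication
by each basis vector, hence by every vector; such a subspace is the whole algebra. -/
theorem span_extMonomial : ⊤ ≤ Submodule.span K (Set.range (extMonomial b)) := by
  have hm (i : Fin 8) : extMonomial b i ∈ Submodule.span K (Set.range (extMonomial b)) :=
    Submodule.subset_span ⟨i, rfl⟩
  have key (j : Fin 3) (x : ExteriorAlgebra K M)
      (hx : x ∈ Submodule.span K (Set.range (extMonomial b))) :
      Λι (b j) * x ∈ Submodule.span K (Set.range (extMonomial b)) := by
    induction hx using Submodule.span_induction with
    | mem x h =>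
      obtain ⟨i, rfl⟩ := h
      fin_cases j
      · simp only [Fin.zero_eta, ι_zero_mul_extMonomial]
        fin_cases i <;> simp [hm]
      · simp only [Fin.mk_one, ι_one_mul_extMonomial]
        fin_cases i <;> simp [hm]
      · simp only [Fin.reduceFinMk, ι_two_mul_extMonomial]
        fin_cases i <;> simp [hm]
    | zero => simp
    | add x y _ _ hx hy => rw [mul_add]; exact add_mem hx hy
    | smul c x _ hx => rw [mul_smul_comm]; exact Submodule.smul_mem _ _ hx
  intro x _
  induction x using CliffordAlgebra.left_induction with
  | algebraMap r =>
    rw [Algebra.algebraMap_eq_smul_one]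
    exact Submodule.smul_mem _ _ (hm 0)
  | add x y hx hy => exact add_mem (hx trivial) (hy trivial)
  | ι_mul x m hx =>
    change Λι m * x ∈ _
    rw [← b.sum_repr m, map_sum, Finset.sum_mul]
    refine sum_mem fun j _ => ?_
    rw [map_smul, smul_mul_assoc]
    exact Submodule.smul_mem _ _ (key j x (hx trivial))

/-- The monomials form a basis of the exterior algebra. -/
noncomputable def extBasis : Module.Basis (Fin 8) K (ExteriorAlgebra K M) :=
  -- The dimension is `2 ^ 3 = 8`, so eight spanning monomials are automatically independent.
  basisOfTopLeSpanOfCardEqFinrank (extMonomial b) (span_extMonomial b) (by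
    rw [Module.finrank_eq_card_basis b.ExteriorAlgebra]
    simp)

@[simp] theorem extBasis_apply (i : Fin 8) : extBasis b i = extMonomial b i := by
  simp [extBasis]

/-- The coordinates of an element of the exterior algebra with respect to the monomials. -/
noncomputable abbrev extCoord : ExteriorAlgebra K M ≃ₗ[K] (Fin 8 → K) := (extBasis b).equivFun

theorem extCoord_extMonomial (i : Fin 8) : extCoord b (extMonomial b i) = Pi.single i 1 := by
  ext j
  rw [← extBasis_apply, Module.Basis.equivFun_self]
  simp [Pi.single_apply, eq_comm]

theorem eq_sum_extMonomial (x : ExteriorAlgebra K M) :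
    x = ∑ i, extCoord b x i • extMonomial b i := by
  simpa using ((extBasis b).sum_equivFun x).symm

/-- The coordinates of the image of a linear map are determined by its values on monomials. -/
theorem extCoord_map (T : ExteriorAlgebra K M →ₗ[K] ExteriorAlgebra K M)
    (x : ExteriorAlgebra K M) :
    extCoord b (T x) = ∑ i, extCoord b x i • extCoord b (T (extMonomial b i)) := by
  conv_lhs => rw [eq_sum_extMonomial b x]
  simp only [map_sum, map_smul]

/-- The transpose of the table on monomials: each coordinate of the product comes, up to sign, from
at most one coordinate of `x`. The same pattern serves the other generators and the contractions. -/
theorem extCoord_ι_zero_mul (x : ExteriorAlgebra K M) : extCoord b (Λι (b 0) * x) =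
    ![0, extCoord b x 0, 0, 0, extCoord b x 2, extCoord b x 3, 0, extCoord b x 6] := by
  rw [← LinearMap.mulLeft_apply (R := K), extCoord_map]
  simp only [LinearMap.mulLeft_apply, ι_zero_mul_extMonomial, Fin.sum_univ_eight]
  ext j
  fin_cases j <;> simp [-Module.Basis.equivFun_apply, extCoord_extMonomial]

theorem extCoord_ι_one_mul (x : ExteriorAlgebra K M) : extCoord b (Λι (b 1) * x) =
    ![0, 0, extCoord b x 0, 0, -extCoord b x 1, 0, extCoord b x 3, -extCoord b x 5] := by
  rw [← LinearMap.mulLeft_apply (R := K), extCoord_map]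
  simp only [LinearMap.mulLeft_apply, ι_one_mul_extMonomial, Fin.sum_univ_eight]
  ext j
  fin_cases j <;> simp [-Module.Basis.equivFun_apply, extCoord_extMonomial]

theorem extCoord_ι_two_mul (x : ExteriorAlgebra K M) : extCoord b (Λι (b 2) * x) =
    ![0, 0, 0, extCoord b x 0, 0, -extCoord b x 1, -extCoord b x 2, extCoord b x 4] := by
  rw [← LinearMap.mulLeft_apply (R := K), extCoord_map]
  simp only [LinearMap.mulLeft_apply, ι_two_mul_extMonomial, Fin.sum_univ_eight]
  ext j
  fin_cases j <;> simp [-Module.Basis.equivFun_apply, extCoord_extMonomial]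

theorem extCoord_contractLeft_zero (x : ExteriorAlgebra K M) :
    extCoord b (CliffordAlgebra.contractLeft (b.coord 0) x) =
    ![extCoord b x 1, 0, extCoord b x 4, extCoord b x 5, 0, 0, extCoord b x 7, 0] := by
  rw [extCoord_map]
  simp only [contractLeft_zero_extMonomial, Fin.sum_univ_eight]
  ext j
  fin_cases j <;> simp [-Module.Basis.equivFun_apply, extCoord_extMonomial]

theorem extCoord_contractLeft_one (x : ExteriorAlgebra K M) :
    extCoord b (CliffordAlgebra.contractLeft (b.coord 1) x) =
    ![extCoord b x 2, -extCoord b x 4, 0, extCoord b x 6, 0, -extCoord b x 7, 0, 0] := by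
  rw [extCoord_map]
  simp only [contractLeft_one_extMonomial, Fin.sum_univ_eight]
  ext j
  fin_cases j <;> simp [-Module.Basis.equivFun_apply, extCoord_extMonomial]

theorem extCoord_contractLeft_two (x : ExteriorAlgebra K M) :
    extCoord b (CliffordAlgebra.contractLeft (b.coord 2) x) =
    ![extCoord b x 3, -extCoord b x 5, -extCoord b x 6, 0, extCoord b x 7, 0, 0, 0] := by
  rw [extCoord_map]
  simp only [contractLeft_two_extMonomial, Fin.sum_univ_eight]
  ext j
  fin_cases j <;> simp [-Module.Basis.equivFun_apply, extCoord_extMonomial]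

theorem extCoord_involute (x : ExteriorAlgebra K M) :
    extCoord b (CliffordAlgebra.involute x) =
      fun i => ![1, -1, -1, -1, 1, 1, 1, -1] i * extCoord b x i := by
  rw [← AlgHom.toLinearMap_apply, extCoord_map]
  simp only [AlgHom.toLinearMap_apply, involute_extMonomial, Fin.sum_univ_eight]
  ext j
  fin_cases j <;> simp [-Module.Basis.equivFun_apply, extCoord_extMonomial]

end ExteriorCoordinates

end CupTable

namespace CupTable

/-! ### The 64 coordinates of a cochain and the matrix of the differential -/

section CochainCoordinates

variable (K : Type u) [Field K]

/-- The basis `x⁻¹, x¹, h⁰` of `𝔥*`. -/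
noncomputable abbrev heisDualBasis : Module.Basis (Fin 3) K (Module.Dual K (Heisenberg K)) :=
  (heisBasis K).dualBasis

/-- The product of a monomial of `Λ𝔥*` and a monomial of `Λ𝔥`. -/
noncomputable def mono (i j : Fin 8) : Cochain K (Heisenberg K) :=
  tens (extMonomial (heisDualBasis K) i) (extMonomial (heisBasis K) j)

/-- The basis of `C` consisting of the products of monomials. -/
noncomputable def cochainBasis : Module.Basis (Fin 8 × Fin 8) K (Cochain K (Heisenberg K)) :=
  ((extBasis (heisDualBasis K)).tensorProduct (extBasis (heisBasis K))).map
    (GradedTensorProduct.of K _ _)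

theorem cochainBasis_apply (i j : Fin 8) : cochainBasis K (i, j) = mono K i j := by
  simp [cochainBasis, mono]
  rfl

variable {K}

/-- The coordinates of a cochain. -/
noncomputable def cochainCoord (i j : Fin 8) : Cochain K (Heisenberg K) →ₗ[K] K :=
  (cochainBasis K).coord (i, j)

theorem cochainCoord_tens (i j : Fin 8) (φ : ExteriorAlgebra K (Module.Dual K (Heisenberg K)))
    (w : ExteriorAlgebra K (Heisenberg K)) : cochainCoord i j (tens φ w) =
      extCoord (heisDualBasis K) φ i * extCoord (heisBasis K) w j := by
  have h : (GradedTensorProduct.of K (fun p : ℕ => ⋀[K]^p (Module.Dual K (Heisenberg K)))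
      (fun q : ℕ => ⋀[K]^q (Heisenberg K))).symm (tens φ w) = φ ⊗ₜ[K] w := rfl
  simp [cochainCoord, cochainBasis, h, mul_comm]

theorem cochainCoord_mono (i j k l : Fin 8) :
    cochainCoord k l (mono K i j) = if i = k ∧ j = l then 1 else 0 := by
  rw [← cochainBasis_apply, cochainCoord, Module.Basis.coord_apply, Module.Basis.repr_self,
    Finsupp.single_apply]
  simp [Prod.ext_iff]

theorem cochain_ext {x y : Cochain K (Heisenberg K)}
    (h : ∀ i j, cochainCoord i j x = cochainCoord i j y) : x = y :=
  (cochainBasis K).ext_elem fun ij => h ij.1 ij.2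

variable (K) in
theorem heisDualBasis_apply (i : Fin 3) : heisDualBasis K i = (heisBasis K).coord i := by
  simp

theorem heisDualBasis_coord (i : Fin 3) :
    (heisDualBasis K).coord i = Module.Dual.eval K (Heisenberg K) (heisBasis K i) := by
  refine LinearMap.ext fun φ => ?_
  rw [Module.Basis.coord_apply, Module.Basis.dualBasis_repr, Module.Dual.eval_apply]

/-- Only `[x₁, x₋₁] = h₀` survives in the Chevalley–Eilenberg formula: `x₁` acts on `Λ𝔥` as `h₀ ∧
ι`, contracting with the dual of `x₋₁`, `x₋₁` acts as minus the analogous operator for `x₁`, and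
`h₀` acts by zero. The last term is the differential of `Λ𝔥*`. -/
theorem differential_tens (φ : ExteriorAlgebra K (Module.Dual K (Heisenberg K)))
    (w : ExteriorAlgebra K (Heisenberg K)) : differential (heisBasis K) (tens φ w) =
      tens (ExteriorAlgebra.ι K (heisDualBasis K 0) * φ)
        (ExteriorAlgebra.ι K (heisBasis K 2) *
          CliffordAlgebra.contractLeft ((heisBasis K).coord 1) w) -
      tens (ExteriorAlgebra.ι K (heisDualBasis K 1) * φ)
        (ExteriorAlgebra.ι K (heisBasis K 2) *
          CliffordAlgebra.contractLeft ((heisBasis K).coord 0) w) -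
      tens (ExteriorAlgebra.ι K (heisDualBasis K 0) * (ExteriorAlgebra.ι K (heisDualBasis K 1) *
        CliffordAlgebra.contractLeft ((heisDualBasis K).coord 2) φ)) w := by
  have h0 : Finset.Ioi (0 : Fin 3) = {1, 2} := by decide
  have h1 : Finset.Ioi (1 : Fin 3) = {2} := by decide
  have h2 : Finset.Ioi (2 : Fin 3) = ∅ := by decide
  rw [heisDualBasis_coord, heisDualBasis_apply, heisDualBasis_apply]
  simp [differential, extAd, Fin.sum_univ_three, heis_bracket_basis, h0, h1,
    h2, heisBasis_apply, sub_eq_add_neg]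

/-- The coordinates of `d x`, in terms of the coordinates of `x`. -/
def differentialMatrix (F : Fin 8 → Fin 8 → K) : Fin 8 → Fin 8 → K :=
  ![0,
    ![0, 0, 0, F 0 2, 0, F 0 4, 0, 0],
    ![0, 0, 0, -F 0 1, 0, 0, F 0 4, 0],
    0,
    ![-F 3 0, -F 3 1, -F 3 2, F 2 2 + F 1 1 - F 3 3, -F 3 4, F 2 4 - F 3 5, -F 1 4 - F 3 6, -F 3 7],
    ![0, 0, 0, F 3 2, 0, F 3 4, 0, 0],
    ![0, 0, 0, -F 3 1, 0, 0, F 3 4, 0],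
    ![0, 0, 0, F 6 2 + F 5 1, 0, F 6 4, -F 5 4, 0]]

theorem differentialMatrix_zero : differentialMatrix (fun _ _ => (0 : K)) = 0 := by
  funext i j
  fin_cases i <;> fin_cases j <;> simp [differentialMatrix]

theorem differentialMatrix_add (F G : Fin 8 → Fin 8 → K) : differentialMatrix
    (fun i j => F i j + G i j) = differentialMatrix F + differentialMatrix G := by
  funext i j
  rw [Pi.add_apply, Pi.add_apply]
  fin_cases i <;> fin_cases j <;> simp [differentialMatrix] <;> ring

theorem cochainCoord_differential (x : Cochain K (Heisenberg K)) (i j : Fin 8) :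
    cochainCoord i j (differential (heisBasis K) x) =
      differentialMatrix (fun k l => cochainCoord k l x) i j := by
  induction x using tens_induction with
  | hz => simp only [map_zero, differentialMatrix_zero, Pi.zero_apply]
  | ha x y hx hy => simp only [map_add, hx, hy, differentialMatrix_add, Pi.add_apply]
  | hp φ w =>
    simp only [differential_tens, map_sub, cochainCoord_tens, extCoord_ι_zero_mul,
      extCoord_ι_one_mul, extCoord_ι_two_mul, extCoord_contractLeft_zero,
      extCoord_contractLeft_one, extCoord_contractLeft_two]
    -- With both coordinate vectors arbitrary, each of the 64 entries is a formal identity in the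
    -- products `f i * g j`.
    generalize extCoord (heisDualBasis K) φ = f
    generalize extCoord (heisBasis K) w = g
    fin_cases i <;> fin_cases j <;> simp [differentialMatrix]

/-- The sign of the parity automorphism on monomials. -/
def monoSign : Fin 8 → K := ![1, -1, -1, -1, 1, 1, 1, -1]

theorem cochainCoord_parity (x : Cochain K (Heisenberg K)) (i j : Fin 8) :
    cochainCoord i j (parity x) = monoSign i * monoSign j * cochainCoord i j x := by
  induction x using tens_induction with
  | hz => simp
  | ha x y hx hy => rw [map_add, map_add, hx, hy, map_add, mul_add]
  | hp φ w =>
    rw [parity_tens, cochainCoord_tens, cochainCoord_tens, extCoord_involute, extCoord_involute]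
    change monoSign i * _ * (monoSign j * _) = _
    ring

/-- Even cochains are fixed by the parity automorphism, which changes the sign of this coordinate;
so the coordinate equals its negative, and the characteristic is zero. -/
theorem cochainCoord_eq_zero_of_even [CharZero K] {x : Cochain K (Heisenberg K)}
    (hx : x ∈ evenPart K (Heisenberg K)) (i j : Fin 8)
    (h : (monoSign i * monoSign j : K) = -1) : cochainCoord i j x = 0 := by
  have := cochainCoord_parity x i j
  rw [parity_of_even x hx, h] at this
  exact self_eq_neg.1 (by simpa using this)

end CochainCoordinates

end CupTable

namespace CupTable

/-! ### Cyclic vectors in the three representations, and the vanishing criterion for equivariant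
bilinear maps -/

section RepresentationsOfSL2

variable {K : Type u} [Field K]

theorem canonicalRep_apply (g : SL2 K) (x : Fin 2 → K) : canonicalRep K g x =
    ![g 0 0 * x 0 + g 0 1 * x 1, g 1 0 * x 0 + g 1 1 * x 1] := by
  change g.1 *ᵥ x = _
  ext i
  fin_cases i <;> simp [Matrix.mulVec, dotProduct, Fin.sum_univ_two]

/-- The trace zero matrix `!![p, q; r, -p]`. -/
def slMk (p q r : K) : SL2Lie K :=
  ⟨!![p, q; r, -p], by simp [mem_sl_iff, Matrix.trace_fin_two]⟩

theorem slMk_eta (A : SL2Lie K) : A = slMk (A.1 0 0) (A.1 0 1) (A.1 1 0) := by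
  have h := A.2
  rw [mem_sl_iff, Matrix.trace_fin_two] at h
  refine Subtype.ext (Matrix.ext fun i j => ?_)
  fin_cases i <;> fin_cases j <;> simp [slMk]
  linear_combination h

theorem slMk_inj {p q r p' q' r' : K} :
    slMk p q r = slMk p' q' r' ↔ p = p' ∧ q = q' ∧ r = r' := by
  refine ⟨fun h => ?_, fun ⟨h, h', h''⟩ => by rw [h, h', h'']⟩
  have h' := congrArg Subtype.val h
  exact ⟨congrFun (congrFun h' 0) 0, congrFun (congrFun h' 0) 1, congrFun (congrFun h' 1) 0⟩

theorem slMk_add (p q r p' q' r' : K) :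
    slMk p q r + slMk p' q' r' = slMk (p + p') (q + q') (r + r') :=
  Subtype.ext (by ext i j; fin_cases i <;> fin_cases j <;> simp [slMk]; ring)

theorem smul_slMk (c p q r : K) : c • slMk p q r = slMk (c * p) (c * q) (c * r) :=
  Subtype.ext (by ext i j; fin_cases i <;> fin_cases j <;> simp [slMk])

theorem slMk_zero : slMk (0 : K) 0 0 = 0 :=
  Subtype.ext (by ext i j; fin_cases i <;> fin_cases j <;> simp [slMk])

theorem adjointRep_slMk (g : SL2 K) (p q r : K) : adjointRep K g (slMk p q r) =
    slMk (p * (g 0 0 * g 1 1 + g 0 1 * g 1 0) - q * (g 0 0 * g 1 0) + r * (g 0 1 * g 1 1))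
      (q * g 0 0 ^ 2 - 2 * p * (g 0 0 * g 0 1) - r * g 0 1 ^ 2)
      (r * g 1 1 ^ 2 + 2 * p * (g 1 0 * g 1 1) - q * g 1 0 ^ 2) := by
  refine Subtype.ext ?_
  change g.1 * !![p, q; r, -p] * (g⁻¹).1 = !![_, _; _, -_]
  rw [Matrix.SpecialLinearGroup.coe_inv, Matrix.adjugate_fin_two]
  ext i j
  fin_cases i <;> fin_cases j <;>
    simp [Matrix.mul_apply, Fin.sum_univ_two] <;> ring

/-- The upper triangular unipotent matrix. -/
def upperUnip (t : K) : SL2 K := ⟨!![1, t; 0, 1], by simp [Matrix.det_fin_two]⟩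

/-- The diagonal matrix with entries `2` and `2⁻¹`. -/
def torusTwo [CharZero K] : SL2 K := ⟨!![2, 0; 0, 2⁻¹], by simp [Matrix.det_fin_two]⟩

/-- The lowest weight vectors. -/
def sl2LowestWeight : ∀ i, sl2V K i
  | 0 => (1 : K)
  | 1 => (![0, 1] : Fin 2 → K)
  | 2 => slMk (0 : K) 0 1

theorem sl2HighestWeight_two : sl2HighestWeight K 2 = slMk (0 : K) 1 0 :=
  Subtype.ext (by ext i j; fin_cases i <;> fin_cases j <;> simp [slMk, sl2HighestWeight])

theorem slMk_mem_of_generators (W : Submodule K (SL2Lie K)) (h1 : slMk 1 0 0 ∈ W)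
    (h2 : slMk 0 1 0 ∈ W) (h3 : slMk 0 0 1 ∈ W) : W = ⊤ := by
  refine eq_top_iff.2 fun A _ => ?_
  have := add_mem (add_mem (W.smul_mem (A.1 0 0) h1) (W.smul_mem (A.1 0 1) h2))
    (W.smul_mem (A.1 1 0) h3)
  rw [slMk_eta A]
  simpa [smul_slMk, slMk_add] using this

theorem vec_mem_of_generators (W : Submodule K (Fin 2 → K)) (h1 : ![1, 0] ∈ W)
    (h2 : ![0, 1] ∈ W) : W = ⊤ := by
  refine eq_top_iff.2 fun x _ => ?_
  have := add_mem (W.smul_mem (x 0) h1) (W.smul_mem (x 1) h2)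
  convert this using 1
  ext i
  fin_cases i <;> simp

theorem scalar_mem_of_generator (W : Submodule K K) (h : 1 ∈ W) : W = ⊤ :=
  eq_top_iff.2 fun x _ => by simpa using W.smul_mem x h

theorem canonicalRep_span_upperUnip (W : Submodule K (Fin 2 → K))
    (h : ∀ t, canonicalRep K (upperUnip t) ![0, 1] ∈ W) : W = ⊤ := by
  have e (t : K) : canonicalRep K (upperUnip t) ![0, 1] = ![t, 1] := by
    rw [canonicalRep_apply]; simp [upperUnip]
  simp only [e] at h
  refine vec_mem_of_generators W ?_ (h 0)
  have := W.sub_mem (h 1) (h 0)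
  rwa [show ![(1 : K), 1] - ![0, 1] = ![1, 0] by
    ext i; fin_cases i <;> simp] at this

/-- The orbit is the curve with coordinates `(t, -t², 1)`. Its points at `t = 0, 1, -1` already
span, by interpolation, since 2 is invertible. -/
theorem adjointRep_span_upperUnip [CharZero K] (W : Submodule K (SL2Lie K))
    (h : ∀ t, adjointRep K (upperUnip t) (slMk 0 0 1) ∈ W) : W = ⊤ := by
  have e (t : K) : adjointRep K (upperUnip t) (slMk 0 0 1) = slMk t (-t ^ 2) 1 := by
    rw [adjointRep_slMk, slMk_inj]; simp [upperUnip]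
  simp only [e] at h
  have h2 : (2 : K) ≠ 0 := two_ne_zero
  refine slMk_mem_of_generators W ?_ ?_ (by simpa using h 0)
  · have := W.smul_mem (1 / 2) (W.add_mem (h 1) (W.smul_mem (-1) (h (-1))))
    simp only [smul_slMk, slMk_add] at this
    convert this using 2 <;> field_simp <;> ring
  · have := W.smul_mem (-1 / 2) (W.add_mem (W.add_mem (h 1) (h (-1))) (W.smul_mem (-2) (h 0)))
    simp only [smul_slMk, slMk_add] at this
    convert this using 2 <;> field_simp <;> ring

/-- Lowest weight vectors are cyclic for the upper unipotent subgroup alone. Since that subgroup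
fixes highest weight vectors, an equivariant bilinear map can be controlled from a single pair of
vectors. -/
theorem span_upperUnip_lowestWeight [CharZero K] : ∀ (i : Fin 3) (W : Submodule K (sl2V K i)),
    (∀ t, sl2Rep K i (upperUnip t) (sl2LowestWeight i) ∈ W) → W = ⊤
  | 0, W, h => scalar_mem_of_generator W (h 0)
  | 1, W, h => canonicalRep_span_upperUnip W h
  | 2, W, h => adjointRep_span_upperUnip W h

/-- The Weyl element. -/
def weylElement : SL2 K := ⟨!![0, -1; 1, 0], by simp [Matrix.det_fin_two]⟩

theorem lowestWeight_eq_smul : ∀ i : Fin 3, ∃ c : K,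
    sl2LowestWeight i = c • sl2Rep K i weylElement (sl2HighestWeight K i)
  | 0 => ⟨1, (one_smul K (1 : K)).symm⟩
  | 1 => ⟨1, by
      change ![0, 1] = (1 : K) • canonicalRep K weylElement ![1, 0]
      rw [canonicalRep_apply]; simp [weylElement]⟩
  | 2 => ⟨-1, by
      rw [sl2HighestWeight_two]
      change slMk 0 0 1 = (-1 : K) • adjointRep K weylElement (slMk 0 1 0)
      rw [adjointRep_slMk, smul_slMk, slMk_inj]; simp [weylElement]⟩

/-- The Weyl element carries the highest weight vector to a multiple of the lowest one, so this
orbit contains, up to scalars, the unipotent orbit that already spans. -/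
theorem span_orbit_highestWeight [CharZero K] (i : Fin 3) (W : Submodule K (sl2V K i))
    (h : ∀ g, sl2Rep K i g (sl2HighestWeight K i) ∈ W) : W = ⊤ := by
  refine span_upperUnip_lowestWeight i W fun t => ?_
  obtain ⟨c, hc⟩ := lowestWeight_eq_smul (K := K) i
  rw [hc, map_smul, ← Module.End.mul_apply, ← map_mul]
  exact W.smul_mem _ (h _)

theorem upperUnip_highestWeight : ∀ (i : Fin 3) (t : K),
    sl2Rep K i (upperUnip t) (sl2HighestWeight K i) = sl2HighestWeight K i
  | 0, _ => rfl
  | 1, t => by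
    change canonicalRep K (upperUnip t) ![1, 0] = ![1, 0]
    rw [canonicalRep_apply]; simp [upperUnip]
  | 2, t => by
    rw [sl2HighestWeight_two]
    change adjointRep K (upperUnip t) (slMk 0 1 0) = slMk 0 1 0
    rw [adjointRep_slMk, slMk_inj]; simp [upperUnip]

variable [CharZero K]

variable {A : Type*} [AddCommGroup A] [Module K A] (σ : Representation K (SL2 K) A)

/-- A morphism on an irreducible representation is determined by the image of the highest weight
vector. -/
theorem eq_of_highestWeight {i : Fin 3} {f f' : sl2V K i →ₗ[K] A}
    (hf : Representation.IsIntertwiningMap (sl2Rep K i) σ f)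
    (hf' : Representation.IsIntertwiningMap (sl2Rep K i) σ f')
    (h : f (sl2HighestWeight K i) = f' (sl2HighestWeight K i)) : f = f' := by
  have := span_orbit_highestWeight i (LinearMap.eqLocus f f') fun g => by
    rw [LinearMap.mem_eqLocus, hf.1, hf'.1, h]
  exact LinearMap.eqLocus_eq_top.1 this

/-- An equivariant bilinear map is determined by its value on a highest weight vector and a lowest
weight vector. -/
theorem bilin_eq_zero {i j : Fin 3} (B : sl2V K i →ₗ[K] sl2V K j →ₗ[K] A)
    (hB : ∀ g x y, B (sl2Rep K i g x) (sl2Rep K j g y) = σ g (B x y))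
    (h : B (sl2HighestWeight K i) (sl2LowestWeight j) = 0) : B = 0 := by
  -- For `u` upper unipotent, `B(v₊, u v₋) = B(u v₊, u v₋) = u B(v₊, v₋) = 0`, and the vectors `u
  -- v₋` span.
  have h1 : LinearMap.ker (B (sl2HighestWeight K i)) = ⊤ :=
    span_upperUnip_lowestWeight j _ fun t => by
      have := hB (upperUnip t) (sl2HighestWeight K i) (sl2LowestWeight j)
      rw [upperUnip_highestWeight, h, map_zero] at this
      exact this
  -- Now `B(g v₊, y) = g B(v₊, g⁻¹ y) = 0` for all `g` and `y`, and the vectors `g v₊` span.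
  have h2 : LinearMap.ker B = ⊤ := span_orbit_highestWeight i _ fun g => by
    refine LinearMap.mem_ker.2 (LinearMap.ext fun y => ?_)
    have := hB g (sl2HighestWeight K i) (sl2Rep K j g⁻¹ y)
    rw [LinearMap.ker_eq_top.1 h1, LinearMap.zero_apply, map_zero, ← Module.End.mul_apply,
      ← map_mul, mul_inv_cancel, map_one] at this
    exact this
  exact LinearMap.ker_eq_top.1 h2

end RepresentationsOfSL2

end CupTable

namespace CupTable

/-! ### The spaces of equivariant bilinear maps, irreducibility, and the labeling -/

section LabelingOfSL2

variable {K : Type u} [Field K]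

theorem m110_apply (x y : Fin 2 → K) : m110 x y = x 0 * y 1 - x 1 * y 0 := by
  simp [m110, Matrix.det_fin_two]

theorem m112_apply (x y : Fin 2 → K) : m112 x y =
    slMk (x 0 * y 1 + x 1 * y 0) (-2 * x 0 * y 0) (2 * x 1 * y 1) := by
  refine Subtype.ext ?_
  ext i j
  fin_cases i <;> fin_cases j <;> simp [m112, slMk]
  ring

theorem m211_slMk (p q r : K) (x : Fin 2 → K) :
    m211 (slMk p q r) x = ![p * x 0 + q * x 1, r * x 0 - p * x 1] := by
  ext i
  fin_cases i <;> simp [m211, slMk, Matrix.vecMul, dotProduct, Fin.sum_univ_two] <;> ring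

theorem m220_slMk (p q r p' q' r' : K) :
    m220 (slMk p q r) (slMk p' q' r') = 2 * p * p' + q * r' + r * q' := by
  simp [m220, slMk, Matrix.trace_fin_two]
  ring

theorem m222_slMk (p q r p' q' r' : K) : m222 (slMk p q r) (slMk p' q' r') =
    slMk (q * r' - r * q') (2 * (p * q' - q * p')) (2 * (r * p' - p * r')) := by
  refine Subtype.ext ?_
  change !![p, q; r, -p] * !![p', q'; r', -p'] - !![p', q'; r', -p'] * !![p, q; r, -p] =
    !![_, _; _, -_]
  ext i j
  fin_cases i <;> fin_cases j <;> simp <;> ring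

theorem m110_equivariant (g : SL2 K) (x y : Fin 2 → K) :
    m110 (canonicalRep K g x) (canonicalRep K g y) = m110 x y := by
  have h := g.det_coe
  rw [Matrix.det_fin_two] at h
  simp only [canonicalRep_apply, m110_apply, Matrix.cons_val_zero, Matrix.cons_val_one]
  linear_combination (x 0 * y 1 - x 1 * y 0) * h

theorem m112_equivariant (g : SL2 K) (x y : Fin 2 → K) :
    m112 (canonicalRep K g x) (canonicalRep K g y) = adjointRep K g (m112 x y) := by
  simp only [canonicalRep_apply, m112_apply, adjointRep_slMk, slMk_inj, Matrix.cons_val_zero,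
    Matrix.cons_val_one]
  refine ⟨?_, ?_, ?_⟩ <;> ring

theorem m211_equivariant (g : SL2 K) (A : SL2Lie K) (x : Fin 2 → K) :
    m211 (adjointRep K g A) (canonicalRep K g x) = canonicalRep K g (m211 A x) := by
  have h := g.det_coe
  rw [Matrix.det_fin_two] at h
  rw [slMk_eta A]
  generalize A.1 0 0 = p
  generalize A.1 0 1 = q
  generalize A.1 1 0 = r
  simp only [canonicalRep_apply, m211_slMk, adjointRep_slMk, Matrix.cons_val_zero,
    Matrix.cons_val_one]
  ext i
  fin_cases i
  · change _ = g 0 0 * _ + g 0 1 * _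
    change _ + _ = _
    linear_combination (g 0 0 * (p * x 0 + q * x 1) + g 0 1 * (r * x 0 - p * x 1)) * h
  · change _ - _ = g 1 0 * _ + g 1 1 * _
    linear_combination (g 1 0 * (p * x 0 + q * x 1) + g 1 1 * (r * x 0 - p * x 1)) * h

theorem coe_adjointRep (g : SL2 K) (A : SL2Lie K) :
    (adjointRep K g A).1 = g.1 * A.1 * (g⁻¹).1 := rfl

theorem coe_inv_mul_cancel (g : SL2 K) (A : Matrix (Fin 2) (Fin 2) K) :
    (g⁻¹).1 * (g.1 * A) = A := by
  rw [← mul_assoc, ← Matrix.SpecialLinearGroup.coe_mul, inv_mul_cancel,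
    Matrix.SpecialLinearGroup.coe_one, one_mul]

theorem m220_equivariant (g : SL2 K) (A B : SL2Lie K) :
    m220 (adjointRep K g A) (adjointRep K g B) = m220 A B := by
  change ((adjointRep K g A).1 * (adjointRep K g B).1).trace = (A.1 * B.1).trace
  rw [coe_adjointRep, coe_adjointRep, mul_assoc, mul_assoc g.1 B.1, coe_inv_mul_cancel,
    Matrix.trace_mul_comm, mul_assoc, coe_inv_mul_cancel, Matrix.trace_mul_comm]

theorem m222_equivariant (g : SL2 K) (A B : SL2Lie K) :
    m222 (adjointRep K g A) (adjointRep K g B) = adjointRep K g (m222 A B) := by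
  refine Subtype.ext ?_
  change (adjointRep K g A).1 * (adjointRep K g B).1 -
    (adjointRep K g B).1 * (adjointRep K g A).1 = g.1 * (A.1 * B.1 - B.1 * A.1) * (g⁻¹).1
  simp only [coe_adjointRep, mul_assoc, coe_inv_mul_cancel, mul_sub, sub_mul]

theorem sl2Bilin_equivariant (g : SL2 K) : ∀ (i j k : Fin 3) (x : sl2V K i) (y : sl2V K j),
    sl2Bilin K i j k (sl2Rep K i g x) (sl2Rep K j g y) = sl2Rep K k g (sl2Bilin K i j k x y)
  | 0, 0, 0, _, _ => rfl
  | 0, 1, 1, a, x => ((canonicalRep K g).map_smul a x).symm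
  | 0, 2, 2, a, x => ((adjointRep K g).map_smul a x).symm
  | 1, 0, 1, x, a => ((canonicalRep K g).map_smul a x).symm
  | 2, 0, 2, x, a => ((adjointRep K g).map_smul a x).symm
  | 1, 1, 0, x, y => m110_equivariant g x y
  | 1, 1, 2, x, y => m112_equivariant g x y
  | 2, 1, 1, A, x => m211_equivariant g A x
  | 1, 2, 1, x, A => m211_equivariant g A x
  | 2, 2, 0, A, B => m220_equivariant g A B
  | 2, 2, 2, A, B => m222_equivariant g A B
  | 0, 0, 1, _, _ | 0, 0, 2, _, _ | 0, 1, 0, _, _ | 0, 1, 2, _, _ | 0, 2, 0, _, _ | 0, 2, 1, _, _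
  | 1, 0, 0, _, _ | 1, 0, 2, _, _ | 1, 1, 1, _, _ | 1, 2, 0, _, _ | 1, 2, 2, _, _
  | 2, 0, 0, _, _ | 2, 0, 1, _, _ | 2, 1, 0, _, _ | 2, 1, 2, _, _ | 2, 2, 1, _, _ =>
    (map_zero _).symm

theorem m110_weight : m110 ![1, 0] ![(0 : K), 1] = 1 := by simp [m110_apply]

theorem m112_weight : m112 ![1, 0] ![(0 : K), 1] = slMk 1 0 0 := by simp [m112_apply]

theorem m211_weight : m211 (sl2HighestWeight K 2) ![0, 1] = ![1, 0] := by
  rw [sl2HighestWeight_two]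
  exact (m211_slMk _ _ _ _).trans (by simp)

theorem m211_flip_weight : m211 (slMk 0 0 1) ![(1 : K), 0] = ![0, 1] :=
  (m211_slMk _ _ _ _).trans (by simp)

theorem m220_weight : m220 (sl2HighestWeight K 2) (slMk 0 0 1) = 1 := by
  rw [sl2HighestWeight_two]
  exact (m220_slMk _ _ _ _ _ _).trans (by simp)

theorem m222_weight : m222 (sl2HighestWeight K 2) (slMk 0 0 1) = slMk 1 0 0 := by
  rw [sl2HighestWeight_two]
  exact (m222_slMk _ _ _ _ _ _).trans (by simp)

theorem eq_smul_of_apply_one_eq_zero {z : Fin 2 → K} (h : z 1 = 0) : z = z 0 • ![1, 0] := by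
  ext i; fin_cases i <;> simp [h]

theorem eq_smul_of_apply_zero_eq_zero {z : Fin 2 → K} (h : z 0 = 0) : z = z 1 • ![0, 1] := by
  ext i; fin_cases i <;> simp [h]

theorem eq_smul_slMk_diag {z : SL2Lie K} (h1 : z.1 0 1 = 0) (h2 : z.1 1 0 = 0) :
    z = z.1 0 0 • slMk 1 0 0 := by
  rw [smul_slMk]; conv_lhs => rw [slMk_eta z, h1, h2]
  simp

theorem eq_smul_slMk_upper {z : SL2Lie K} (h1 : z.1 0 0 = 0) (h2 : z.1 1 0 = 0) :
    z = z.1 0 1 • slMk 0 1 0 := by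
  rw [smul_slMk]; conv_lhs => rw [slMk_eta z, h1, h2]
  simp

theorem eq_smul_slMk_lower {z : SL2Lie K} (h1 : z.1 0 0 = 0) (h2 : z.1 0 1 = 0) :
    z = z.1 1 0 • slMk 0 0 1 := by
  rw [smul_slMk]; conv_lhs => rw [slMk_eta z, h1, h2]
  simp

theorem eq_smul_of_eq_one {z v : K} (h : v = 1) : z = z • v := by simp [h]

theorem slMk_ne_zero {p q r : K} (h : p ≠ 0 ∨ q ≠ 0 ∨ r ≠ 0) : slMk p q r ≠ 0 := by
  rw [← slMk_zero, Ne, slMk_inj]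
  tauto

theorem vec_ne_zero {p q : K} (h : p ≠ 0 ∨ q ≠ 0) : (![p, q] : Fin 2 → K) ≠ 0 := by
  intro h'
  have h0 : p = 0 := congrFun h' 0
  have h1 : q = 0 := congrFun h' 1
  tauto

/-- The pair `(v₊, v₋)` detects every chosen map. This yields both the linear independence of the
labeling maps and the uniqueness of the table coefficients. -/
theorem sl2Bilin_weight_ne_zero : ∀ i j k : Fin 3, sl2Dim i j k ≠ 0 →
    sl2Bilin K i j k (sl2HighestWeight K i) (sl2LowestWeight j) ≠ 0
  | 0, 0, 0, _ => fun h => (one_ne_zero : (1 : K) ≠ 0) (Eq.trans (mul_one (1 : K)).symm h)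
  | 0, 1, 1, _ => fun h => vec_ne_zero (Or.inr one_ne_zero) (Eq.trans (one_smul K (![0, 1] : Fin 2 → K)).symm h)
  | 0, 2, 2, _ => fun h => slMk_ne_zero (Or.inr (Or.inr one_ne_zero)) (Eq.trans (one_smul K (slMk (0 : K) 0 1)).symm h)
  | 1, 0, 1, _ => fun h => vec_ne_zero (Or.inl one_ne_zero) (Eq.trans (one_smul K (![1, 0] : Fin 2 → K)).symm h)
  | 1, 1, 0, _ => fun h => (one_ne_zero : (1 : K) ≠ 0) (Eq.trans (m110_weight).symm h)
  | 1, 1, 2, _ => fun h => slMk_ne_zero (Or.inl one_ne_zero) (Eq.trans (m112_weight).symm h)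
  | 1, 2, 1, _ => fun h => vec_ne_zero (Or.inr one_ne_zero) (Eq.trans (m211_flip_weight).symm h)
  | 2, 0, 2, _ => fun h => slMk_ne_zero (Or.inr (Or.inl one_ne_zero)) (Eq.trans ((one_smul K (sl2HighestWeight K 2)).trans sl2HighestWeight_two).symm h)
  | 2, 1, 1, _ => fun h => vec_ne_zero (Or.inl one_ne_zero) (Eq.trans (m211_weight).symm h)
  | 2, 2, 0, _ => fun h => (one_ne_zero : (1 : K) ≠ 0) (Eq.trans (m220_weight).symm h)
  | 2, 2, 2, _ => fun h => slMk_ne_zero (Or.inl one_ne_zero) (Eq.trans (m222_weight).symm h)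
  | 0, 0, 1, h | 0, 0, 2, h | 0, 1, 0, h | 0, 1, 2, h | 0, 2, 0, h | 0, 2, 1, h
  | 1, 0, 0, h | 1, 0, 2, h | 1, 1, 1, h | 1, 2, 0, h | 1, 2, 2, h | 2, 0, 0, h
  | 2, 0, 1, h | 2, 1, 0, h | 2, 1, 2, h | 2, 2, 1, h => absurd rfl h

/-- With `u` the unipotent matrix of parameter 1, `u v - v = v₂ (1, 0)` lies in `W`; when the second
coordinate `v₂` is zero, `v` itself is a multiple of `(1, 0)`. -/
theorem canonicalRep_highestWeight_mem (W : Submodule K (Fin 2 → K))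
    (hW : ∀ g, ∀ v ∈ W, canonicalRep K g v ∈ W) (v : Fin 2 → K) (hv : v ∈ W) (h0 : v ≠ 0) :
    ![1, 0] ∈ W := by
  have key (c : K) (hc : c ≠ 0) (h : c • ![1, 0] ∈ W) : ![1, 0] ∈ W := by
    have := W.smul_mem c⁻¹ h
    rwa [smul_smul, inv_mul_cancel₀ hc, one_smul] at this
  by_cases h1 : v 1 = 0
  · rw [eq_smul_of_apply_one_eq_zero h1] at hv
    refine key (v 0) (fun h => h0 ?_) hv
    rw [eq_smul_of_apply_one_eq_zero h1, h, zero_smul]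
  · refine key (v 1) h1 ?_
    convert W.sub_mem (hW (upperUnip 1) v hv) hv using 1
    rw [canonicalRep_apply]
    ext i
    fin_cases i <;> simp [upperUnip]

theorem one_mem_of_ne_zero (W : Submodule K K) (v : K) (hv : v ∈ W) (h0 : v ≠ 0) : 1 ∈ W := by
  have := W.smul_mem v⁻¹ hv
  rwa [smul_eq_mul, inv_mul_cancel₀ h0] at this

theorem sl2Bilin_eq_zero (i j k : Fin 3) (h : sl2Dim i j k = 0) : sl2Bilin K i j k = 0 := by
  fin_cases i <;> fin_cases j <;> fin_cases k <;> first | rfl | exact absurd h one_ne_zero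

theorem sl2V_finiteDimensional : ∀ i : Fin 3, FiniteDimensional K (sl2V K i)
  | 0 => inferInstanceAs (FiniteDimensional K K)
  | 1 => inferInstanceAs (FiniteDimensional K (Fin 2 → K))
  | 2 => inferInstanceAs (FiniteDimensional K (SL2Lie K))

variable [CharZero K]

/-- In characteristic zero the powers of 2 are distinct, so this single torus element separates
weights and no maximal torus or Lie algebra action is needed. -/
theorem torusTwo_highestWeight : ∀ i : Fin 3, sl2Rep K i torusTwo (sl2HighestWeight K i) =
    (2 : K) ^ (i : ℕ) • sl2HighestWeight K i
  | 0 => (by rw [pow_zero, one_smul] : (1 : K) = (2 : K) ^ 0 • (1 : K))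
  | 1 => by
    have : canonicalRep K torusTwo ![1, 0] = (2 : K) ^ 1 • ![1, 0] := by
      rw [canonicalRep_apply]
      ext i
      fin_cases i <;> simp [torusTwo]
    exact this
  | 2 => by
    have : adjointRep K torusTwo (slMk 0 1 0) = (2 : K) ^ 2 • slMk 0 1 0 := by
      rw [adjointRep_slMk, smul_slMk, slMk_inj]
      simp [torusTwo]
    rw [sl2HighestWeight_two]
    exact this

theorem torusTwo_lowestWeight : ∀ i : Fin 3, sl2Rep K i torusTwo (sl2LowestWeight i) =
    ((2 : K) ^ (i : ℕ))⁻¹ • sl2LowestWeight i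
  | 0 => (by rw [pow_zero, inv_one, one_smul] : (1 : K) = ((2 : K) ^ 0)⁻¹ • (1 : K))
  | 1 => by
    have : canonicalRep K torusTwo ![0, 1] = ((2 : K) ^ 1)⁻¹ • ![0, 1] := by
      rw [canonicalRep_apply]
      ext i
      fin_cases i <;> simp [torusTwo]
    exact this
  | 2 => by
    have : adjointRep K torusTwo (slMk 0 0 1) = ((2 : K) ^ 2)⁻¹ • slMk 0 0 1 := by
      rw [adjointRep_slMk, smul_slMk, slMk_inj]
      simp [torusTwo]
    exact this

theorem trivial_weight {c : K} {z : K} (h : z = c • z) : c ≠ 1 → z = 0 := by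
  rw [smul_eq_mul] at h
  grind

theorem canonicalRep_weight {c : K} {z : Fin 2 → K} (h : canonicalRep K torusTwo z = c • z) :
    (c ≠ 2 → z 0 = 0) ∧ (c ≠ 2⁻¹ → z 1 = 0) := by
  rw [canonicalRep_apply] at h
  have h0 := congrFun h 0
  have h1 := congrFun h 1
  simp [torusTwo] at h0 h1
  grind

theorem adjointRep_weight {c : K} {z : SL2Lie K} (h : adjointRep K torusTwo z = c • z) :
    (c ≠ 1 → z.1 0 0 = 0) ∧ (c ≠ 4 → z.1 0 1 = 0) ∧ (c ≠ 4⁻¹ → z.1 1 0 = 0) := by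
  rw [slMk_eta z, adjointRep_slMk, smul_slMk, slMk_inj] at h
  simp [torusTwo] at h
  grind

theorem canonicalRep_weight_eq_zero {c : K} {z : Fin 2 → K}
    (h : canonicalRep K torusTwo z = c • z) (h1 : c ≠ 2) (h2 : c ≠ 2⁻¹) : z = 0 := by
  ext i
  fin_cases i
  exacts [(canonicalRep_weight h).1 h1, (canonicalRep_weight h).2 h2]

theorem adjointRep_weight_eq_zero {c : K} {z : SL2Lie K} (h : adjointRep K torusTwo z = c • z)
    (h1 : c ≠ 1) (h2 : c ≠ 4) (h3 : c ≠ 4⁻¹) : z = 0 := by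
  obtain ⟨h1', h2', h3'⟩ := adjointRep_weight h
  rw [slMk_eta z, h1' h1, h2' h2, h3' h3, slMk_zero]

/-- Invariance under the torus leaves only a diagonal matrix `diag(p, -p)`, and conjugation by the
unipotent matrix of parameter 1 gives it the upper entry `-2p`, so `p = 0`. -/
theorem adjointRep_fixed_eq_zero {z : SL2Lie K} (h : ∀ g, adjointRep K g z = z) : z = 0 := by
  obtain ⟨-, h2, h3⟩ := adjointRep_weight (K := K) (c := 1) (z := z) (by rw [h, one_smul])
  have h2 := h2 (by norm_num)
  have h3 := h3 (by norm_num)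
  have h1 := h (upperUnip 1)
  rw [slMk_eta z, h2, h3, adjointRep_slMk, slMk_inj] at h1
  simp [upperUnip] at h1
  rw [slMk_eta z, h1, h2, h3, slMk_zero]

/-- The vector `z` plays the role of `B(v₊, v₋)`, which has torus eigenvalue `2^(i-j)`. Each weight
space of `V_k` is at most a line, so `z` is zero or a multiple of the value of the chosen map. Only
for `i = j = 0`, `k = 2` is there a weight line without a nonzero equivariant map; full invariance
excludes it, and the last hypothesis on `z` exists for this case. -/
theorem exists_smul_bilin_of_weight : ∀ (i j k : Fin 3) (z : sl2V K k),
    sl2Rep K k torusTwo z = ((2 : K) ^ (i : ℕ) * ((2 : K) ^ (j : ℕ))⁻¹) • z →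
    (i = 0 → j = 0 → ∀ g, sl2Rep K k g z = z) →
    ∃ c : K, z = c • sl2Bilin K i j k (sl2HighestWeight K i) (sl2LowestWeight j)
  | 0, 0, 0, z, h, _ => ⟨z, eq_smul_of_eq_one (K := K) (mul_one (1 : K))⟩
  | 0, 0, 1, z, h, _ => ⟨0, (canonicalRep_weight_eq_zero h (by norm_num) (by norm_num) : z = 0).trans (smul_zero _).symm⟩
  | 0, 0, 2, z, _, h => ⟨0, (adjointRep_fixed_eq_zero (h rfl rfl)).trans (smul_zero _).symm⟩
  | 0, 1, 0, z, h, _ => ⟨0, (trivial_weight (K := K) h (by norm_num) : z = 0).trans (smul_zero _).symm⟩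
  | 0, 1, 1, z, h, _ => ⟨_, (eq_smul_of_apply_zero_eq_zero ((canonicalRep_weight h).1 (by norm_num))).trans
    (congrArg (_ • ·) (one_smul K (![0, 1] : Fin 2 → K)).symm)⟩
  | 0, 1, 2, z, h, _ => ⟨0, (adjointRep_weight_eq_zero h (by norm_num) (by norm_num) (by norm_num) : z = 0).trans (smul_zero _).symm⟩
  | 0, 2, 0, z, h, _ => ⟨0, (trivial_weight (K := K) h (by norm_num) : z = 0).trans (smul_zero _).symm⟩
  | 0, 2, 1, z, h, _ => ⟨0, (canonicalRep_weight_eq_zero h (by norm_num) (by norm_num) : z = 0).trans (smul_zero _).symm⟩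
  | 0, 2, 2, z, h, _ => ⟨_, (eq_smul_slMk_lower ((adjointRep_weight h).1 (by norm_num))
    ((adjointRep_weight h).2.1 (by norm_num))).trans (congrArg (_ • ·) (one_smul K (slMk (0 : K) 0 1)).symm)⟩
  | 1, 0, 0, z, h, _ => ⟨0, (trivial_weight (K := K) h (by norm_num) : z = 0).trans (smul_zero _).symm⟩
  | 1, 0, 1, z, h, _ => ⟨_, (eq_smul_of_apply_one_eq_zero ((canonicalRep_weight h).2 (by norm_num))).trans
    (congrArg (_ • ·) (one_smul K (![1, 0] : Fin 2 → K)).symm)⟩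
  | 1, 0, 2, z, h, _ => ⟨0, (adjointRep_weight_eq_zero h (by norm_num) (by norm_num) (by norm_num) : z = 0).trans (smul_zero _).symm⟩
  | 1, 1, 0, z, h, _ => ⟨z, eq_smul_of_eq_one (K := K) m110_weight⟩
  | 1, 1, 1, z, h, _ => ⟨0, (canonicalRep_weight_eq_zero h (by norm_num) (by norm_num) : z = 0).trans (smul_zero _).symm⟩
  | 1, 1, 2, z, h, _ => ⟨_, (eq_smul_slMk_diag ((adjointRep_weight h).2.1 (by norm_num))
    ((adjointRep_weight h).2.2 (by norm_num))).trans (congrArg (_ • ·) (m112_weight).symm)⟩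
  | 1, 2, 0, z, h, _ => ⟨0, (trivial_weight (K := K) h (by norm_num) : z = 0).trans (smul_zero _).symm⟩
  | 1, 2, 1, z, h, _ => ⟨_, (eq_smul_of_apply_zero_eq_zero ((canonicalRep_weight h).1 (by norm_num))).trans
    (congrArg (_ • ·) (m211_flip_weight).symm)⟩
  | 1, 2, 2, z, h, _ => ⟨0, (adjointRep_weight_eq_zero h (by norm_num) (by norm_num) (by norm_num) : z = 0).trans (smul_zero _).symm⟩
  | 2, 0, 0, z, h, _ => ⟨0, (trivial_weight (K := K) h (by norm_num) : z = 0).trans (smul_zero _).symm⟩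
  | 2, 0, 1, z, h, _ => ⟨0, (canonicalRep_weight_eq_zero h (by norm_num) (by norm_num) : z = 0).trans (smul_zero _).symm⟩
  | 2, 0, 2, z, h, _ => ⟨_, (eq_smul_slMk_upper ((adjointRep_weight h).1 (by norm_num))
    ((adjointRep_weight h).2.2 (by norm_num))).trans (congrArg (_ • ·) ((one_smul K (sl2HighestWeight K 2)).trans sl2HighestWeight_two).symm)⟩
  | 2, 1, 0, z, h, _ => ⟨0, (trivial_weight (K := K) h (by norm_num) : z = 0).trans (smul_zero _).symm⟩
  | 2, 1, 1, z, h, _ => ⟨_, (eq_smul_of_apply_one_eq_zero ((canonicalRep_weight h).2 (by norm_num))).trans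
    (congrArg (_ • ·) (m211_weight).symm)⟩
  | 2, 1, 2, z, h, _ => ⟨0, (adjointRep_weight_eq_zero h (by norm_num) (by norm_num) (by norm_num) : z = 0).trans (smul_zero _).symm⟩
  | 2, 2, 0, z, h, _ => ⟨z, eq_smul_of_eq_one (K := K) m220_weight⟩
  | 2, 2, 1, z, h, _ => ⟨0, (canonicalRep_weight_eq_zero h (by norm_num) (by norm_num) : z = 0).trans (smul_zero _).symm⟩
  | 2, 2, 2, z, h, _ => ⟨_, (eq_smul_slMk_diag ((adjointRep_weight h).2.1 (by norm_num))
    ((adjointRep_weight h).2.2 (by norm_num))).trans (congrArg (_ • ·) (m222_weight).symm)⟩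

/-- Every equivariant bilinear map is a multiple of the chosen one. -/
theorem exists_eq_smul_bilin (i j k : Fin 3) (B : sl2V K i →ₗ[K] sl2V K j →ₗ[K] sl2V K k)
    (hB : ∀ g x y, B (sl2Rep K i g x) (sl2Rep K j g y) = sl2Rep K k g (B x y)) :
    ∃ c : K, B = c • sl2Bilin K i j k := by
  obtain ⟨c, hc⟩ := exists_smul_bilin_of_weight i j k
    (B (sl2HighestWeight K i) (sl2LowestWeight j))
    (by rw [← hB, torusTwo_highestWeight, torusTwo_lowestWeight, map_smul, map_smul,
      LinearMap.smul_apply, smul_smul, mul_comm])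
    -- Both weight vectors of `V_0` are the fixed vector 1, so here `B(v₊, v₋)` is invariant.
    (fun hi hj g => by subst hi hj; exact (hB g _ _).symm)
  -- The difference of `B` and `c` times the chosen map is equivariant and vanishes at `(v₊, v₋)`.
  refine ⟨c, sub_eq_zero.1 (bilin_eq_zero (sl2Rep K k) _ (fun g x y => ?_) ?_)⟩
  · simp only [LinearMap.sub_apply, LinearMap.smul_apply, hB, sl2Bilin_equivariant, map_sub,
      map_smul]
  · simp only [LinearMap.sub_apply, LinearMap.smul_apply, ← hc, sub_self]

theorem sl2HighestWeight_ne_zero : ∀ i : Fin 3, sl2HighestWeight K i ≠ 0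
  | 0 => (one_ne_zero : (1 : K) ≠ 0)
  | 1 => vec_ne_zero (Or.inl one_ne_zero)
  | 2 => by
    rw [sl2HighestWeight_two]
    exact slMk_ne_zero (Or.inr (Or.inl one_ne_zero))

/-- For the unipotent `u` of parameter 1, `u - 1` sends `(p, q, r)` to `(r, -2p - r, 0)`, and
applied twice it gives `(0, -2r, 0)`. According to whether `r ≠ 0`, or `r = 0 ≠ p`, or only `q`
survives, two, one or no applications land on a nonzero multiple of the highest weight vector. -/
theorem adjointRep_highestWeight_mem (W : Submodule K (SL2Lie K))
    (hW : ∀ g, ∀ v ∈ W, adjointRep K g v ∈ W) (v : SL2Lie K) (hv : v ∈ W) (h0 : v ≠ 0) :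
    slMk 0 1 0 ∈ W := by
  have key (c : K) (hc : c ≠ 0) (h : slMk 0 c 0 ∈ W) : slMk 0 1 0 ∈ W := by
    have := W.smul_mem c⁻¹ h
    rwa [smul_slMk, mul_zero, inv_mul_cancel₀ hc] at this
  have hu (p q r : K) :
      adjointRep K (upperUnip 1) (slMk p q r) = slMk (p + r) (q - 2 * p - r) r := by
    rw [adjointRep_slMk, slMk_inj]
    simp [upperUnip]
  have hsub (p q r : K) (h : slMk p q r ∈ W) : slMk r (-2 * p - r) 0 ∈ W := by
    have := W.add_mem (hW (upperUnip 1) _ h) (W.smul_mem (-1) h)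
    rw [hu, smul_slMk, slMk_add] at this
    convert this using 2 <;> ring
  rw [slMk_eta v] at hv h0
  by_cases hr : v.1 1 0 = 0
  · by_cases hp : v.1 0 0 = 0
    · rw [hp, hr] at hv h0
      exact key _ (fun h => h0 (by rw [h, slMk_zero])) hv
    · have := hsub _ _ _ hv
      rw [hr, sub_zero] at this
      exact key _ (mul_ne_zero (by norm_num) hp) this
  · have := hsub _ _ _ (hsub _ _ _ hv)
    rw [sub_zero] at this
    exact key _ (mul_ne_zero (by norm_num) hr) this

theorem sl2HighestWeight_mem : ∀ (i : Fin 3) (W : Submodule K (sl2V K i)),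
    (∀ g, ∀ v ∈ W, sl2Rep K i g v ∈ W) → ∀ v ∈ W, v ≠ 0 → sl2HighestWeight K i ∈ W
  | 0, W, _, v, hv, h0 => one_mem_of_ne_zero W v hv h0
  | 1, W, hW, v, hv, h0 => canonicalRep_highestWeight_mem W hW v hv h0
  | 2, W, hW, v, hv, h0 => by
    rw [sl2HighestWeight_two]
    exact adjointRep_highestWeight_mem W hW v hv h0

/-- Every nonzero subrepresentation contains the highest weight vector, whose orbit spans. -/
theorem sl2Rep_isIrreducible (i : Fin 3) : (sl2Rep K i).IsIrreducible where
  exists_pair_ne := ⟨⊥, ⊤, fun h => sl2HighestWeight_ne_zero (K := K) i <| by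
    have : sl2HighestWeight K i ∈ (⊥ : Subrepresentation (sl2Rep K i)).toSubmodule := by
      rw [h]; exact Submodule.mem_top
    exact this⟩
  eq_bot_or_eq_top W := by
    by_cases h : ∀ v ∈ W.toSubmodule, v = 0
    · exact Or.inl (Subrepresentation.toSubmodule_injective ((Submodule.eq_bot_iff _).2 h))
    · push Not at h
      obtain ⟨v, hv, h0⟩ := h
      refine Or.inr (Subrepresentation.toSubmodule_injective ?_)
      exact span_orbit_highestWeight i _ fun g => W.apply_mem_toSubmodule g
        (sl2HighestWeight_mem i _ (fun g v hv => W.apply_mem_toSubmodule g hv) v hv h0)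

theorem sl2Dim_le_one : ∀ i j k : Fin 3, sl2Dim i j k ≤ 1 := by decide

/-- An isomorphism `e` yields the equivariant bilinear map `(a, x) ↦ a e(x)` on `V_0 × V_i`. By the
classification it vanishes for `i ≠ j`, contradicting injectivity at the highest weight vector. -/
theorem eq_of_sl2Rep_equiv (i j : Fin 3) (e : (sl2Rep K i).Equiv (sl2Rep K j)) : i = j := by
  by_contra hij
  obtain ⟨c, hc⟩ := exists_eq_smul_bilin 0 i j
    ((LinearMap.lsmul K (sl2V K i →ₗ[K] sl2V K j)).flip e.toLinearMap)
    (fun g a x => (congrArg (HSMul.hSMul (α := K) a)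
      (LinearMap.congr_fun (e.isIntertwining' g) x)).trans
        ((sl2Rep K j g).map_smul (a : K) (e x)).symm)
  rw [sl2Bilin_eq_zero _ _ _ (by clear hc c e; revert i j; decide), smul_zero] at hc
  have h1 : (1 : K) • e (sl2HighestWeight K i) = 0 := LinearMap.congr_fun₂ hc (1 : K) _
  rw [one_smul] at h1
  exact sl2HighestWeight_ne_zero i (e.injective (h1.trans (map_zero e).symm))

theorem sl2Labeling_isLabeling : (sl2Labeling K).IsLabeling where
  finiteDimensional := sl2V_finiteDimensional
  irreducible := sl2Rep_isIrreducible
  eq_of_equiv i j := fun ⟨e⟩ => eq_of_sl2Rep_equiv i j e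
  isIntertwining i j k q := ⟨fun g t => by
    induction t using TensorProduct.induction_on with
    | zero => rw [map_zero, map_zero, map_zero]
    | add x y hx hy => rw [map_add, map_add, hx, hy, map_add, map_add]
    | tmul x y => exact sl2Bilin_equivariant g i j k x y⟩
  linearIndependent i j k := by
    have : Subsingleton (Fin (sl2Dim i j k)) :=
      Fin.subsingleton_iff_le_one.2 (sl2Dim_le_one i j k)
    have hq (q : Fin (sl2Dim i j k)) : TensorProduct.lift (sl2Bilin K i j k) ≠ 0 := fun h =>
      sl2Bilin_weight_ne_zero (K := K) i j k (Nat.pos_iff_ne_zero.1 q.pos)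
        (LinearMap.congr_fun h (sl2HighestWeight K i ⊗ₜ sl2LowestWeight j))
    rcases isEmpty_or_nonempty (Fin (sl2Dim i j k)) with _ | ⟨⟨q⟩⟩
    · exact linearIndependent_empty_type (ι := Fin (sl2Dim i j k))
    · exact LinearIndependent.of_subsingleton (ι := Fin (sl2Dim i j k)) q (hq q)
  mem_span i j k f hf := by
    obtain ⟨c, hc⟩ := exists_eq_smul_bilin i j k (TensorProduct.curry f)
      (fun g x y => hf.1 g (x ⊗ₜ y))
    have hf' : f = c • TensorProduct.lift (sl2Bilin K i j k) := by
      refine TensorProduct.ext' fun x y => ?_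
      exact LinearMap.congr_fun₂ hc x y
    by_cases h : sl2Dim i j k = 0
    · have hc' : TensorProduct.curry f = 0 :=
        hc.trans (by rw [sl2Bilin_eq_zero _ _ _ h, smul_zero]; rfl)
      have : f = 0 := TensorProduct.ext' fun x y => LinearMap.congr_fun₂ hc' x y
      rw [this]
      exact Submodule.zero_mem _
    · rw [hf']
      exact Submodule.smul_mem _ _
        (Submodule.subset_span ⟨(⟨0, Nat.pos_of_ne_zero h⟩ : Fin (sl2Dim i j k)), rfl⟩)

end LabelingOfSL2

end CupTable

namespace CupTable

/-! ### Equivariant cochain representatives of the ten components -/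

section HighestWeightMaps

variable (K : Type u) [Field K]

/-- The embedding of `K²` into `𝔥`. -/
noncomputable def vecHeis : (Fin 2 → K) →ₗ[K] Heisenberg K :=
  (LinearMap.proj 0).smulRight (heisBasis K 0) + (LinearMap.proj 1).smulRight (heisBasis K 1)

/-- The embedding of `K²` into `𝔥*`, with `(1, 0) ↦ x¹` and `(0, 1) ↦ -x⁻¹`. -/
noncomputable def vecDual : (Fin 2 → K) →ₗ[K] Module.Dual K (Heisenberg K) :=
  (LinearMap.proj 0).smulRight ((heisBasis K).coord 1) -
    (LinearMap.proj 1).smulRight ((heisBasis K).coord 0)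

variable {K}

theorem vecHeis_apply (x : Fin 2 → K) :
    vecHeis K x = x 0 • heisBasis K 0 + x 1 • heisBasis K 1 := rfl

theorem vecDual_apply (x : Fin 2 → K) :
    vecDual K x = x 0 • (heisBasis K).coord 1 - x 1 • (heisBasis K).coord 0 := rfl

theorem heisRep_vecHeis (g : SL2 K) (x : Fin 2 → K) :
    heisRep K g (vecHeis K x) = vecHeis K (canonicalRep K g x) := by
  rw [canonicalRep_apply]
  apply Heisenberg.ext <;> simp [heisRep_apply, vecHeis_apply, heisBasis_apply]

theorem heisRep_basis_zero (g : SL2 K) :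
    heisRep K g (heisBasis K 0) = g 0 0 • heisBasis K 0 + g 1 0 • heisBasis K 1 := by
  apply Heisenberg.ext <;> simp [heisRep_apply, heisBasis_apply]

theorem heisRep_basis_one (g : SL2 K) :
    heisRep K g (heisBasis K 1) = g 0 1 • heisBasis K 0 + g 1 1 • heisBasis K 1 := by
  apply Heisenberg.ext <;> simp [heisRep_apply, heisBasis_apply]

/-- The determinant is an invariant symplectic form on `K²` and identifies `K²` with its dual; this
explains the sign in `vecDual`. -/
theorem heisRep_dual_vecDual (g : SL2 K) (x : Fin 2 → K) :
    (heisRep K).dual g (vecDual K x) = vecDual K (canonicalRep K g x) := by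
  obtain ⟨h0, h1⟩ := heisRep_dual_coord g
  rw [canonicalRep_apply, vecDual_apply, vecDual_apply, map_sub, map_smul, map_smul, h0, h1]
  simp only [Matrix.cons_val_zero, Matrix.cons_val_one]
  module

theorem heisRep_dual_coord_two (g : SL2 K) :
    (heisRep K).dual g ((heisBasis K).coord 2) = (heisBasis K).coord 2 := by
  refine LinearMap.ext fun v => ?_
  rw [heisRep_dual_apply, heisBasis_coord, heisRep_apply, heisBasis_coord]
  rfl

/-- The image of a basis vector under a linear map of `sl(2, K)` given by a bilinear map
`𝔥* × 𝔥 → C`. -/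
noncomputable def slCochain (β : Module.Dual K (Heisenberg K) →ₗ[K] Heisenberg K →ₗ[K]
    Cochain K (Heisenberg K)) : SL2Lie K →ₗ[K] Cochain K (Heisenberg K) where
  -- This is `sl(2) ⊂ End(K²) = (K²)* ⊗ K²`: each dual basis vector is paired with the image under
  -- `A` of the basis vector, that is, with a column of `A`.
  toFun A := β ((heisBasis K).coord 0) (vecHeis K ![A.1 0 0, A.1 1 0]) +
    β ((heisBasis K).coord 1) (vecHeis K ![A.1 0 1, A.1 1 1])
  map_add' A B := by
    simp only [vecHeis_apply, Matrix.cons_val_zero, Matrix.cons_val_one, map_add, map_smul]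
    have e (i j : Fin 2) : (A + B).1 i j = A.1 i j + B.1 i j := rfl
    simp only [e]
    module
  map_smul' c A := by
    simp only [vecHeis_apply, Matrix.cons_val_zero, Matrix.cons_val_one, map_add, map_smul]
    have e (i j : Fin 2) : (c • A).1 i j = c * A.1 i j := rfl
    simp only [e, RingHom.id_apply]
    module

theorem slCochain_slMk (β : Module.Dual K (Heisenberg K) →ₗ[K] Heisenberg K →ₗ[K]
    Cochain K (Heisenberg K)) (p q r : K) : slCochain β (slMk p q r) =
      p • β ((heisBasis K).coord 0) (heisBasis K 0) + r • β ((heisBasis K).coord 0) (heisBasis K 1)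
      + (q • β ((heisBasis K).coord 1) (heisBasis K 0) -
        p • β ((heisBasis K).coord 1) (heisBasis K 1)) := by
  change β _ (vecHeis K ![p, r]) + β _ (vecHeis K ![q, -p]) = _
  simp only [vecHeis_apply, Matrix.cons_val_zero, Matrix.cons_val_one, map_add, map_smul]
  module

/-- Conjugation of `A` corresponds to the simultaneous action on `(K²)*` and `K²`, so equivariance
of `β` carries over. -/
theorem slCochain_equivariant (β : Module.Dual K (Heisenberg K) →ₗ[K] Heisenberg K →ₗ[K]
    Cochain K (Heisenberg K)) (hβ : ∀ g φ v,
      cochainRep K g (β φ v) = β ((heisRep K).dual g φ) (heisRep K g v)) (g : SL2 K)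
    (A : SL2Lie K) : slCochain β (adjointRep K g A) = cochainRep K g (slCochain β A) := by
  obtain ⟨h0, h1⟩ := heisRep_dual_coord g
  rw [slMk_eta A, adjointRep_slMk, slCochain_slMk, slCochain_slMk]
  simp only [map_add, map_sub, map_smul, hβ, h0, h1, heisRep_basis_zero, heisRep_basis_one,
    LinearMap.sub_apply, LinearMap.smul_apply]
  module

/-- The bilinear map `(φ, v) ↦ φ ⊗ v`. -/
noncomputable def tensBilin : Module.Dual K (Heisenberg K) →ₗ[K] Heisenberg K →ₗ[K]
    Cochain K (Heisenberg K) :=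
  tens.compl₁₂ (ExteriorAlgebra.ι K) (ExteriorAlgebra.ι K)

/-- The bilinear map `(φ, v) ↦ (φ ∧ h⁰) ⊗ (v ∧ h₀)`. -/
noncomputable def tensBilinCenter : Module.Dual K (Heisenberg K) →ₗ[K] Heisenberg K →ₗ[K]
    Cochain K (Heisenberg K) :=
  tens.compl₁₂ (LinearMap.mulRight K (dhz K) ∘ₗ ExteriorAlgebra.ι K)
    (LinearMap.mulRight K (hz K) ∘ₗ ExteriorAlgebra.ι K)

variable (K)

open CupTable.Comp

/-- The maps from the representations of the labeling to the cocycles, defined by the highest weight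
vectors. -/
noncomputable def tauCochain : ∀ r : Comp, sl2V K r.weight →ₗ[K] Cochain K (Heisenberg K)
  | H000 => LinearMap.toSpanSingleton K _ (hwv K H000)
  | H011 => LinearMap.toSpanSingleton K _ (hwv K H011)
  | H211 => slCochain tensBilin
  | H120 => tens.flip 1 ∘ₗ LinearMap.mulRight K (dhz K) ∘ₗ ExteriorAlgebra.ι K ∘ₗ vecDual K
  | H102 => tens 1 ∘ₗ LinearMap.mulRight K (hz K) ∘ₗ ExteriorAlgebra.ι K ∘ₗ vecHeis K
  | H022 => LinearMap.toSpanSingleton K _ (hwv K H022)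
  | H222 => slCochain tensBilinCenter
  | H131 => tens (dxm K * dxp K * dhz K) ∘ₗ ExteriorAlgebra.ι K ∘ₗ vecHeis K
  | H113 => tens.flip (xp K * xm K * hz K) ∘ₗ ExteriorAlgebra.ι K ∘ₗ vecDual K
  | H033 => LinearMap.toSpanSingleton K _ (hwv K H033)

theorem dxm_mul_dxp_invariant (g : SL2 K) :
    ExteriorAlgebra.map ((heisRep K).dual g) (dxm K * dxp K) = dxm K * dxp K := by
  have hdet := g.det_coe
  rw [Matrix.det_fin_two] at hdet
  obtain ⟨h0, h1⟩ := heisRep_dual_coord g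
  rw [map_mul, dxm, dxp, ExteriorAlgebra.map_apply_ι, ExteriorAlgebra.map_apply_ι, h0, h1]
  simp only [map_sub, map_smul, sub_mul, mul_sub, smul_mul_smul_comm,
    ExteriorAlgebra.ι_sq_zero, ι_swap ((heisBasis K).coord 1) ((heisBasis K).coord 0), smul_zero]
  linear_combination (norm := module) hdet • (ExteriorAlgebra.ι K ((heisBasis K).coord 0) *
          ExteriorAlgebra.ι K ((heisBasis K).coord 1))

theorem xp_mul_xm_invariant (g : SL2 K) :
    ExteriorAlgebra.map (heisRep K g) (xp K * xm K) = xp K * xm K := by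
  have hdet := g.det_coe
  rw [Matrix.det_fin_two] at hdet
  rw [map_mul, xp, xm, ExteriorAlgebra.map_apply_ι, ExteriorAlgebra.map_apply_ι,
    heisRep_basis_zero, heisRep_basis_one]
  simp only [map_add, map_smul, add_mul, mul_add, smul_mul_smul_comm,
    ExteriorAlgebra.ι_sq_zero, ι_swap (heisBasis K 1) (heisBasis K 0), smul_zero]
  linear_combination (norm := module) hdet • (ExteriorAlgebra.ι K (heisBasis K 0) *
          ExteriorAlgebra.ι K (heisBasis K 1))

theorem dhz_invariant (g : SL2 K) :
    ExteriorAlgebra.map ((heisRep K).dual g) (dhz K) = dhz K := by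
  rw [dhz, ExteriorAlgebra.map_apply_ι, heisRep_dual_coord_two]

theorem hz_invariant (g : SL2 K) : ExteriorAlgebra.map (heisRep K g) (hz K) = hz K := by
  rw [hz, ExteriorAlgebra.map_apply_ι, heisRep_basis_two]

/-- The first two terms form the canonical element of `(K²)* ⊗ K²`, invariant because `det g = 1`,
and `h⁰` and `h₀` are separately fixed. -/
theorem hwv_H011_invariant (g : SL2 K) : cochainRep K g (hwv K H011) = hwv K H011 := by
  have hdet := g.det_coe
  rw [Matrix.det_fin_two] at hdet
  obtain ⟨h0, h1⟩ := heisRep_dual_coord g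
  rw [hwv, map_add, map_add, map_smul, cochainRep_apply, cochainMap_tens, cochainMap_tens,
    cochainMap_tens, dhz_invariant, hz_invariant, dxp, dxm, xp, xm]
  simp only [ExteriorAlgebra.map_apply_ι, h0, h1, heisRep_basis_zero, heisRep_basis_one, map_add,
    map_sub, map_smul, LinearMap.sub_apply, LinearMap.smul_apply]
  linear_combination (norm := module) hdet •
    (tens (ExteriorAlgebra.ι K ((heisBasis K).coord 0)) (ExteriorAlgebra.ι K (heisBasis K 0)) +
    tens (ExteriorAlgebra.ι K ((heisBasis K).coord 1)) (ExteriorAlgebra.ι K (heisBasis K 1)))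

theorem toSpanSingleton_equivariant {x : Cochain K (Heisenberg K)}
    (hx : ∀ g, cochainRep K g x = x) (g : SL2 K) (a : K) :
    LinearMap.toSpanSingleton K _ x a = cochainRep K g (LinearMap.toSpanSingleton K _ x a) := by
  rw [LinearMap.toSpanSingleton_apply, map_smul, hx]

/-- Each map combines the identifications of `K²` or `sl(2)` with factors fixed by the group: `h⁰`,
`h₀`, `x⁻¹x¹`, `x₁x₋₁` and their products. The four weight-zero components come from invariant
cochains. -/
theorem tauCochain_equivariant (g : SL2 K) : ∀ (r : Comp) (v : sl2V K r.weight),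
    tauCochain K r (sl2Rep K r.weight g v) = cochainRep K g (tauCochain K r v)
  | H000, a => toSpanSingleton_equivariant K (fun g => cochainMap_one _ _) g a
  | H011, a => toSpanSingleton_equivariant K (hwv_H011_invariant K) g a
  | H211, A => slCochain_equivariant _ (fun g φ v => by
      simp [tensBilin, cochainRep_apply, cochainMap_tens]) g A
  | H120, x => by
    have h (x : Fin 2 → K) : tens (ExteriorAlgebra.ι K (vecDual K (canonicalRep K g x)) * dhz K) 1 =
        cochainRep K g (tens (ExteriorAlgebra.ι K (vecDual K x) * dhz K) 1) := by
      rw [cochainRep_apply, cochainMap_tens_one, map_mul (ExteriorAlgebra.map _),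
        ExteriorAlgebra.map_apply_ι, dhz_invariant, heisRep_dual_vecDual]
    exact h x
  | H102, x => by
    have h (x : Fin 2 → K) : tens 1 (ExteriorAlgebra.ι K (vecHeis K (canonicalRep K g x)) * hz K) =
        cochainRep K g (tens 1 (ExteriorAlgebra.ι K (vecHeis K x) * hz K)) := by
      rw [cochainRep_apply, cochainMap_one_tens, map_mul (ExteriorAlgebra.map _),
        ExteriorAlgebra.map_apply_ι, hz_invariant, heisRep_vecHeis]
    exact h x
  | H022, a => toSpanSingleton_equivariant K (fun g => by
      rw [hwv, cochainRep_apply, cochainMap_tens, dxm_mul_dxp_invariant, xp_mul_xm_invariant]) g a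
  | H222, A => slCochain_equivariant _ (fun g φ v => by
      change cochainRep K g (tens (ExteriorAlgebra.ι K φ * dhz K) (ExteriorAlgebra.ι K v * hz K)) =
        tens (ExteriorAlgebra.ι K _ * dhz K) (ExteriorAlgebra.ι K _ * hz K)
      rw [cochainRep_apply, cochainMap_tens, map_mul (ExteriorAlgebra.map _),
        map_mul (ExteriorAlgebra.map _), ExteriorAlgebra.map_apply_ι, ExteriorAlgebra.map_apply_ι,
        dhz_invariant, hz_invariant]) g A
  | H131, x => by
    have h (x : Fin 2 → K) :
        tens (dxm K * dxp K * dhz K) (ExteriorAlgebra.ι K (vecHeis K (canonicalRep K g x))) =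
        cochainRep K g (tens (dxm K * dxp K * dhz K) (ExteriorAlgebra.ι K (vecHeis K x))) := by
      rw [cochainRep_apply, cochainMap_tens, map_mul (ExteriorAlgebra.map _),
        ExteriorAlgebra.map_apply_ι, dhz_invariant, dxm_mul_dxp_invariant, heisRep_vecHeis]
    exact h x
  | H113, x => by
    have h (x : Fin 2 → K) :
        tens (ExteriorAlgebra.ι K (vecDual K (canonicalRep K g x))) (xp K * xm K * hz K) =
        cochainRep K g (tens (ExteriorAlgebra.ι K (vecDual K x)) (xp K * xm K * hz K)) := by
      rw [cochainRep_apply, cochainMap_tens, map_mul (ExteriorAlgebra.map (heisRep K g)),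
        ExteriorAlgebra.map_apply_ι, hz_invariant, xp_mul_xm_invariant, heisRep_dual_vecDual]
    exact h x
  | H033, a => toSpanSingleton_equivariant K (fun g => by
      rw [hwv, cochainRep_apply, cochainMap_tens, map_mul (ExteriorAlgebra.map _),
        dxm_mul_dxp_invariant, dhz_invariant, map_mul (ExteriorAlgebra.map _),
        xp_mul_xm_invariant, hz_invariant]) g a

theorem tauCochain_highestWeight : ∀ r : Comp,
    tauCochain K r (sl2HighestWeight K r.weight) = hwv K r
  | H000 => one_smul K _
  | H011 => one_smul K _
  | H211 => by
    change slCochain tensBilin (sl2HighestWeight K 2) = _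
    rw [sl2HighestWeight_two, slCochain_slMk]
    simp [hwv, tensBilin, dxp, xp]
  | H120 => by
    change tens (ExteriorAlgebra.ι K (vecDual K ![1, 0]) * dhz K) 1 = _
    simp [hwv, vecDual_apply, dxp]
  | H102 => by
    change tens 1 (ExteriorAlgebra.ι K (vecHeis K ![1, 0]) * hz K) = _
    simp [hwv, vecHeis_apply, xp]
  | H022 => one_smul K _
  | H222 => by
    change slCochain tensBilinCenter (sl2HighestWeight K 2) = _
    rw [sl2HighestWeight_two, slCochain_slMk]
    simp [hwv, tensBilinCenter, dxp, xp]
  | H131 => by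
    change tens (dxm K * dxp K * dhz K) (ExteriorAlgebra.ι K (vecHeis K ![1, 0])) = _
    simp [hwv, vecHeis_apply, xp]
  | H113 => by
    change tens (ExteriorAlgebra.ι K (vecDual K ![1, 0])) (xp K * xm K * hz K) = _
    simp [hwv, vecDual_apply, dxp]
  | H033 => one_smul K _

variable {K}

/-- The degrees of the monomials. -/
def monoDegree : Fin 8 → ℕ := ![0, 1, 1, 1, 2, 2, 2, 3]

theorem extMonomial_mem {M : Type u} [AddCommGroup M] [Module K M] (b : Module.Basis (Fin 3) K M)
    (i : Fin 8) : extMonomial b i ∈ ⋀[K]^(monoDegree i) M := by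
  have h1 (v : M) : ExteriorAlgebra.ι K v ∈ ⋀[K]^1 M := by simp [ExteriorAlgebra.exteriorPower]
  have h2 (v w : M) : ExteriorAlgebra.ι K v * ExteriorAlgebra.ι K w ∈ ⋀[K]^2 M :=
    SetLike.mul_mem_graded (h1 v) (h1 w)
  fin_cases i
  · exact SetLike.one_mem_graded _
  · exact h1 _
  · exact h1 _
  · exact h1 _
  · exact h2 _ _
  · exact h2 _ _
  · exact h2 _ _
  · exact SetLike.mul_mem_graded (h2 _ _) (h1 _)

theorem mono_mem_bidegree (i j : Fin 8) :
    mono K i j ∈ CupTable.bidegree K (Heisenberg K) (monoDegree i) (monoDegree j) :=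
  Submodule.subset_span ⟨_, extMonomial_mem _ i, _, extMonomial_mem _ j, rfl⟩

variable (K)

theorem dxm_eq : dxm K = extMonomial (heisDualBasis K) 1 := by simp [dxm, extMonomial]

theorem dxp_eq : dxp K = extMonomial (heisDualBasis K) 2 := by simp [dxp, extMonomial]

theorem dhz_eq : dhz K = extMonomial (heisDualBasis K) 3 := by simp [dhz, extMonomial]

theorem tauCochain_H000 (a : K) : tauCochain K H000 a = a • mono K 0 0 := rfl

theorem tauCochain_H011 (a : K) :
    tauCochain K H011 a = a • (mono K 2 2 + mono K 1 1 + (2 : K) • mono K 3 3) := by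
  change a • hwv K H011 = _
  rw [hwv, dxp_eq, dxm_eq, dhz_eq]
  rfl

theorem tauCochain_H211 (p q r : K) : tauCochain K H211 (slMk p q r) =
    p • mono K 1 1 + r • mono K 1 2 + (q • mono K 2 1 - p • mono K 2 2) := by
  refine (slCochain_slMk _ _ _ _).trans ?_
  simp only [← heisDualBasis_apply]
  rfl

theorem tauCochain_H120 (x : Fin 2 → K) :
    tauCochain K H120 x = x 0 • mono K 6 0 - x 1 • mono K 5 0 := by
  change tens (ExteriorAlgebra.ι K (vecDual K x) * dhz K) 1 = _
  simp only [vecDual_apply, dhz, ← heisDualBasis_apply, map_sub, map_smul, sub_mul, smul_mul_assoc,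
    LinearMap.sub_apply, LinearMap.smul_apply]
  rfl

theorem tauCochain_H102 (x : Fin 2 → K) :
    tauCochain K H102 x = x 0 • mono K 0 5 + x 1 • mono K 0 6 := by
  change tens 1 (ExteriorAlgebra.ι K (vecHeis K x) * hz K) = _
  simp only [vecHeis_apply, hz, map_add, map_smul, add_mul, smul_mul_assoc]
  rfl

theorem tauCochain_H022 (a : K) : tauCochain K H022 a = a • mono K 4 4 := by
  change a • hwv K H022 = _
  rw [hwv, dxp, dxm, ← heisDualBasis_apply, ← heisDualBasis_apply]
  rfl

theorem tauCochain_H222 (p q r : K) : tauCochain K H222 (slMk p q r) =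
    p • mono K 5 5 + r • mono K 5 6 + (q • mono K 6 5 - p • mono K 6 6) := by
  refine (slCochain_slMk _ _ _ _).trans ?_
  have h (φ : Module.Dual K (Heisenberg K)) (v : Heisenberg K) : tensBilinCenter φ v =
    tens (ExteriorAlgebra.ι K φ * dhz K) (ExteriorAlgebra.ι K v * hz K) := rfl
  simp only [h, dhz, ← heisDualBasis_apply]
  rfl

theorem tauCochain_H131 (x : Fin 2 → K) :
    tauCochain K H131 x = x 0 • mono K 7 1 + x 1 • mono K 7 2 := by
  change tens (dxm K * dxp K * dhz K) (ExteriorAlgebra.ι K (vecHeis K x)) = _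
  simp only [vecHeis_apply, dxm, dxp, dhz, ← heisDualBasis_apply, map_add, map_smul]
  rfl

theorem tauCochain_H113 (x : Fin 2 → K) :
    tauCochain K H113 x = x 0 • mono K 2 7 - x 1 • mono K 1 7 := by
  change tens (ExteriorAlgebra.ι K (vecDual K x)) (xp K * xm K * hz K) = _
  simp only [vecDual_apply, ← heisDualBasis_apply, map_sub, map_smul,
    LinearMap.sub_apply, LinearMap.smul_apply]
  rfl

theorem tauCochain_H033 (a : K) : tauCochain K H033 a = a • mono K 7 7 := by
  change a • hwv K H033 = _
  rw [hwv, dxp, dxm, dhz, ← heisDualBasis_apply, ← heisDualBasis_apply, ← heisDualBasis_apply]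
  rfl

theorem tauCochain_mem_bidegree : ∀ (r : Comp) (v : sl2V K r.weight),
    tauCochain K r v ∈ CupTable.bidegree K (Heisenberg K) r.bidegree.1 r.bidegree.2
  | H000, a => by
    exact Submodule.smul_mem _ _ (mono_mem_bidegree 0 0)
  | H011, a => by
    refine (tauCochain_H011 K a) ▸ Submodule.smul_mem _ _ (add_mem (add_mem ?_ ?_)
      (Submodule.smul_mem _ _ ?_))
    exacts [mono_mem_bidegree 2 2, mono_mem_bidegree 1 1, mono_mem_bidegree 3 3]
  | H211, A => by
    rw [slMk_eta A, tauCochain_H211]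
    refine add_mem (add_mem (Submodule.smul_mem _ _ ?_) (Submodule.smul_mem _ _ ?_))
      (sub_mem (Submodule.smul_mem _ _ ?_) (Submodule.smul_mem _ _ ?_))
    exacts [mono_mem_bidegree 1 1, mono_mem_bidegree 1 2, mono_mem_bidegree 2 1,
      mono_mem_bidegree 2 2]
  | H120, x => (tauCochain_H120 K x) ▸ sub_mem (Submodule.smul_mem _ _ (mono_mem_bidegree 6 0))
      (Submodule.smul_mem _ _ (mono_mem_bidegree 5 0))
  | H102, x => (tauCochain_H102 K x) ▸ add_mem (Submodule.smul_mem _ _ (mono_mem_bidegree 0 5))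
      (Submodule.smul_mem _ _ (mono_mem_bidegree 0 6))
  | H022, a => (tauCochain_H022 K a) ▸ Submodule.smul_mem _ _ (mono_mem_bidegree 4 4)
  | H222, A => by
    rw [slMk_eta A, tauCochain_H222]
    refine add_mem (add_mem (Submodule.smul_mem _ _ ?_) (Submodule.smul_mem _ _ ?_))
      (sub_mem (Submodule.smul_mem _ _ ?_) (Submodule.smul_mem _ _ ?_))
    exacts [mono_mem_bidegree 5 5, mono_mem_bidegree 5 6, mono_mem_bidegree 6 5,
      mono_mem_bidegree 6 6]
  | H131, x => (tauCochain_H131 K x) ▸ add_mem (Submodule.smul_mem _ _ (mono_mem_bidegree 7 1))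
      (Submodule.smul_mem _ _ (mono_mem_bidegree 7 2))
  | H113, x => (tauCochain_H113 K x) ▸ sub_mem (Submodule.smul_mem _ _ (mono_mem_bidegree 2 7))
      (Submodule.smul_mem _ _ (mono_mem_bidegree 1 7))
  | H033, a => (tauCochain_H033 K a) ▸ Submodule.smul_mem _ _ (mono_mem_bidegree 7 7)

end HighestWeightMaps

end CupTable

namespace CupTable

/-! ### Cocycles modulo coboundaries: the decomposition into ten components -/

section Cohomology

variable {K : Type u} [Field K]

/-- Read off entry by entry from the matrix of `d`; the representatives are then checked on
coordinates alone. -/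
theorem differential_eq_zero {x : Cochain K (Heisenberg K)}
    (h0 : cochainCoord 0 1 x = 0 ∧ cochainCoord 0 2 x = 0 ∧ cochainCoord 0 4 x = 0)
    (h3 : cochainCoord 3 0 x = 0 ∧ cochainCoord 3 1 x = 0 ∧ cochainCoord 3 2 x = 0 ∧
      cochainCoord 3 4 x = 0 ∧ cochainCoord 3 7 x = 0)
    (ht : cochainCoord 3 3 x = cochainCoord 1 1 x + cochainCoord 2 2 x)
    (h4 : cochainCoord 2 4 x = cochainCoord 3 5 x ∧ cochainCoord 1 4 x = -cochainCoord 3 6 x)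
    (h7 : cochainCoord 5 1 x = -cochainCoord 6 2 x ∧ cochainCoord 6 4 x = 0 ∧
      cochainCoord 5 4 x = 0) : differential (heisBasis K) x = 0 := by
  obtain ⟨h01, h02, h04⟩ := h0
  obtain ⟨h30, h31, h32, h34, h37⟩ := h3
  obtain ⟨h24, h14⟩ := h4
  obtain ⟨h51, h64, h54⟩ := h7
  refine cochain_ext fun i j => ?_
  rw [cochainCoord_differential, map_zero, differentialMatrix]
  simp only [h01, h02, h04, h30, h31, h32, h34, h37, ht, h24, h14, h51, h64, h54]
  fin_cases i <;> fin_cases j <;> simp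
  ring

/-- These seven equations are all the conditions that closedness imposes on coordinates of even
total degree; the remaining entries of the matrix involve odd coordinates only. -/
theorem coord_of_differential_eq_zero {x : Cochain K (Heisenberg K)}
    (h : differential (heisBasis K) x = 0) :
    cochainCoord 0 4 x = 0 ∧ cochainCoord 3 1 x = 0 ∧ cochainCoord 3 2 x = 0 ∧
    cochainCoord 3 7 x = 0 ∧ cochainCoord 3 3 x = cochainCoord 1 1 x + cochainCoord 2 2 x ∧
    cochainCoord 6 4 x = 0 ∧ cochainCoord 5 4 x = 0 := by
  have key (i j : Fin 8) : differentialMatrix (fun k l => cochainCoord k l x) i j = 0 := by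
    rw [← cochainCoord_differential, h, map_zero]
  refine ⟨key 1 5, neg_eq_zero.1 (key 4 1), neg_eq_zero.1 (key 4 2), neg_eq_zero.1 (key 4 7), ?_,
    key 7 5, neg_eq_zero.1 (key 7 6)⟩
  have : cochainCoord 2 2 x + cochainCoord 1 1 x - cochainCoord 3 3 x = 0 := key 4 3
  linear_combination -this

theorem tauCochain_cocycle : ∀ (r : Comp) (v : sl2V K r.weight),
    differential (heisBasis K) (tauCochain K r v) = 0
  | .H000, a => by
    obtain ⟨a, rfl⟩ : ∃ b : K, b = a := ⟨a, rfl⟩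
    rw [tauCochain_H000]; apply differential_eq_zero <;> simp [cochainCoord_mono]
  | .H011, a => by
    obtain ⟨a, rfl⟩ : ∃ b : K, b = a := ⟨a, rfl⟩
    -- Closedness requires the `h⁰ ⊗ h₀` coordinate to be the sum of those of `x⁻¹ ⊗ x₁` and `x¹ ⊗
    -- x₋₁`, here `1 + 1`; this is the coefficient 2 of the representative.
    rw [tauCochain_H011]; apply differential_eq_zero <;> simp [cochainCoord_mono]; ring
  | .H211, A => by
    rw [slMk_eta A, tauCochain_H211]; apply differential_eq_zero <;> simp [cochainCoord_mono]
  | .H120, x => by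
    obtain ⟨x, rfl⟩ : ∃ b : Fin 2 → K, b = x := ⟨x, rfl⟩
    rw [tauCochain_H120]; apply differential_eq_zero <;> simp [cochainCoord_mono]
  | .H102, x => by
    obtain ⟨x, rfl⟩ : ∃ b : Fin 2 → K, b = x := ⟨x, rfl⟩
    rw [tauCochain_H102]; apply differential_eq_zero <;> simp [cochainCoord_mono]
  | .H022, a => by
    obtain ⟨a, rfl⟩ : ∃ b : K, b = a := ⟨a, rfl⟩
    rw [tauCochain_H022]; apply differential_eq_zero <;> simp [cochainCoord_mono]
  | .H222, A => by
    rw [slMk_eta A, tauCochain_H222]; apply differential_eq_zero <;> simp [cochainCoord_mono]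
  | .H131, x => by
    obtain ⟨x, rfl⟩ : ∃ b : Fin 2 → K, b = x := ⟨x, rfl⟩
    rw [tauCochain_H131]; apply differential_eq_zero <;> simp [cochainCoord_mono]
  | .H113, x => by
    obtain ⟨x, rfl⟩ : ∃ b : Fin 2 → K, b = x := ⟨x, rfl⟩
    rw [tauCochain_H113]; apply differential_eq_zero <;> simp [cochainCoord_mono]
  | .H033, a => by
    obtain ⟨a, rfl⟩ : ∃ b : K, b = a := ⟨a, rfl⟩
    rw [tauCochain_H033]; apply differential_eq_zero <;> simp [cochainCoord_mono]

theorem tauCochain_mem_evenCocycles (r : Comp) (v : sl2V K r.weight) :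
    tauCochain K r v ∈ evenCocycles (heisBasis K) :=
  ⟨LinearMap.mem_ker.2 (tauCochain_cocycle r v),
    Submodule.mem_iSup_of_mem _ (Submodule.mem_iSup_of_mem _
      (Submodule.mem_iSup_of_mem (by cases r <;> decide) (tauCochain_mem_bidegree K r v)))⟩

theorem Comp.sum_univ {M : Type*} [AddCommMonoid M] (f : Comp → M) : ∑ r, f r =
    f .H000 + (f .H011 + (f .H211 + (f .H120 + (f .H102 + (f .H022 + (f .H222 + (f .H131 +
      (f .H113 + f .H033)))))))) := by
  change ∑ r ∈ ({.H000, .H011, .H211, .H120, .H102, .H022, .H222, .H131, .H113, .H033} :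
    Finset Comp), f r = _
  simp

/-- Among the monomials occurring in the representatives, a coboundary has nonzero coordinates at
most at `(4,4)`, `(5,5)`, `(6,6)`, where they are `-s, s, s` with `s` the `(3,4)` coordinate of `y`.
All other coefficients are compared directly. -/
theorem eq_zero_of_sum_tauCochain_eq (v : ∀ r : Comp, sl2V K r.weight) [CharZero K]
    (y : Cochain K (Heisenberg K))
    (h : ∑ r, tauCochain K r (v r) = differential (heisBasis K) y) (r : Comp) : v r = 0 := by
  have key (i j : Fin 8) := (congrArg (cochainCoord i j) h).trans (cochainCoord_differential y i j)
  obtain ⟨p, q, t, h211⟩ : ∃ p q r, v .H211 = slMk p q r := ⟨_, _, _, slMk_eta _⟩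
  obtain ⟨p', q', t', h222⟩ : ∃ p q r, v .H222 = slMk p q r := ⟨_, _, _, slMk_eta _⟩
  obtain ⟨a0, h000⟩ : ∃ a : K, v .H000 = a := ⟨_, rfl⟩
  obtain ⟨a1, h011⟩ : ∃ a : K, v .H011 = a := ⟨_, rfl⟩
  obtain ⟨a2, h022⟩ : ∃ a : K, v .H022 = a := ⟨_, rfl⟩
  obtain ⟨a3, h033⟩ : ∃ a : K, v .H033 = a := ⟨_, rfl⟩
  obtain ⟨x20, h120⟩ : ∃ x : Fin 2 → K, v .H120 = x := ⟨_, rfl⟩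
  obtain ⟨x02, h102⟩ : ∃ x : Fin 2 → K, v .H102 = x := ⟨_, rfl⟩
  obtain ⟨x31, h131⟩ : ∃ x : Fin 2 → K, v .H131 = x := ⟨_, rfl⟩
  obtain ⟨x13, h113⟩ : ∃ x : Fin 2 → K, v .H113 = x := ⟨_, rfl⟩
  simp only [Comp.sum_univ, h000, h011, h211, h120, h102, h022, h222, h131, h113, h033,
    tauCochain_H000, tauCochain_H011, tauCochain_H211, tauCochain_H120,
    tauCochain_H102, tauCochain_H022, tauCochain_H222, tauCochain_H131, tauCochain_H113,
    tauCochain_H033, map_add, map_sub, map_smul, cochainCoord_mono] at key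
  have k00 := key 0 0
  have k11 := key 1 1
  have k12 := key 1 2
  have k21 := key 2 1
  have k22 := key 2 2
  have k60 := key 6 0
  have k50 := key 5 0
  have k05 := key 0 5
  have k06 := key 0 6
  have k44 := key 4 4
  have k55 := key 5 5
  have k56 := key 5 6
  have k65 := key 6 5
  have k66 := key 6 6
  have k71 := key 7 1
  have k72 := key 7 2
  have k17 := key 1 7
  have k27 := key 2 7
  have k77 := key 7 7
  clear key
  simp [differentialMatrix] at k00 k11 k12 k21 k22 k60 k50 k05 k06 k44 k55 k56 k65 k66 k71 k72
  simp [differentialMatrix] at k17 k27 k77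
  have vec {x : Fin 2 → K} (h0 : x 0 = 0) (h1 : x 1 = 0) : x = 0 := by
    ext i; fin_cases i <;> assumption
  have hp : p = 0 := by linear_combination (k11 - k22) / 2
  have ha1 : a1 = 0 := by linear_combination k11 - hp
  -- The equations are `p' = s`, `-p' = s` and `a2 = -s`: subtracting the first two gives `p' = 0`,
  -- and adding the first and last gives `a2 = -p' = 0`.
  have hp' : p' = 0 := by linear_combination (k55 - k66) / 2
  have ha2 : a2 = 0 := by linear_combination k44 + k55 - hp'
  cases r
  · exact h000.trans k00
  · exact h011.trans ha1
  · rw [h211, hp, k21, k12]; exact slMk_zero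
  · exact h120.trans (vec k60 k50)
  · exact h102.trans (vec k05 k06)
  · exact h022.trans ha2
  · rw [h222, hp', k65, k56]; exact slMk_zero
  · exact h131.trans (vec k71 k72)
  · exact h113.trans (vec k27 k17)
  · exact h033.trans k77

theorem differential_mono (i j : Fin 8) : differential (heisBasis K) (mono K i j) =
    tens (![extMonomial (heisDualBasis K) 1, 0, extMonomial (heisDualBasis K) 4,
        extMonomial (heisDualBasis K) 5, 0, 0, extMonomial (heisDualBasis K) 7, 0] i)
      (![0, 0, extMonomial (heisBasis K) 3, 0, extMonomial (heisBasis K) 5, 0, 0, 0] j) -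
    tens (![extMonomial (heisDualBasis K) 2, -extMonomial (heisDualBasis K) 4, 0,
        extMonomial (heisDualBasis K) 6, 0, -extMonomial (heisDualBasis K) 7, 0, 0] i)
      (![0, extMonomial (heisBasis K) 3, 0, 0, -extMonomial (heisBasis K) 6, 0, 0, 0] j) -
    tens (![0, 0, 0, extMonomial (heisDualBasis K) 4, 0, 0, 0, 0] i)
      (extMonomial (heisBasis K) j) := by
  rw [mono, differential_tens, ι_zero_mul_extMonomial, ι_one_mul_extMonomial,
    contractLeft_zero_extMonomial, contractLeft_one_extMonomial, contractLeft_two_extMonomial]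
  generalize heisDualBasis K = b
  congr 1
  · congr 2
    · fin_cases j <;> simp [ι_two_mul_extMonomial]
    · fin_cases j <;> simp [ι_two_mul_extMonomial]
  · congr 2
    fin_cases i <;> simp [ι_one_mul_extMonomial, ι_zero_mul_extMonomial]

/-- The coboundaries in the even part of `C`. -/
theorem differential_mono_coboundary :
    differential (heisBasis K) (mono K 0 2) = mono K 1 3 ∧
    differential (heisBasis K) (mono K 0 1) = -mono K 2 3 ∧
    differential (heisBasis K) (mono K 3 0) = -mono K 4 0 ∧
    differential (heisBasis K) (mono K 2 4) = mono K 4 5 ∧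
    differential (heisBasis K) (mono K 1 4) = -mono K 4 6 ∧
    differential (heisBasis K) (mono K 3 4) = mono K 5 5 + mono K 6 6 - mono K 4 4 ∧
    differential (heisBasis K) (mono K 6 2) = mono K 7 3 := by
  simp only [differential_mono]
  simp [mono]

/-- The coefficients solve a triangular system. Besides the parameters of the ten families, the
coordinates of an even cocycle are free only along the seven coboundary directions, for which
explicit primitives are known. -/
theorem exists_eq_sum_tauCochain [CharZero K] (x : Cochain K (Heisenberg K))
    (hx : x ∈ evenCocycles (heisBasis K)) :
    ∃ (v : ∀ r : Comp, sl2V K r.weight) (y : Cochain K (Heisenberg K)),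
      x = ∑ r, tauCochain K r (v r) + differential (heisBasis K) y := by
  obtain ⟨h04, h31, h32, h37, h33, h64, h54⟩ := coord_of_differential_eq_zero hx.1
  -- Evenness removes 32 of the 64 coordinates.
  have hodd (i j : Fin 8) (h : (monoDegree i + monoDegree j) % 2 = 1) : cochainCoord i j x = 0 := by
    refine cochainCoord_eq_zero_of_even hx.2 i j ?_
    revert h
    fin_cases i <;> fin_cases j <;> simp [monoDegree, monoSign]
  have hsum : x = ∑ i, ∑ j, cochainCoord i j x • mono K i j := by
    conv_lhs => rw [← (cochainBasis K).sum_repr x, Fintype.sum_prod_type]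
    simp only [cochainBasis_apply]
    rfl
  generalize hc : (fun i j => cochainCoord i j x) = c at *
  replace hc (i j : Fin 8) : cochainCoord i j x = c i j := congrFun (congrFun hc i) j
  simp only [hc] at h04 h31 h32 h37 h33 h64 h54 hodd hsum
  obtain ⟨d1, d2, d3, d4, d5, d6, d7⟩ := differential_mono_coboundary (K := K)
  -- The `(3,3)` coordinate occurs in `H_0^{1,1}` with factor 2, whence `c 3 3 / 2`. The `(5,5)` and
  -- `(6,6)` coordinates split into an antisymmetric part in `H_2^{2,2}` and a symmetric part,
  -- cohomologous to the same multiple of the `(4,4)` monomial in `H_0^{2,2}`. The signs in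
  -- `H_1^{2,0}` and `H_1^{1,3}` come from `vecDual`.
  refine ⟨fun r => match r with
    | .H000 => c 0 0
    | .H011 => (c 3 3 / 2 : K)
    | .H211 => slMk (c 1 1 - c 3 3 / 2) (c 2 1) (c 1 2)
    | .H120 => ![c 6 0, -c 5 0]
    | .H102 => ![c 0 5, c 0 6]
    | .H022 => (c 4 4 + (c 5 5 + c 6 6) / 2 : K)
    | .H222 => slMk ((c 5 5 - c 6 6) / 2) (c 6 5) (c 5 6)
    | .H131 => ![c 7 1, c 7 2]
    | .H113 => ![c 2 7, -c 1 7]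
    -- The second component is a primitive of the exact part: one term for each of the seven
    -- coboundaries, with the sign of its differential.
    | .H033 => c 7 7, c 1 3 • mono K 0 2 - c 2 3 • mono K 0 1 - c 4 0 • mono K 3 0 +
      c 4 5 • mono K 2 4 - c 4 6 • mono K 1 4 + ((c 5 5 + c 6 6) / 2) • mono K 3 4 +
      c 7 3 • mono K 6 2, ?_⟩
  simp only [Comp.sum_univ, tauCochain_H000, tauCochain_H011, tauCochain_H211, tauCochain_H120,
    tauCochain_H102, tauCochain_H022, tauCochain_H222, tauCochain_H131, tauCochain_H113,
    tauCochain_H033, map_add, map_sub, map_smul, d1, d2, d3, d4, d5, d6, d7]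
  rw [hsum]
  simp (discharger := decide) only [Fin.sum_univ_eight, hodd]
  simp only [h04, h31, h32, h37, h33, h64, h54, zero_smul, zero_add, add_zero]
  simp only [Matrix.cons_val_zero, Matrix.cons_val_one]
  module

variable (K) in
/-- The maps from the representations of the labeling to the cohomology. -/
noncomputable def tau (r : Comp) : sl2V K r.weight →ₗ[K] HeisCohomology K :=
  (evenCoboundaries (heisBasis K)).mkQ ∘ₗ
    (tauCochain K r).codRestrict (evenCocycles (heisBasis K)) (tauCochain_mem_evenCocycles r)

theorem tau_apply (r : Comp) (v : sl2V K r.weight) : tau K r v =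
    (evenCoboundaries (heisBasis K)).mkQ ⟨tauCochain K r v, tauCochain_mem_evenCocycles r v⟩ := rfl

theorem tau_intertwining (r : Comp) :
    Representation.IsIntertwiningMap (sl2Rep K r.weight) (cohomologyRep K) (tau K r) :=
  ⟨fun g v => congrArg (evenCoboundaries (heisBasis K)).mkQ
    (Subtype.ext (tauCochain_equivariant K g r v))⟩

theorem tau_isHighestWeightFamily : IsHighestWeightFamily K (tau K) := fun r =>
  ⟨tau_intertwining r, tauCochain_highestWeight K r ▸ ⟨tauCochain_mem_evenCocycles r _, rfl⟩⟩

theorem range_tau_le (r : Comp) : LinearMap.range (tau K r) ≤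
    cohomology (heisBasis K) r.bidegree.1 r.bidegree.2 := by
  rintro _ ⟨v, rfl⟩
  exact ⟨⟨tauCochain K r v, tauCochain_mem_evenCocycles r v⟩, tauCochain_mem_bidegree K r v, rfl⟩

theorem sum_tau (v : ∀ r : Comp, sl2V K r.weight) : ∑ r, tau K r (v r) =
    (evenCoboundaries (heisBasis K)).mkQ ⟨∑ r, tauCochain K r (v r),
      sum_mem fun r _ => tauCochain_mem_evenCocycles r (v r)⟩ := by
  simp only [tau_apply, ← map_sum]
  congr 1

theorem mkQ_eq_zero_of_eq_differential {x : evenCocycles (heisBasis K)}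
    (y : Cochain K (Heisenberg K)) (h : (x : Cochain K (Heisenberg K)) =
      differential (heisBasis K) y) : (evenCoboundaries (heisBasis K)).mkQ x = 0 :=
  (Submodule.Quotient.mk_eq_zero _).2 ⟨y, h.symm⟩

variable [CharZero K]

theorem eq_zero_of_sum_tau_eq_zero (v : ∀ r : Comp, sl2V K r.weight)
    (h : ∑ r, tau K r (v r) = 0) (r : Comp) : v r = 0 := by
  rw [sum_tau] at h
  obtain ⟨y, hy⟩ := (Submodule.Quotient.mk_eq_zero _).1 h
  exact eq_zero_of_sum_tauCochain_eq v y hy.symm r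

theorem exists_eq_sum_tau (h : HeisCohomology K) :
    ∃ v : ∀ r : Comp, sl2V K r.weight, h = ∑ r, tau K r (v r) := by
  obtain ⟨⟨x, hx⟩, rfl⟩ := (evenCoboundaries (heisBasis K)).mkQ_surjective h
  obtain ⟨v, y, hxy⟩ := exists_eq_sum_tauCochain x hx
  refine ⟨v, sub_eq_zero.1 ?_⟩
  rw [sum_tau, ← map_sub]
  exact mkQ_eq_zero_of_eq_differential y (sub_eq_iff_eq_add'.2 hxy)

/-- Independence applied to a family supported on the single component `r`. -/
theorem tau_injective (r : Comp) : Function.Injective (tau K r) := by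
  refine (injective_iff_map_eq_zero _).2 fun x hx => ?_
  have := eq_zero_of_sum_tau_eq_zero (Pi.single r x) ?_ r
  · rwa [Pi.single_eq_same] at this
  · rw [Finset.sum_eq_single r, Pi.single_eq_same, hx]
    · intro s _ hs
      rw [Pi.single_eq_of_ne hs, map_zero]
    · simp

theorem tau_isInternal : DirectSum.IsInternal fun r => LinearMap.range (tau K r) := by
  refine DirectSum.isInternal_submodule_of_iSupIndep_of_iSup_eq_top ?_ ?_
  · rw [iSupIndep_iff_finsetSum_eq_zero_imp_eq_zero]
    intro s v hv hsum
    -- The finite family is extended by zero to all ten components and lifted through the maps, so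
    -- that independence applies.
    have hw (r : Comp) : ∃ w : sl2V K r.weight, tau K r w = if r ∈ s then v r else 0 := by
      split_ifs with h
      · exact hv r h
      · exact ⟨0, map_zero _⟩
    choose w hw using hw
    have h0 := eq_zero_of_sum_tau_eq_zero w (by simpa [hw] using hsum)
    intro r hr
    have := hw r
    rwa [h0, map_zero, if_pos hr, eq_comm] at this
  · refine eq_top_iff.2 fun h _ => ?_
    obtain ⟨v, rfl⟩ := exists_eq_sum_tau h
    exact sum_mem fun r _ => Submodule.mem_iSup_of_mem r ⟨v r, rfl⟩

end Cohomology

end CupTable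

namespace CupTable

/-! ### The product of two monomial cochains -/

section Products

/-- The sign of the product of two monomials. -/
def monoMulSign : Fin 8 → Fin 8 → ℤ :=
  ![![1, 1, 1, 1, 1, 1, 1, 1],
    ![1, 0, 1, 1, 0, 0, 1, 0],
    ![1, -1, 0, 1, 0, -1, 0, 0],
    ![1, -1, -1, 0, 1, 0, 0, 0],
    ![1, 0, 0, 1, 0, 0, 0, 0],
    ![1, 0, -1, 0, 0, 0, 0, 0],
    ![1, 1, 0, 0, 0, 0, 0, 0],
    ![1, 0, 0, 0, 0, 0, 0, 0]]

/-- The index of the product of two monomials. -/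
def monoMulIndex : Fin 8 → Fin 8 → Fin 8 :=
  -- Where the product vanishes, the index is a dummy 0; the sign is 0 there.
  ![![0, 1, 2, 3, 4, 5, 6, 7],
    ![1, 0, 4, 5, 0, 0, 7, 0],
    ![2, 4, 0, 6, 0, 7, 0, 0],
    ![3, 5, 6, 0, 7, 0, 0, 0],
    ![4, 0, 0, 7, 0, 0, 0, 0],
    ![5, 0, 7, 0, 0, 0, 0, 0],
    ![6, 7, 0, 0, 0, 0, 0, 0],
    ![7, 0, 0, 0, 0, 0, 0, 0]]

variable {K : Type u} [Field K]

theorem extMonomial_mul {M : Type u} [AddCommGroup M] [Module K M] (b : Module.Basis (Fin 3) K M)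
    (i j : Fin 8) : extMonomial b i * extMonomial b j =
      monoMulSign i j • extMonomial b (monoMulIndex i j) := by
  have h : extMonomial b i * extMonomial b j = ![extMonomial b j,
      ExteriorAlgebra.ι K (b 0) * extMonomial b j, ExteriorAlgebra.ι K (b 1) * extMonomial b j,
      ExteriorAlgebra.ι K (b 2) * extMonomial b j,
      ExteriorAlgebra.ι K (b 0) * (ExteriorAlgebra.ι K (b 1) * extMonomial b j),
      ExteriorAlgebra.ι K (b 0) * (ExteriorAlgebra.ι K (b 2) * extMonomial b j),
      ExteriorAlgebra.ι K (b 1) * (ExteriorAlgebra.ι K (b 2) * extMonomial b j),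
      ExteriorAlgebra.ι K (b 0) * (ExteriorAlgebra.ι K (b 1) *
        (ExteriorAlgebra.ι K (b 2) * extMonomial b j))] i := by
    generalize extMonomial b j = x
    fin_cases i <;> simp [extMonomial, mul_assoc]
  rw [h]
  fin_cases i <;> fin_cases j <;>
    simp [ι_zero_mul_extMonomial, ι_one_mul_extMonomial, ι_two_mul_extMonomial, monoMulSign,
      monoMulIndex]

/-- The first factor is the Koszul sign for moving the `Λ𝔥` part of the left monomial past the `Λ𝔥*`
part of the right one; the other two sort the monomials inside each exterior algebra. -/
theorem mono_mul_mono (i j k l : Fin 8) : mono K i j * mono K k l =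
    ((-1) ^ (monoDegree j * monoDegree k) * (monoMulSign i k * monoMulSign j l)) •
      mono K (monoMulIndex i k) (monoMulIndex j l) := by
  have h := GradedTensorProduct.tmul_coe_mul_coe_tmul (R := K)
    (fun p : ℕ => ⋀[K]^p (Module.Dual K (Heisenberg K))) (fun q : ℕ => ⋀[K]^q (Heisenberg K))
    (extMonomial (heisDualBasis K) i) ⟨_, extMonomial_mem (heisBasis K) j⟩
    ⟨_, extMonomial_mem (heisDualBasis K) k⟩ (extMonomial (heisBasis K) l)
  change tens _ _ * tens _ _ = _ • tens (_ * _) (_ * _) at h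
  rw [mono, mono, h, extMonomial_mul, extMonomial_mul, mono]
  simp only [map_zsmul, LinearMap.smul_apply, smul_smul]
  rcases Int.units_eq_one_or ((-1 : ℤˣ) ^ (monoDegree j * monoDegree k)) with e | e
  · have e' : (-1 : ℤ) ^ (monoDegree j * monoDegree k) = 1 := by
      simpa using congrArg (Units.val) e
    rw [e, e', one_smul, one_mul, mul_comm]
  · have e' : (-1 : ℤ) ^ (monoDegree j * monoDegree k) = -1 := by
      simpa using congrArg (Units.val) e
    rw [e, e', Units.neg_smul, one_smul, neg_one_mul, neg_smul, mul_comm]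

end Products

end CupTable

namespace CupTable

/-! ### Monomial form of the weight vectors and of the values of the chosen bilinear maps -/

section WeightProducts

variable (K : Type u) [Field K]

open CupTable.Comp

theorem hwv_eq_mono : hwv K H011 = mono K 2 2 + mono K 1 1 + (2 : K) • mono K 3 3 ∧
    hwv K H211 = mono K 2 1 ∧ hwv K H120 = mono K 6 0 ∧ hwv K H102 = mono K 0 5 ∧
    hwv K H022 = mono K 4 4 ∧ hwv K H222 = mono K 6 5 ∧ hwv K H131 = mono K 7 1 ∧
    hwv K H113 = mono K 2 7 ∧ hwv K H033 = mono K 7 7 := by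
  simp only [← tauCochain_highestWeight]
  refine ⟨(tauCochain_H011 K 1).trans (one_smul _ _), ?_, (tauCochain_H120 K ![1, 0]).trans ?_,
    (tauCochain_H102 K ![1, 0]).trans ?_, (tauCochain_H022 K 1).trans (one_smul _ _), ?_,
    (tauCochain_H131 K ![1, 0]).trans ?_, (tauCochain_H113 K ![1, 0]).trans ?_,
    (tauCochain_H033 K 1).trans (one_smul _ _)⟩
  · refine (congrArg (tauCochain K H211) sl2HighestWeight_two).trans ?_
    simp [tauCochain_H211]
  · simp
  · simp
  · refine (congrArg (tauCochain K H222) sl2HighestWeight_two).trans ?_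
    simp [tauCochain_H222]
  · simp
  · simp

/-- The image of the lowest weight vector in the component `r`. -/
noncomputable def lwv (r : Comp) : Cochain K (Heisenberg K) :=
  tauCochain K r (sl2LowestWeight r.weight)

theorem lwv_eq_mono : lwv K H011 = mono K 2 2 + mono K 1 1 + (2 : K) • mono K 3 3 ∧
    lwv K H211 = mono K 1 2 ∧ lwv K H120 = -mono K 5 0 ∧ lwv K H102 = mono K 0 6 ∧
    lwv K H022 = mono K 4 4 ∧ lwv K H222 = mono K 5 6 ∧ lwv K H131 = mono K 7 2 ∧
    lwv K H113 = -mono K 1 7 ∧ lwv K H033 = mono K 7 7 := by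
  refine ⟨(tauCochain_H011 K 1).trans (one_smul _ _), (tauCochain_H211 K 0 0 1).trans ?_,
    (tauCochain_H120 K ![0, 1]).trans ?_, (tauCochain_H102 K ![0, 1]).trans ?_,
    (tauCochain_H022 K 1).trans (one_smul _ _), (tauCochain_H222 K 0 0 1).trans ?_,
    (tauCochain_H131 K ![0, 1]).trans ?_, (tauCochain_H113 K ![0, 1]).trans ?_,
    (tauCochain_H033 K 1).trans (one_smul _ _)⟩ <;> simp

/-- The image in the component `s` of the value of the chosen bilinear map `V i × V j → V k` at a
highest and a lowest weight vector. -/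
noncomputable def bilinWeight (i j : Fin 3) (s : Comp) : Cochain K (Heisenberg K) :=
  tauCochain K s (sl2Bilin K i j s.weight (sl2HighestWeight K i) (sl2LowestWeight j))

theorem bilinWeight_zero :
    bilinWeight K 0 0 H022 = mono K 4 4 ∧ bilinWeight K 0 0 H033 = mono K 7 7 ∧
    bilinWeight K 0 1 H131 = mono K 7 2 ∧ bilinWeight K 0 1 H113 = -mono K 1 7 ∧
    bilinWeight K 0 2 H222 = mono K 5 6 ∧ bilinWeight K 1 0 H131 = mono K 7 1 ∧
    bilinWeight K 1 0 H113 = mono K 2 7 ∧ bilinWeight K 2 0 H222 = mono K 6 5 := by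
  obtain ⟨-, -, -, -, -, h222, h131, h113, -⟩ := hwv_eq_mono K
  obtain ⟨-, -, -, -, -, l222, l131, l113, -⟩ := lwv_eq_mono K
  rw [← tauCochain_highestWeight] at h222 h131 h113
  exact ⟨(congrArg (tauCochain K H022) (mul_one (1 : K))).trans
      ((tauCochain_H022 K 1).trans (one_smul _ _)),
    (congrArg (tauCochain K H033) (mul_one (1 : K))).trans
      ((tauCochain_H033 K 1).trans (one_smul _ _)),
    (congrArg (tauCochain K H131) (one_smul K (![0, 1] : Fin 2 → K))).trans l131,
    (congrArg (tauCochain K H113) (one_smul K (![0, 1] : Fin 2 → K))).trans l113,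
    (congrArg (tauCochain K H222) (one_smul K (slMk (0 : K) 0 1))).trans l222,
    (congrArg (tauCochain K H131) (one_smul K (![1, 0] : Fin 2 → K))).trans h131,
    (congrArg (tauCochain K H113) (one_smul K (![1, 0] : Fin 2 → K))).trans h113,
    (congrArg (tauCochain K H222) (one_smul K (sl2HighestWeight K 2))).trans h222⟩

theorem bilinWeight_pos :
    bilinWeight K 1 1 H022 = mono K 4 4 ∧ bilinWeight K 1 1 H222 = mono K 5 5 - mono K 6 6 ∧
    bilinWeight K 1 1 H033 = mono K 7 7 ∧
    bilinWeight K 2 2 H022 = mono K 4 4 ∧ bilinWeight K 2 2 H033 = mono K 7 7 ∧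
    bilinWeight K 2 1 H131 = mono K 7 1 ∧ bilinWeight K 2 1 H113 = mono K 2 7 ∧
    bilinWeight K 1 2 H131 = mono K 7 2 ∧ bilinWeight K 1 2 H113 = -mono K 1 7 := by
  obtain ⟨-, -, -, -, -, -, h131, h113, -⟩ := hwv_eq_mono K
  obtain ⟨-, -, -, -, -, -, l131, l113, -⟩ := lwv_eq_mono K
  rw [← tauCochain_highestWeight] at h131 h113
  refine ⟨(congrArg (tauCochain K H022) (m110_weight (K := K))).trans
      ((tauCochain_H022 K 1).trans (one_smul _ _)),
    (congrArg (tauCochain K H222) (m112_weight (K := K))).trans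
      ((tauCochain_H222 K 1 0 0).trans ?_),
    (congrArg (tauCochain K H033) (m110_weight (K := K))).trans
      ((tauCochain_H033 K 1).trans (one_smul _ _)),
    (congrArg (tauCochain K H022) (m220_weight (K := K))).trans
      ((tauCochain_H022 K 1).trans (one_smul _ _)),
    (congrArg (tauCochain K H033) (m220_weight (K := K))).trans
      ((tauCochain_H033 K 1).trans (one_smul _ _)),
    (congrArg (tauCochain K H131) (m211_weight (K := K))).trans h131,
    (congrArg (tauCochain K H113) (m211_weight (K := K))).trans h113,
    (congrArg (tauCochain K H131) (m211_flip_weight (K := K))).trans l131,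
    (congrArg (tauCochain K H113) (m211_flip_weight (K := K))).trans l113⟩
  simp [sub_eq_add_neg]

theorem sl2Bilin_zero_left (k : Fin 3) (y : sl2V K k) :
    sl2Bilin K 0 k k (sl2HighestWeight K 0) y = y := by
  fin_cases k <;> exact one_smul K _

theorem sl2Bilin_zero_right (k : Fin 3) (x : sl2V K k) :
    sl2Bilin K k 0 k x (sl2LowestWeight 0) = x := by
  fin_cases k
  · exact mul_one (M := K) x
  · exact one_smul K (show Fin 2 → K from x)
  · exact one_smul K (show SL2Lie K from x)

end WeightProducts

end CupTable

namespace CupTable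

/-! ### The table at the level of cochains, on one pair of weight vectors -/

section CupProduct

variable {K : Type u} [Field K]

open CupTable.Comp

/-- A finite check of 81 pairs, each a multiplication of at most three monomials by at most three.
The unit component is treated separately. -/
theorem hwv_mul_lwv [CharZero K] (r₁ r₂ : Comp) (h₁ : r₁ ≠ H000) (h₂ : r₂ ≠ H000) :
    ∃ y, hwv K r₁ * lwv K r₂ = ∑ s, cupCoeff K r₁ r₂ s • bilinWeight K r₁.weight r₂.weight s +
      differential (heisBasis K) y := by
  obtain ⟨z1, z2, z3, z4, z5, z6, z7, z8⟩ := bilinWeight_zero K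
  obtain ⟨p1, p2, p3, p4, p5, p6, p7, p8, p9⟩ := bilinWeight_pos K
  obtain ⟨a1, a2, a3, a4, a5, a6, a7, a8, a9⟩ := hwv_eq_mono K
  obtain ⟨b1, b2, b3, b4, b5, b6, b7, b8, b9⟩ := lwv_eq_mono K
  obtain ⟨-, -, -, -, -, hd, -⟩ := differential_mono_coboundary (K := K)
  -- Only three products leave the span of the representatives. `H_0^{1,1} ∨ H_0^{1,1}` gives `-2`
  -- times the `(4,4)` monomial and `-4` times the sum of `(5,5)` and `(6,6)`; replacing that sum by
  -- `(4,4)` modulo `d` yields `-6`. The two mixed products of `H_1^{2,0}` and `H_1^{0,2}` give a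
  -- single monomial, `(6,6)` or minus `(5,5)`, whose symmetric half is exact up to a multiple of
  -- `(4,4)`.
  refine ⟨(match r₁, r₂ with
    | H011, H011 => -4
    | H120, H102 => 1 / 2
    | H102, H120 => -(1 / 2)
    | _, _ => 0 : K) • mono K 3 4, ?_⟩
  rw [map_smul, hd, Comp.sum_univ]
  cases r₁ <;> cases r₂ <;> first | exact absurd rfl h₁ | exact absurd rfl h₂ | skip
  all_goals
    dsimp only [cupCoeff, Comp.weight]
    simp only [zero_smul, zero_add, add_zero, one_smul, neg_smul,
      a1, a2, a3, a4, a5, a6, a7, a8, a9, b1, b2, b3, b4, b5, b6, b7, b8, b9,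
      z1, z2, z3, z4, z5, z6, z7, z8, p1, p2, p3, p4, p5, p6, p7, p8, p9, mul_neg, mul_add, add_mul,
      smul_mul_assoc, mul_smul_comm, mono_mul_mono]
    simp [monoDegree, monoMulSign, monoMulIndex]
  all_goals try module

end CupProduct

end CupTable

namespace CupTable

/-! ### From one pair of weight vectors to the full table, and its uniqueness -/

section CupProduct

variable {K : Type u} [Field K]

open CupTable.Comp

theorem hwv_mul_lwv_eq [CharZero K] (r₁ r₂ : Comp) :
    ∃ y, hwv K r₁ * lwv K r₂ = ∑ s, cupCoeff K r₁ r₂ s • bilinWeight K r₁.weight r₂.weight s +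
      differential (heisBasis K) y := by
  by_cases h₁ : r₁ = H000
  · subst h₁
    refine ⟨0, ?_⟩
    simp only [cupCoeff, ite_smul, one_smul, zero_smul, Finset.sum_ite_eq, Finset.mem_univ, if_true,
      map_zero, add_zero]
    exact (one_mul _).trans (congrArg (tauCochain K r₂) (sl2Bilin_zero_left K _ _).symm)
  by_cases h₂ : r₂ = H000
  · subst h₂
    refine ⟨0, ?_⟩
    have h : ∀ s, cupCoeff K r₁ H000 s = if r₁ = s then 1 else 0 := by
      intro s; cases r₁ <;> rfl
    simp only [h, ite_smul, one_smul, zero_smul, Finset.sum_ite_eq, Finset.mem_univ, if_true,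
      map_zero, add_zero]
    rw [bilinWeight]
    refine Eq.trans ?_ (congrArg (tauCochain K r₁) (sl2Bilin_zero_right K _ _).symm)
    rw [tauCochain_highestWeight, lwv]
    exact (congrArg (hwv K r₁ * ·) ((tauCochain_H000 K 1).trans (one_smul _ _))).trans (mul_one _)
  exact hwv_mul_lwv r₁ r₂ h₁ h₂

/-- The group acts on cochains by algebra automorphisms of `Λ𝔥* ⊗ Λ𝔥`, and this passes to classes.
-/
theorem cohomologyRep_cup (g : SL2 K) (x y : HeisCohomology K) :
    cohomologyRep K g (cup (heisBasis K) x y) =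
      cup (heisBasis K) (cohomologyRep K g x) (cohomologyRep K g y) := by
  obtain ⟨x, rfl⟩ := (evenCoboundaries (heisBasis K)).mkQ_surjective x
  obtain ⟨y, rfl⟩ := (evenCoboundaries (heisBasis K)).mkQ_surjective y
  exact congrArg (evenCoboundaries (heisBasis K)).mkQ (Subtype.ext (cochainMap_mul _ _ _ _))

theorem isGTable_tau_iff (c : ∀ r₁ r₂ s : Comp, Fin (sl2Dim r₁.weight r₂.weight s.weight) → K) :
    IsGTable (sl2Labeling K) (cup (heisBasis K)) Comp.weight (tau K) c ↔
      ∀ (r₁ r₂ : Comp) (x : sl2V K r₁.weight) (y : sl2V K r₂.weight),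
        cup (heisBasis K) (tau K r₁ x) (tau K r₂ y) =
          ∑ s, tau K s (∑ q, c r₁ r₂ s q •
            sl2Bilin K r₁.weight r₂.weight s.weight x y) := by
  simp only [map_sum, map_smul]
  rfl

variable [CharZero K]

theorem cup_tau_weight (r₁ r₂ : Comp) :
    cup (heisBasis K) (tau K r₁ (sl2HighestWeight K _)) (tau K r₂ (sl2LowestWeight _)) =
      ∑ s, cupCoeff K r₁ r₂ s • tau K s (sl2Bilin K r₁.weight r₂.weight s.weight
        (sl2HighestWeight K _) (sl2LowestWeight _)) := by
  obtain ⟨y, hy⟩ := hwv_mul_lwv_eq (K := K) r₁ r₂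
  simp only [← map_smul]
  rw [sum_tau, tau_apply, tau_apply, cup_mk, ← sub_eq_zero, ← map_sub]
  refine mkQ_eq_zero_of_eq_differential y (sub_eq_iff_eq_add'.2 ?_)
  simp only [map_smul]
  rw [← tauCochain_highestWeight] at hy
  exact hy

/-- Both sides are equivariant bilinear maps into cohomology, so their difference vanishes once it
vanishes at `(v₊, v₋)`, which is the cochain computation. -/
theorem cup_tau (r₁ r₂ : Comp) (x : sl2V K r₁.weight) (y : sl2V K r₂.weight) :
    cup (heisBasis K) (tau K r₁ x) (tau K r₂ y) =
      ∑ s, cupCoeff K r₁ r₂ s • tau K s (sl2Bilin K r₁.weight r₂.weight s.weight x y) := by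
  have h := bilin_eq_zero (cohomologyRep K) ((cup (heisBasis K)).compl₁₂ (tau K r₁) (tau K r₂) -
    ∑ s, cupCoeff K r₁ r₂ s • (sl2Bilin K r₁.weight r₂.weight s.weight).compr₂ (tau K s))
    (fun g x y => ?_) ?_
  · have := LinearMap.congr_fun₂ h x y
    simpa [LinearMap.sum_apply, sub_eq_zero] using this
  · simp only [LinearMap.sub_apply, LinearMap.compl₁₂_apply, LinearMap.sum_apply,
      LinearMap.smul_apply, LinearMap.compr₂_apply, (tau_intertwining _).1 g,
      sl2Bilin_equivariant, map_sub, map_sum, map_smul, cohomologyRep_cup]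
  · simp only [LinearMap.sub_apply, LinearMap.compl₁₂_apply, LinearMap.sum_apply,
      LinearMap.smul_apply, LinearMap.compr₂_apply, cup_tau_weight, sub_self]

/-- Both families send the highest weight vectors to the same classes, and these vectors generate
the representations. -/
theorem eq_tau_of_isHighestWeightFamily
    {τ : ∀ r : Comp, (sl2Labeling K).V r.weight →ₗ[K] HeisCohomology K}
    (h : IsHighestWeightFamily K τ) : τ = tau K := by
  funext r
  refine eq_of_highestWeight (cohomologyRep K) (h r).1 (tau_intertwining r) ?_
  obtain ⟨_, h1⟩ := (h r).2
  obtain ⟨_, h2⟩ := (tau_isHighestWeightFamily (K := K) r).2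
  exact h1.symm.trans h2

/-- The multiplicity spaces have dimension 0 or 1. In the first case the inner sum is empty and the
chosen bilinear map is zero, so the terms agree whatever the coefficient. -/
theorem cup_tau_eq_sum (r₁ r₂ : Comp) (x : sl2V K r₁.weight) (y : sl2V K r₂.weight) :
    cup (heisBasis K) (tau K r₁ x) (tau K r₂ y) =
      ∑ s, tau K s (∑ _ : Fin (sl2Dim r₁.weight r₂.weight s.weight), cupCoeff K r₁ r₂ s •
        sl2Bilin K r₁.weight r₂.weight s.weight x y) := by
  rw [cup_tau]
  refine Finset.sum_congr rfl fun s _ => ?_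
  rw [Finset.sum_const, Finset.card_univ, Fintype.card_fin]
  rcases Nat.le_one_iff_eq_zero_or_eq_one.1 (sl2Dim_le_one r₁.weight r₂.weight s.weight) with h | h
  · rw [sl2Bilin_eq_zero _ _ _ h, LinearMap.zero_apply, LinearMap.zero_apply, map_zero, smul_zero,
      smul_zero, smul_zero, map_zero]
  · rw [h, one_smul, map_smul]

/-- Two tables are compared at `(v₊, v₋)`: directness of the sum isolates the component `s`, and the
chosen map does not vanish there, so the coefficients agree. Where the multiplicity is 0 there is no
coefficient to determine. -/
theorem isGTable_iff (c : ∀ r₁ r₂ s : Comp, Fin (sl2Dim r₁.weight r₂.weight s.weight) → K) :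
    IsGTable (sl2Labeling K) (cup (heisBasis K)) Comp.weight (tau K) c ↔ c = cupTable K := by
  refine Iff.trans (isGTable_tau_iff c) ⟨fun h => ?_, fun h => ?_⟩
  · funext r₁ r₂ s q
    have h1 := (h r₁ r₂ (sl2HighestWeight K _) (sl2LowestWeight _)).symm.trans
      (cup_tau_eq_sum r₁ r₂ (sl2HighestWeight K _) (sl2LowestWeight _))
    rw [← sub_eq_zero, ← Finset.sum_sub_distrib] at h1
    simp only [← map_sub, ← Finset.sum_sub_distrib, ← sub_smul] at h1
    have h2 := eq_zero_of_sum_tau_eq_zero _ h1 s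
    have : Subsingleton (Fin (sl2Dim r₁.weight r₂.weight s.weight)) :=
      Fin.subsingleton_iff_le_one.2 (sl2Dim_le_one _ _ _)
    rw [Fintype.sum_subsingleton _ q] at h2
    exact sub_eq_zero.1 ((smul_eq_zero.1 h2).resolve_right
      (sl2Bilin_weight_ne_zero _ _ _ (Nat.pos_iff_ne_zero.1 q.pos)))
  · subst h
    exact cup_tau_eq_sum

end CupProduct

end CupTable

theorem mainTheorem3 (K : Type u) [Field K] [CharZero K] :
    (CupTable.sl2Labeling K).IsLabeling ∧
    CupTable.ActsByAlgebraAutomorphisms (CupTable.cohomologyRep K)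
      (CupTable.cup (CupTable.heisBasis K)) ∧
    (∃! τ : ∀ r : CupTable.Comp,
        (CupTable.sl2Labeling K).V r.weight →ₗ[K] CupTable.HeisCohomology K,
      CupTable.IsHighestWeightFamily K τ) ∧
    ∀ τ : ∀ r : CupTable.Comp,
        (CupTable.sl2Labeling K).V r.weight →ₗ[K] CupTable.HeisCohomology K,
      CupTable.IsHighestWeightFamily K τ →
        CupTable.IsGDecomposition (CupTable.sl2Labeling K) (CupTable.cohomologyRep K)
          CupTable.Comp.weight τ ∧
        (∀ r : CupTable.Comp, LinearMap.range (τ r) ≤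
          CupTable.cohomology (CupTable.heisBasis K) r.bidegree.1 r.bidegree.2) ∧
        ∀ c : ∀ r₁ r₂ s : CupTable.Comp,
            Fin ((CupTable.sl2Labeling K).d r₁.weight r₂.weight s.weight) → K,
          CupTable.IsGTable (CupTable.sl2Labeling K) (CupTable.cup (CupTable.heisBasis K))
            CupTable.Comp.weight τ c ↔ c = CupTable.cupTable K := by
  refine ⟨CupTable.sl2Labeling_isLabeling, CupTable.cohomologyRep_cup,
    ⟨CupTable.tau K, CupTable.tau_isHighestWeightFamily,
      fun τ hτ => CupTable.eq_tau_of_isHighestWeightFamily hτ⟩, fun τ hτ => ?_⟩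
  -- By uniqueness, every assertion about an arbitrary family concerns the explicit one.
  obtain rfl := CupTable.eq_tau_of_isHighestWeightFamily hτ
  exact ⟨⟨CupTable.tau_intertwining, CupTable.tau_injective, CupTable.tau_isInternal⟩,
    CupTable.range_tau_le, CupTable.isGTable_iff⟩
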